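/- Let $K$ be a totally real number field with ring of integers $\mathcal O_K$, and let $\mathcal A=\left(\frac{a,b}{K}\right)$ be a (totally) definite quaternion algebra over $K$, i.e. one whose reduced norm $\mathrm{nrd}$ takes totally positive values at all nonzero elements (an element of $K$ is totally positive if its image under every embedding $K\to\mathbb R$ is positive). An order is a subring of $\mathcal A$ that is also an $\mathcal O_K$-lattice (a finitely generated $\mathcal O_K$-submodule spanning $\mathcal A$ over $K$). For an order $\mathcal O$ put $\mathcal O^1=\{u\in\mathcal O:\mathrm{nrd}(u)=1\}$ and, for totally positive $\alpha\in\mathcal O_K$, $r_{\mathcal O}(\alpha)=\#\{x\in\mathcal O:\mathrm{nrd}(x)=\alpha\}$. The class number of $\mathcal O$ is the number of classes of lattices $L\subset\mathcal A$ with right order $\{x\in\mathcal A: Lx\subseteq L\}=\mathcal O$, where $L\sim M$ if $L=xM$ for some $x\in\mathcal A^\times$. The reduced discriminant $\mathrm{discrd}(\mathcal O)$ is the ideal of $\mathcal O_K$ generated by all $\mathrm{trd}((xy-yx)\bar z)$ with $x,y,z\in\mathcal O$. **Theorem.** Let $\mathcal H\subset\mathcal A$ be a maximal order with reduced discriminant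 $\mathfrak D$, and let $\mathcal G\subseteq\mathcal H$ be an order of class number $1$ that is perceptive in $\mathcal H$, i.e. for every $x\in\mathcal H$ there is $u\in\mathcal H^1$ with $ux\in\mathcal G$. Suppose that $\mathcal H/\mathcal G\simeq\mathcal O_K/\mathfrak q^2$ as $\mathcal O_K$-modules for a nonzero prime ideal $\mathfrak q\nmid\mathfrak D$, and let $q=\mathrm N(\mathfrak q)=\#(\mathcal O_K/\mathfrak q)$. Let $\alpha\in\mathcal O_K$ be totally positive and let $e\ge 0$ satisfy $\alpha\in\mathfrak q^e$, $\alpha\notin\mathfrak q^{e+1}$. Then $\mathcal G^1$ and $\{x\in\mathcal G:\mathrm{nrd}(x)=\alpha\}$ are finite and $$ r_{\mathcal G}(\alpha)=\#\mathcal G^1\cdot\sigma_{\mathfrak q\mathfrak D}(\alpha)\cdot \begin{cases}1,&e=0,\\ 2q,&e=1,\\ 2(q+q^2+\cdots+q^e)+q^e-q,&e\ge2,\end{cases} $$ where $\sigma_{\mathfrak q\mathfrak D}(\alpha)=\sum_{\delta}\mathrm N(\delta)$, the sum running over the ideals $\delta$ of $\mathcal O_K$ that divide $\alpha\mathcal O_K$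 and are divisible neither by $\mathfrak q$ nor by any prime ideal dividing $\mathfrak D$. -/

import Mathlib

open scoped Quaternion NumberField

noncomputable section

namespace QuatOrder

/-- An element of a totally real number field is totally positive if every real embedding
sends it to a positive number. -/
def IsTotallyPositive {K : Type*} [Field K] (x : K) : Prop :=
  ∀ σ : K →+* ℝ, 0 < σ x

/-- The quaternion algebra `(a, b / K)`: it has basis `1, i, j, k` with `i² = a`, `j² = b`,
`k = i j = - j i`. This is a copy of Mathlib's `ℍ[K,a,b]` with the same ring and `K`-algebra
structure and the same standard involution; its `𝓞 K`-algebra structure is the restriction of the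
`K`-algebra structure. -/
def Quat (K : Type*) [Field K] (a b : K) : Type _ := ℍ[K,a,b]

instance (K : Type*) [Field K] (a b : K) : Ring (Quat K a b) :=
  inferInstanceAs (Ring ℍ[K,a,b])

instance (K : Type*) [Field K] (a b : K) : Algebra K (Quat K a b) :=
  inferInstanceAs (Algebra K ℍ[K,a,b])

instance (K : Type*) [Field K] (a b : K) : StarRing (Quat K a b) :=
  inferInstanceAs (StarRing ℍ[K,a,b])

section Algebra

variable {K : Type*} [Field K] {a b : K}

/-- The reduced norm `q * star q = t² - a x² - b y² + a b z²`; the product lies in the base field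
(see `mul_star_eq_nrd`), so it is given by its scalar part. -/
def nrd (q : Quat K a b) : K := QuaternionAlgebra.re (q * star q)

/-- The reduced trace `q + star q = 2 t`, which lies in the base field
(see `add_star_eq_trd`). -/
def trd (q : Quat K a b) : K := QuaternionAlgebra.re (q + star q)

theorem mul_star_eq_nrd (q : Quat K a b) : q * star q = algebraMap K (Quat K a b) (nrd q) := by
  have h : ∀ x : ℍ[K,a,b], x * star x = algebraMap K ℍ[K,a,b] (x * star x).re := by
    intro x
    ext <;> simp <;> ring
  exact h q

theorem add_star_eq_trd (q : Quat K a b) : q + star q = algebraMap K (Quat K a b) (trd q) := by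
  have h : ∀ x : ℍ[K,a,b], x + star x = algebraMap K ℍ[K,a,b] (x + star x).re := by
    intro x
    ext <;> simp
  exact h q

theorem nrd_mk (t x y z : K) :
    nrd (a := a) (b := b) (⟨t, x, y, z⟩ : ℍ[K,a,b]) =
      t ^ 2 - a * x ^ 2 - b * y ^ 2 + a * b * z ^ 2 := by
  have h : ((⟨t, x, y, z⟩ : ℍ[K,a,b]) * star (⟨t, x, y, z⟩ : ℍ[K,a,b])).re =
      t ^ 2 - a * x ^ 2 - b * y ^ 2 + a * b * z ^ 2 := by
    simp; ring
  exact h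

variable (K a b) in
/-- The quaternion algebra `(a, b / K)` over a totally real field is (totally) definite: the
reduced norm is a totally positive definite quadratic form. This forces `a` and `b` to be
nonzero (their negatives are reduced norms of `i` and `j`). -/
def IsDefinite : Prop := ∀ q : Quat K a b, q ≠ 0 → IsTotallyPositive (nrd q)

end Algebra

section Orders

variable {K : Type*} [Field K] {a b : K}

/-- An `𝓞 K`-lattice in the quaternion algebra: a finitely generated `𝓞 K`-submodule that
spans the algebra over `K`. -/
structure IsLattice (L : Submodule (𝓞 K) (Quat K a b)) : Prop where
  fg : L.FG
  span_eq_top : Submodule.span K (L : Set (Quat K a b)) = ⊤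

/-- An `𝓞 K`-order: a subring of the quaternion algebra that is an `𝓞 K`-lattice. -/
def IsOrder (O : Subalgebra (𝓞 K) (Quat K a b)) : Prop :=
  IsLattice (Subalgebra.toSubmodule O)

/-- A maximal order, i.e. one maximal with respect to inclusion among orders. -/
def IsMaximalOrder (O : Subalgebra (𝓞 K) (Quat K a b)) : Prop :=
  Maximal IsOrder O

/-- The right order `{x | L x ⊆ L}` of a submodule `L`. -/
def rightOrder (L : Submodule (𝓞 K) (Quat K a b)) : Subalgebra (𝓞 K) (Quat K a b) where
  carrier := {x | ∀ y ∈ L, y * x ∈ L}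
  mul_mem' := fun {x z} hx hz y hy => by
    rw [← mul_assoc]
    exact hz _ (hx y hy)
  add_mem' := fun {x z} hx hz y hy => by
    rw [mul_add]
    exact L.add_mem (hx y hy) (hz y hy)
  algebraMap_mem' := fun r y hy => by
    rw [← Algebra.commutes, ← Algebra.smul_def]
    exact L.smul_mem r hy

variable (K a b) in
/-- Right equivalence: `L ∼ M` if `L = x M` for some invertible `x` of the algebra. -/
def rightEquivalence : Setoid (Submodule (𝓞 K) (Quat K a b)) where
  r L M := ∃ x : (Quat K a b)ˣ, L = M.map (LinearMap.mulLeft (𝓞 K) (x : Quat K a b))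
  iseqv := by
    refine ⟨fun L => ⟨1, ?_⟩, ?_, ?_⟩
    · simp
    · rintro L M ⟨x, rfl⟩
      refine ⟨x⁻¹, ?_⟩
      rw [← Submodule.map_comp, ← LinearMap.mulLeft_mul]
      simp
    · rintro L M N ⟨x, rfl⟩ ⟨y, rfl⟩
      refine ⟨x * y, ?_⟩
      rw [← Submodule.map_comp, ← LinearMap.mulLeft_mul]
      simp

/-- The (right) class set of `O`: the right equivalence classes of the lattices whose right
order is `O`. -/
def classSet (O : Subalgebra (𝓞 K) (Quat K a b)) : Set (Quotient (rightEquivalence K a b)) :=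
  {c | ∃ L : Submodule (𝓞 K) (Quat K a b), IsLattice L ∧ rightOrder L = O ∧
    c = Quotient.mk (rightEquivalence K a b) L}

/-- The class number of an order. -/
def classNumber (O : Subalgebra (𝓞 K) (Quat K a b)) : ℕ := (classSet O).ncard

/-- The set of elements of reduced norm `α` in `O`. -/
def normFiber (O : Subalgebra (𝓞 K) (Quat K a b)) (α : 𝓞 K) : Set (Quat K a b) :=
  {q | q ∈ O ∧ nrd q = (α : K)}

/-- The number `r_O(α)` of elements of reduced norm `α` in `O`. -/
def rep (O : Subalgebra (𝓞 K) (Quat K a b)) (α : 𝓞 K) : ℕ := (normFiber O α).ncard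

/-- The set `O¹` of elements of reduced norm `1` in `O`. -/
def normOne (O : Subalgebra (𝓞 K) (Quat K a b)) : Set (Quat K a b) := {u | u ∈ O ∧ nrd u = 1}

/-- `G` is `H`-perceptive: `G ⊆ H` and every orbit `H¹ q` with `q ∈ H` meets `G`. -/
def IsPerceptive (G H : Subalgebra (𝓞 K) (Quat K a b)) : Prop :=
  G ≤ H ∧ ∀ q ∈ H, ∃ u ∈ normOne H, u * q ∈ G

/-- The reduced discriminant of an order: the ideal generated by all
`trd ((x y - y x) * star z)` with `x, y, z` in the order (for an order these elements of `K`
all lie in `𝓞 K`). -/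
def discrd (O : Subalgebra (𝓞 K) (Quat K a b)) : Ideal (𝓞 K) :=
  Ideal.span {d | ∃ x ∈ O, ∃ y ∈ O, ∃ z ∈ O, (d : K) = trd ((x * y - y * x) * star z)}

end Orders

/-- `σ_𝔇(α)`: the sum of the norms of the ideals `δ` dividing `α 𝓞 K` that are divisible by no
prime divisor of `𝔇` (a finite sum for `α ≠ 0`). -/
def sigma {K : Type*} [Field K] [NumberField K] (𝔇 : Ideal (𝓞 K)) (α : 𝓞 K) : ℕ :=
  ∑ᶠ (δ : Ideal (𝓞 K)) (_ : δ ∣ Ideal.span {α} ∧ ∀ 𝔭 : Ideal (𝓞 K), Prime 𝔭 → 𝔭 ∣ 𝔇 → ¬ 𝔭 ∣ δ),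
    Ideal.absNorm δ

/-- The local factor `1`, `2 q`, `2 (q + ⋯ + q^e) + q^e - q` for `e = 0`, `e = 1`, `e ≥ 2`. -/
def localFactor (q : ℤ) (e : ℕ) : ℤ :=
  if e = 0 then 1
  else if e = 1 then 2 * q
  else 2 * (∑ i ∈ Finset.Icc 1 e, q ^ i) + q ^ e - q

end QuatOrder

end

/-!
The count in `𝒢` is reduced to a count in the maximal order `ℋ`, and the latter to the
structure of the left ideals above the primes of the base field `K`.

*Principal left ideals.* If a left ideal `J` of `ℋ` contains a scalar prime to `𝔮`, then `J ∩ 𝒢`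
has left order exactly `𝒢`, so it is principal by class number one, and perceptivity moves every
element of `J` into `𝒢` by a unit of norm one, so a generator of `J ∩ 𝒢` generates `J`
(`exists_eq_span`). At `𝔮` itself one multiplies a given left ideal into one containing a scalar
prime to `𝔮` (`StdInvolution.exists_sup_eq_span`); this uses that the trace form is nondegenerate
at `𝔮`, since `𝔮` does not divide the discriminant. Modulo any prime `𝔭` there are zero divisors,
because `ℋ / 𝔭 ℋ` has dimension four and is thus not a field of degree two. Hence every prime `𝔭`
has a generator that is a reduced norm, in particular a totally positive one.

*Units.* As all primes have totally positive generators, every nonzero integer is a unit times a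
totally positive integer, so that the units realize all sign vectors by weak approximation. By
Dirichlet's unit theorem there are no more classes of units modulo squares than sign vectors, so
totally positive units are squares (`exists_sq_eq_of_isTotallyPositive`). Every totally positive
generator `π` of `𝔭` is therefore the norm of a generator of each left ideal spanned by `𝔭` and a
zero divisor (`IsOrder.PrincipalAtPrimes.isGoodPrime`).

*Counting in `ℋ`.* The number of left ideals `ℋ y` with `nrd y = π` is `1` or `N(𝔭) + 1`,
according to whether `𝔭` divides the discriminant or not
(`StdInvolution.IsGoodPrime.ncard_normIdeals`), and an element of norm divisible by `π` lies in
exactly one of them, unless it is divisible by `π`, in which case it lies in all. Counting pairs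
of an element and such an ideal gives the recursion for `r_ℋ(π ^ e γ)` that is also satisfied by
`σ_𝔇`, whence `r_ℋ(α) = #ℋ¹ σ_𝔇(α)` (`IsOrder.PrincipalAtPrimes.repNum_eq`).

*Counting in `𝒢`.* Let `β` generate `𝔮`. By nondegeneracy of the trace form at `𝔮`, the suborder
is `{z | β² ∣ trd (z m)}` for some `m`. Let `M` and `L` be the left annihilators of `m` modulo `β`
and modulo `β²`; they are generated by elements of norm `β` and `β²`, and `𝒢 = 𝓞 K + L`. Up to
`ℋ¹` an element of `ℋ` is a scalar modulo `L`, so the number of units `u ∈ ℋ¹` with `u x ∈ 𝒢`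
depends only on whether `x` lies in `L`, in `M` outside `L`, or outside `M`. Double counting on
`ℋ / L` determines the three values up to a common factor `#𝒢¹`, and double counting on the elements
of norm `α` gives `q (q + 1) r_𝒢(α) = r_ℋ(α) + (q - 1) r_ℋ(α / β) + q² r_ℋ(α / β²)` after division
by `#𝒢¹` (`StdInvolution.IsPerceptiveSub.repSub_mul`). The stated local factor results by summing
geometric series (`StdInvolution.IsPerceptiveSub.repSub_eq`).
-/

noncomputable section

namespace QuatOrder

/-! ### Reduced norm, reduced trace and commutators in a quaternion algebra -/

section Algebra

variable {K : Type*} [Field K] {a b : K}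

theorem nrd_eq (x : Quat K a b) : nrd x = QuaternionAlgebra.re x ^ 2
    - a * QuaternionAlgebra.imI x ^ 2 - b * QuaternionAlgebra.imJ x ^ 2
    + a * b * QuaternionAlgebra.imK x ^ 2 :=
  nrd_mk _ _ _ _

theorem trd_eq (x : Quat K a b) : trd x = 2 * QuaternionAlgebra.re x := by
  have h : ∀ x : ℍ[K,a,b], (x + star x).re = 2 * x.re := by
    intro x; simp; ring
  exact h x

theorem algebraMap_injective : Function.Injective (algebraMap K (Quat K a b)) := by
  intro x y h
  have h' : (algebraMap K ℍ[K,a,b] x) = algebraMap K ℍ[K,a,b] y := h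
  simpa using congrArg QuaternionAlgebra.re h'

theorem star_algebraMap (c : K) :
    star (algebraMap K (Quat K a b) c) = algebraMap K (Quat K a b) c := by
  have h : star (algebraMap K ℍ[K,a,b] c) = algebraMap K ℍ[K,a,b] c := by
    ext <;> simp
  exact h

theorem star_smul_quat (c : K) (x : Quat K a b) : star (c • x) = c • star x := by
  rw [Algebra.smul_def, star_mul, star_algebraMap, ← Algebra.commutes, ← Algebra.smul_def]

theorem star_eq (x : Quat K a b) : star x = algebraMap K _ (trd x) - x := by
  rw [← add_star_eq_trd]; abel

theorem star_mul_eq_nrd (x : Quat K a b) : star x * x = algebraMap K _ (nrd x) := by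
  rw [← mul_star_eq_nrd, star_eq, sub_mul, mul_sub, Algebra.commutes]

theorem trd_add (x y : Quat K a b) : trd (x + y) = trd x + trd y := by
  simp only [trd_eq]
  rw [← mul_add]; rfl

theorem trd_smul (c : K) (x : Quat K a b) : trd (c • x) = c * trd x := by
  simp only [trd_eq]
  rw [mul_left_comm]; rfl

/-- The trilinear form `trd ((x y - y x) star z)` whose values generate the reduced
discriminant. -/
def discForm (x y z : Quat K a b) : K := trd ((x * y - y * x) * star z)

/-- Cramer's rule in the three-dimensional quotient of the algebra by its scalars, with the
alternating form `discForm` as determinant. -/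
theorem exists_discForm_smul_eq (x y w z : Quat K a b) : ∃ c : K,
    discForm x y w • z = trd (z * (y * star w - star w * y)) • x +
      trd (z * (star w * x - x * star w)) • y + trd (z * (y * x - x * y)) • w +
      algebraMap K _ c := by
  have h : ∀ x y w z : ℍ[K,a,b], ∃ c : K,
      (2 * ((x * y - y * x) * star w).re) • z = (2 * (z * (y * star w - star w * y)).re) • x +
      (2 * (z * (star w * x - x * star w)).re) • y + (2 * (z * (y * x - x * y)).re) • w +
      algebraMap K ℍ[K,a,b] c := by
    intro x y w z
    refine ⟨((2 * ((x * y - y * x) * star w).re) • z -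
      ((2 * (z * (y * star w - star w * y)).re) • x +
      (2 * (z * (star w * x - x * star w)).re) • y + (2 * (z * (y * x - x * y)).re) • w)).re, ?_⟩
    ext
    · simp only [QuaternionAlgebra.re_add, QuaternionAlgebra.re_sub,
        QuaternionAlgebra.algebraMap_eq]
      ring
    all_goals
      simp only [QuaternionAlgebra.re_sub, QuaternionAlgebra.imI_add, QuaternionAlgebra.imI_sub,
        QuaternionAlgebra.imJ_add, QuaternionAlgebra.imJ_sub, QuaternionAlgebra.imK_add,
        QuaternionAlgebra.imK_sub, QuaternionAlgebra.imI_smul, QuaternionAlgebra.imJ_smul,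
        QuaternionAlgebra.imK_smul, QuaternionAlgebra.re_mul, QuaternionAlgebra.imI_mul,
        QuaternionAlgebra.imJ_mul, QuaternionAlgebra.imK_mul, QuaternionAlgebra.re_star,
        QuaternionAlgebra.imI_star, QuaternionAlgebra.imJ_star, QuaternionAlgebra.imK_star,
        QuaternionAlgebra.algebraMap_eq, smul_eq_mul]
      ring
  simp only [discForm, trd_eq]
  exact h x y w z

theorem finrank_quat : Module.finrank K (Quat K a b) = 4 :=
  QuaternionAlgebra.finrank_eq_four (R := K) a 0 b

/-- Every quaternion is conjugate to its star: there is `w ≠ 0` with `star y * w = w * y`,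
found among the pure quaternions orthogonal to `star y`. -/
theorem exists_star_mul_eq_mul (y : Quat K a b) : ∃ w : Quat K a b, w ≠ 0 ∧ star y * w = w * y := by
  let f : Quat K a b →ₗ[K] K × K :=
    { toFun := fun w => (trd w, trd (w * y))
      map_add' := fun u v => by simp [add_mul, trd_add]
      map_smul' := fun c u => by simp [trd_smul] }
  have : Module.Finite K (Quat K a b) :=
    Module.finite_of_finrank_pos (by rw [finrank_quat]; norm_num)
  have hf : ¬ Function.Injective f := fun hinj => by
    have := LinearMap.finrank_le_finrank_of_injective hinj
    rw [finrank_quat] at this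
    simp at this
  rw [← LinearMap.ker_eq_bot, ← ne_eq, Submodule.ne_bot_iff] at hf
  obtain ⟨w, hw, hw0⟩ := hf
  refine ⟨w, hw0, ?_⟩
  rw [LinearMap.mem_ker, Prod.mk_eq_zero] at hw
  have h1 : star w = - w := by rw [star_eq, show trd w = 0 from hw.1]; simp
  have h2 : star (w * y) = - (w * y) := by rw [star_eq, show trd (w * y) = 0 from hw.2]; simp
  rw [star_mul, h1] at h2
  simpa using h2

end Algebra

/-! ### Rings with a standard involution -/

/-- An anti-involution `conj` on an `O`-algebra `R` for which trace `x + conj x` and norm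
`x * conj x` take values in `O`, the norm being anisotropic. An order in a definite quaternion
algebra carries this structure. -/
structure StdInvolution (O R : Type*) [CommRing O] [Ring R] [Algebra O R] where
  /-- the anti-involution -/
  conj : R → R
  /-- the reduced trace -/
  tr : R → O
  /-- the reduced norm -/
  n : R → O
  conj_add : ∀ x y, conj (x + y) = conj x + conj y
  conj_mul : ∀ x y, conj (x * y) = conj y * conj x
  conj_algebraMap : ∀ c, conj (algebraMap O R c) = algebraMap O R c
  add_conj : ∀ x, x + conj x = algebraMap O R (tr x)
  mul_conj : ∀ x, x * conj x = algebraMap O R (n x)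
  inj : Function.Injective (algebraMap O R)
  eq_zero_of_n : ∀ x, n x = 0 → x = 0

namespace StdInvolution

variable {O R : Type*} [CommRing O] [Ring R] [Algebra O R] (S : StdInvolution O R)

theorem conj_eq (x : R) : S.conj x = algebraMap O R (S.tr x) - x := by
  rw [← S.add_conj]; abel

theorem conj_mul_self (x : R) : S.conj x * x = algebraMap O R (S.n x) := by
  rw [← S.mul_conj, S.conj_eq, sub_mul, mul_sub, Algebra.commutes]

theorem conj_conj (x : R) : S.conj (S.conj x) = x := by
  have h := S.conj_add x (S.conj x)
  rw [S.add_conj, S.conj_algebraMap, ← S.add_conj, add_comm] at h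
  exact (add_left_cancel h).symm

theorem tr_algebraMap (c : O) : S.tr (algebraMap O R c) = 2 * c := by
  apply S.inj
  rw [← S.add_conj, S.conj_algebraMap, map_mul, map_ofNat, two_mul]

theorem n_algebraMap (c : O) : S.n (algebraMap O R c) = c ^ 2 := by
  apply S.inj
  rw [← S.mul_conj, S.conj_algebraMap, map_pow, sq]

theorem n_one : S.n 1 = 1 := by simpa using S.n_algebraMap 1

theorem n_zero : S.n 0 = 0 := by simpa using S.n_algebraMap 0

theorem tr_add (x y : R) : S.tr (x + y) = S.tr x + S.tr y := by
  apply S.inj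
  rw [map_add, ← S.add_conj, ← S.add_conj, ← S.add_conj, S.conj_add]; abel

theorem tr_mul_comm (x y : R) : S.tr (x * y) = S.tr (y * x) := by
  apply S.inj
  rw [← S.add_conj, ← S.add_conj, S.conj_mul, S.conj_mul, S.conj_eq x, S.conj_eq y]
  simp only [sub_mul, mul_sub]
  rw [← Algebra.commutes (S.tr x) (algebraMap O R (S.tr y)), ← Algebra.commutes (S.tr x) y,
    ← Algebra.commutes (S.tr y) x]
  abel

theorem tr_algebraMap_mul (c : O) (x : R) : S.tr (algebraMap O R c * x) = c * S.tr x := by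
  apply S.inj
  rw [← S.add_conj, S.conj_mul, S.conj_algebraMap, map_mul, ← S.add_conj, mul_add,
    ← Algebra.commutes c (S.conj x)]

theorem tr_conj (x : R) : S.tr (S.conj x) = S.tr x := by
  apply S.inj
  rw [← S.add_conj, S.conj_conj, add_comm, S.add_conj]

theorem tr_zero : S.tr 0 = 0 := by simpa using S.tr_algebraMap 0

theorem tr_neg (x : R) : S.tr (-x) = - S.tr x := by
  have := S.tr_algebraMap_mul (-1) x
  simpa using this

theorem tr_sub (x y : R) : S.tr (x - y) = S.tr x - S.tr y := by
  rw [sub_eq_add_neg, S.tr_add, S.tr_neg, sub_eq_add_neg]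

theorem n_mul (x y : R) : S.n (x * y) = S.n x * S.n y := by
  apply S.inj
  rw [← S.mul_conj, S.conj_mul, mul_assoc, ← mul_assoc y, S.mul_conj, Algebra.commutes,
    ← mul_assoc, S.mul_conj, map_mul]

theorem n_conj (x : R) : S.n (S.conj x) = S.n x := by
  apply S.inj
  rw [← S.mul_conj, S.conj_conj, S.conj_mul_self]

theorem n_add (x y : R) : S.n (x + y) = S.n x + S.tr (x * S.conj y) + S.n y := by
  apply S.inj
  rw [map_add, map_add, ← S.mul_conj, ← S.mul_conj, ← S.mul_conj, ← S.add_conj, S.conj_add,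
    S.conj_mul, S.conj_conj, add_mul, mul_add, mul_add]
  abel

/-- The ideal `𝔭 R` of elements divisible by an ideal of scalars. -/
def scalarIdeal (R : Type*) [Ring R] [Algebra O R] (I : Ideal O) : Ideal R where
  carrier := (I • (⊤ : Submodule O R) : Submodule O R)
  add_mem' := fun hx hy => Submodule.add_mem _ hx hy
  zero_mem' := Submodule.zero_mem _
  smul_mem' := fun c x hx => by
    refine Submodule.smul_induction_on (p := fun x => c • x ∈ I • (⊤ : Submodule O R)) hx
      (fun r hr m _ => ?_) (fun x y hx hy => ?_)
    · rw [smul_eq_mul, mul_smul_comm]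
      exact Submodule.smul_mem_smul hr Submodule.mem_top
    · rw [smul_add]; exact Submodule.add_mem _ hx hy

theorem mem_scalarIdeal {I : Ideal O} {x : R} :
    x ∈ scalarIdeal R I ↔ x ∈ (I • (⊤ : Submodule O R) : Submodule O R) := Iff.rfl

theorem algebraMap_mul_mem_scalarIdeal {I : Ideal O} {c : O} (hc : c ∈ I) (x : R) :
    algebraMap O R c * x ∈ scalarIdeal R I := by
  rw [← Algebra.smul_def, mem_scalarIdeal]
  exact Submodule.smul_mem_smul hc Submodule.mem_top

theorem algebraMap_mem_scalarIdeal {I : Ideal O} {c : O} (hc : c ∈ I) :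
    algebraMap O R c ∈ scalarIdeal R I := by
  simpa using algebraMap_mul_mem_scalarIdeal (R := R) hc 1

theorem scalarIdeal_induction {I : Ideal O} {p : R → Prop} {x : R} (hx : x ∈ scalarIdeal R I)
    (h : ∀ c ∈ I, ∀ y : R, p (algebraMap O R c * y)) (hadd : ∀ x y, p x → p y → p (x + y)) :
    p x := by
  rw [mem_scalarIdeal] at hx
  refine Submodule.smul_induction_on (p := p) hx (fun r hr m _ => ?_) (fun x y => hadd x y)
  rw [Algebra.smul_def]; exact h r hr m

instance (I : Ideal O) : (scalarIdeal R I).IsTwoSided where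
  mul_mem_of_left := fun {a} c ha => by
    refine scalarIdeal_induction (p := fun a => a * c ∈ scalarIdeal R I) ha (fun r hr m => ?_)
      (fun x y hx hy => ?_)
    · rw [mul_assoc]; exact algebraMap_mul_mem_scalarIdeal hr _
    · rw [add_mul]; exact Ideal.add_mem _ hx hy

theorem mem_scalarIdeal_singleton {c : O} {x : R} :
    x ∈ scalarIdeal R (Ideal.span {c}) ↔ ∃ y, x = algebraMap O R c * y := by
  constructor
  · intro hx
    refine scalarIdeal_induction (p := fun x => ∃ y, x = algebraMap O R c * y) hx
      (fun r hr m => ?_) (fun x y hx hy => ?_)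
    · obtain ⟨s, rfl⟩ := Ideal.mem_span_singleton'.1 hr
      exact ⟨algebraMap O R s * m, by rw [mul_comm s c, map_mul, mul_assoc]⟩
    · obtain ⟨u, rfl⟩ := hx
      obtain ⟨v, rfl⟩ := hy
      exact ⟨u + v, by rw [mul_add]⟩
  · rintro ⟨y, rfl⟩
    exact algebraMap_mul_mem_scalarIdeal (Ideal.mem_span_singleton_self c) y

/-- The ideal `I R` contracts to a set containing every `x` with multiples `s x`, `t x ∈ I R` for
coprime scalars; here the form with a prime ideal `𝔭` and a scalar outside it. -/
theorem mem_scalarIdeal_of_mul_mem {𝔭 : Ideal O} (h : 𝔭.IsMaximal) (k : ℕ) {c : O} (hc : c ∉ 𝔭)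
    {x : R} (hx : algebraMap O R c * x ∈ scalarIdeal R (𝔭 ^ k)) : x ∈ scalarIdeal R (𝔭 ^ k) := by
  have hcop : IsCoprime (Ideal.span {c}) (𝔭 ^ k) := by
    apply IsCoprime.pow_right
    rw [Ideal.isCoprime_iff_sup_eq, sup_comm]
    apply h.1.2
    refine lt_of_le_of_ne le_sup_left (fun h' => hc ?_)
    rw [h']
    exact Ideal.mem_sup_right (Ideal.mem_span_singleton_self c)
  rw [Ideal.isCoprime_iff_exists] at hcop
  obtain ⟨i, hi, j, hj, hij⟩ := hcop
  obtain ⟨s, rfl⟩ := Ideal.mem_span_singleton'.1 hi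
  have : x = algebraMap O R s * (algebraMap O R c * x) + algebraMap O R j * x := by
    rw [← mul_assoc, ← map_mul, ← add_mul, ← map_add, hij, map_one, one_mul]
  rw [this]
  exact Ideal.add_mem _ (Ideal.mul_mem_left _ _ hx) (algebraMap_mul_mem_scalarIdeal hj _)

end StdInvolution

/-! ### Principal left ideals of prime norm -/

namespace StdInvolution

variable {O R : Type*} [CommRing O] [Ring R] [Algebra O R] (S : StdInvolution O R)

/-- If the elements of norm in a prime ideal form a two-sided ideal of finite index, then
the quotient is a finite domain, hence commutative by Wedderburn's theorem. -/
theorem commutator_mem_of_mem_iff {𝔭 : Ideal O} (h𝔭 : 𝔭.IsPrime) (I : Ideal R) [I.IsTwoSided]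
    [Finite (R ⧸ I)] (hI : ∀ x, x ∈ I ↔ S.n x ∈ 𝔭) (x y : R) : x * y - y * x ∈ I := by
  have hnt : Nontrivial (R ⧸ I) := by
    rw [Ideal.Quotient.nontrivial_iff, Ne, Ideal.eq_top_iff_one, hI, S.n_one]
    exact fun h => h𝔭.ne_top ((Ideal.eq_top_iff_one _).2 h)
  have : NoZeroDivisors (R ⧸ I) := by
    refine ⟨fun {u v} huv => ?_⟩
    obtain ⟨u, rfl⟩ := Ideal.Quotient.mk_surjective u
    obtain ⟨v, rfl⟩ := Ideal.Quotient.mk_surjective v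
    rw [← map_mul, Ideal.Quotient.eq_zero_iff_mem, hI, S.n_mul] at huv
    rw [Ideal.Quotient.eq_zero_iff_mem, Ideal.Quotient.eq_zero_iff_mem, hI, hI]
    exact h𝔭.mem_or_mem huv
  have : IsDomain (R ⧸ I) := NoZeroDivisors.to_isDomain _
  have hf := Finite.isDomain_to_isField (R ⧸ I)
  rw [← Ideal.Quotient.eq_zero_iff_mem, map_sub, map_mul, map_mul, hf.mul_comm, sub_self]

/-- The principal left ideals generated by an element of norm `π`. -/
def normIdeals (π : O) : Set (Ideal R) := {M | ∃ y, S.n y = π ∧ M = Ideal.span {y}}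

/-- A generator `π` of a prime ideal of norm `N` such that `R` behaves modulo `π` like an order
all of whose one-sided ideals are principal: the left ideals generated by `π` and a zero divisor
modulo `π` are principal of the expected norm and index. -/
structure IsGoodPrime (π : O) (N : ℕ) : Prop where
  prime : Prime π
  isMaximal : (Ideal.span {π}).IsMaximal
  card_quot : Nat.card (O ⧸ Ideal.span {π}) = N
  one_lt : 1 < N
  index_span : ∀ y, S.n y = π → (Ideal.span {y}).toAddSubgroup.index = N ^ 2
  index_scalar : (scalarIdeal R (Ideal.span {π})).toAddSubgroup.index = N ^ 4
  exists_sup_eq : ∀ x, π ∣ S.n x → x ∉ scalarIdeal R (Ideal.span {π}) →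
    ∃ y, S.n y = π ∧ Ideal.span {x} ⊔ scalarIdeal R (Ideal.span {π}) = Ideal.span {y}
  exists_not_mem : ∃ x, π ∣ S.n x ∧ x ∉ scalarIdeal R (Ideal.span {π})

variable {S}
variable {π : O} {N : ℕ}

theorem dvd_n_of_mem_span {x y : R} (hy : S.n y = π) (hx : x ∈ Ideal.span {y}) : π ∣ S.n x := by
  obtain ⟨z, rfl⟩ := Ideal.mem_span_singleton'.1 hx
  rw [S.n_mul, hy]; exact dvd_mul_left _ _

theorem scalarIdeal_le_span {y : R} (hy : S.n y = π) :
    scalarIdeal R (Ideal.span {π}) ≤ Ideal.span {y} := by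
  intro x hx
  obtain ⟨z, rfl⟩ := mem_scalarIdeal_singleton.1 hx
  rw [Algebra.commutes, ← hy, ← S.conj_mul_self, ← mul_assoc]
  exact Ideal.mul_mem_left _ _ (Ideal.mem_span_singleton_self _)

theorem dvd_n_of_mem {M : Ideal R} (hM : M ∈ S.normIdeals π) {x : R} (hx : x ∈ M) :
    π ∣ S.n x := by
  obtain ⟨y, hy, rfl⟩ := hM
  exact dvd_n_of_mem_span hy hx

theorem scalarIdeal_le {M : Ideal R} (hM : M ∈ S.normIdeals π) :
    scalarIdeal R (Ideal.span {π}) ≤ M := by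
  obtain ⟨y, hy, rfl⟩ := hM
  exact scalarIdeal_le_span hy

theorem eq_of_le_of_index_eq {A B : Ideal R} (h : A ≤ B)
    (hi : A.toAddSubgroup.index = B.toAddSubgroup.index) (h0 : A.toAddSubgroup.index ≠ 0) :
    A = B := by
  have h' : A.toAddSubgroup ≤ B.toAddSubgroup := h
  have h1 := AddSubgroup.relIndex_mul_index h'
  rw [← hi] at h1
  have h2 : A.toAddSubgroup.relIndex B.toAddSubgroup = 1 :=
    Nat.eq_of_mul_eq_mul_right (Nat.pos_of_ne_zero h0) (by rw [h1, one_mul])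
  exact le_antisymm h (AddSubgroup.relIndex_eq_one.1 h2)

namespace IsGoodPrime

variable (hg : S.IsGoodPrime π N)
include hg

theorem index_of_mem {M : Ideal R} (hM : M ∈ S.normIdeals π) :
    M.toAddSubgroup.index = N ^ 2 := by
  obtain ⟨y, hy, rfl⟩ := hM
  exact hg.index_span y hy

theorem one_notMem {M : Ideal R} (hM : M ∈ S.normIdeals π) : (1 : R) ∉ M := fun h => by
  have := dvd_n_of_mem hM h
  rw [S.n_one] at this
  exact hg.prime.not_isUnit (isUnit_of_dvd_one this)

theorem sup_eq {M : Ideal R} (hM : M ∈ S.normIdeals π) {x : R} (hx : x ∈ M)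
    (hx' : x ∉ scalarIdeal R (Ideal.span {π})) :
    M = Ideal.span {x} ⊔ scalarIdeal R (Ideal.span {π}) := by
  obtain ⟨y, hy, h⟩ := hg.exists_sup_eq x (dvd_n_of_mem hM hx) hx'
  rw [h]
  symm
  refine eq_of_le_of_index_eq ?_ ?_ ?_
  · rw [← h]
    exact sup_le (by rwa [Ideal.span_singleton_le_iff_mem]) (scalarIdeal_le hM)
  · rw [hg.index_of_mem hM, hg.index_span y hy]
  · rw [hg.index_span y hy]
    exact pow_ne_zero _ (by have := hg.one_lt; omega)

theorem eq_of_mem_of_mem {M M' : Ideal R} (hM : M ∈ S.normIdeals π) (hM' : M' ∈ S.normIdeals π)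
    {x : R} (hx : x ∈ M) (hx' : x ∈ M') (h : x ∉ scalarIdeal R (Ideal.span {π})) : M = M' := by
  rw [hg.sup_eq hM hx h, hg.sup_eq hM' hx' h]

theorem exists_mem_normIdeals {x : R} (hx : π ∣ S.n x) : ∃ M ∈ S.normIdeals π, x ∈ M := by
  by_cases h : x ∈ scalarIdeal R (Ideal.span {π})
  · obtain ⟨z, hz, hz'⟩ := hg.exists_not_mem
    obtain ⟨y, hy, -⟩ := hg.exists_sup_eq z hz hz'
    exact ⟨_, ⟨y, hy, rfl⟩, scalarIdeal_le_span hy h⟩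
  · obtain ⟨y, hy, h'⟩ := hg.exists_sup_eq x hx h
    refine ⟨_, ⟨y, hy, rfl⟩, ?_⟩
    rw [← h']
    exact Ideal.mem_sup_left (Ideal.mem_span_singleton_self _)

theorem inf_eq {M M' : Ideal R} (hM : M ∈ S.normIdeals π) (hM' : M' ∈ S.normIdeals π)
    (hne : M ≠ M') : M ⊓ M' = scalarIdeal R (Ideal.span {π}) := by
  refine le_antisymm (fun x hx => ?_) (le_inf (scalarIdeal_le hM) (scalarIdeal_le hM'))
  by_contra h
  exact hne (hg.eq_of_mem_of_mem hM hM' hx.1 hx.2 h)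

theorem relIndex_scalarIdeal {M : Ideal R} (hM : M ∈ S.normIdeals π) :
    (scalarIdeal R (Ideal.span {π})).toAddSubgroup.relIndex M.toAddSubgroup = N ^ 2 := by
  have h' : (scalarIdeal R (Ideal.span {π})).toAddSubgroup ≤ M.toAddSubgroup := scalarIdeal_le hM
  have h1 := AddSubgroup.relIndex_mul_index h'
  rw [hg.index_scalar, hg.index_of_mem hM] at h1
  have := hg.one_lt
  exact Nat.eq_of_mul_eq_mul_right (show 0 < N ^ 2 by positivity) (by rw [h1]; ring)

theorem sup_eq_top {M M' : Ideal R} (hM : M ∈ S.normIdeals π) (hM' : M' ∈ S.normIdeals π)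
    (hne : M ≠ M') : M ⊔ M' = ⊤ := by
  have h1 : M.toAddSubgroup.relIndex (M.toAddSubgroup ⊔ M'.toAddSubgroup) =
      M.toAddSubgroup.relIndex M'.toAddSubgroup := AddSubgroup.relIndex_sup_left _ _
  rw [eq_comm, ← AddSubgroup.inf_relIndex_right] at h1
  have h2 : M.toAddSubgroup ⊓ M'.toAddSubgroup
      = (scalarIdeal R (Ideal.span {π})).toAddSubgroup := by
    rw [← hg.inf_eq hM hM' hne]; rfl
  rw [h2, hg.relIndex_scalarIdeal hM', eq_comm] at h1
  have h3 := AddSubgroup.relIndex_mul_index (le_sup_left :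
    M.toAddSubgroup ≤ M.toAddSubgroup ⊔ M'.toAddSubgroup)
  rw [h1, hg.index_of_mem hM] at h3
  have := hg.one_lt
  have h4 : (M.toAddSubgroup ⊔ M'.toAddSubgroup).index = 1 :=
    Nat.eq_of_mul_eq_mul_left (show 0 < N ^ 2 by positivity) (by rw [h3, mul_one])
  rw [AddSubgroup.index_eq_one] at h4
  rw [Ideal.eq_top_iff_one, Submodule.mem_sup]
  have h5 : (1 : R) ∈ M.toAddSubgroup ⊔ M'.toAddSubgroup := h4 ▸ AddSubgroup.mem_top _
  rw [AddSubgroup.mem_sup] at h5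
  exact h5

omit hg in
theorem self_mul_mem (x : R) (hx : π ∣ S.n x) :
    x * x - algebraMap O R (S.tr x) * x ∈ scalarIdeal R (Ideal.span {π}) := by
  have h : x * x - algebraMap O R (S.tr x) * x = - algebraMap O R (S.n x) := by
    rw [← S.conj_mul_self, S.conj_eq, sub_mul]; abel
  rw [h]
  exact neg_mem (algebraMap_mem_scalarIdeal (Ideal.mem_span_singleton.2 hx))

theorem isUnit_mod {c : O} (hc : ¬ π ∣ c) {x : R}
    (hx : algebraMap O R c * x ∈ scalarIdeal R (Ideal.span {π})) :
    x ∈ scalarIdeal R (Ideal.span {π}) := by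
  have h := mem_scalarIdeal_of_mul_mem hg.isMaximal 1 (c := c) (x := x)
    (by rwa [Ideal.mem_span_singleton])
  rw [pow_one] at h
  exact h hx

/-- Two distinct members of `normIdeals` give complementary idempotents modulo `π`. -/
theorem exists_idempotents {M M' : Ideal R} (hM : M ∈ S.normIdeals π) (hM' : M' ∈ S.normIdeals π)
    (hne : M ≠ M') : ∃ e ∈ M, ∃ f ∈ M', e + f = 1 ∧ e * f ∈ scalarIdeal R (Ideal.span {π}) ∧
      f * e ∈ scalarIdeal R (Ideal.span {π}) ∧ π ∣ S.tr e - 1 ∧ π ∣ S.tr f - 1 := by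
  have h := hg.sup_eq_top hM hM' hne
  rw [Ideal.eq_top_iff_one, Submodule.mem_sup] at h
  obtain ⟨e, he, f, hf, hef⟩ := h
  have hf1 : f = 1 - e := by rw [← hef]; abel
  have h1 : e * f ∈ scalarIdeal R (Ideal.span {π}) := by
    rw [← hg.inf_eq hM hM' hne]
    refine ⟨?_, Ideal.mul_mem_left _ _ hf⟩
    rw [hf1, mul_sub, mul_one]
    exact sub_mem he (Ideal.mul_mem_left _ _ he)
  have h2 : f * e ∈ scalarIdeal R (Ideal.span {π}) := by
    have : f * e = e * f := by rw [hf1, mul_sub, sub_mul, one_mul, mul_one]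
    rwa [this]
  have h3 : π ∣ S.tr e - 1 := by
    by_contra hc
    have h4 : algebraMap O R (S.tr e - 1) * e ∈ scalarIdeal R (Ideal.span {π}) := by
      have : algebraMap O R (S.tr e - 1) * e
          = - (e * f) - (e * e - algebraMap O R (S.tr e) * e) := by
        rw [hf1, map_sub, map_one, mul_sub, sub_mul, one_mul, mul_one]; abel
      rw [this]
      exact sub_mem (neg_mem h1) (self_mul_mem e (dvd_n_of_mem hM he))
    have h5 := scalarIdeal_le hM' (hg.isUnit_mod hc h4)
    exact hg.one_notMem hM' (hef ▸ add_mem h5 hf)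
  refine ⟨e, he, f, hf, hef, h1, h2, h3, ?_⟩
  have : S.tr f - 1 = - (S.tr e - 1) := by
    rw [hf1, S.tr_sub, ← map_one (algebraMap O R), S.tr_algebraMap]; ring
  rw [this]
  exact (dvd_neg).2 h3

/-- The members of `normIdeals` other than a fixed `M'` are parametrised by the classes modulo `π`
of the `b ∈ M'` of trace `-1`: the ideal `M` corresponds to the zero divisor `1 + b ∈ M`. -/
theorem card_normIdeals_diff {M M' : Ideal R} (hM : M ∈ S.normIdeals π)
    (hM' : M' ∈ S.normIdeals π) (hne : M ≠ M') :
    Nat.card {A : Ideal R // A ∈ S.normIdeals π ∧ A ≠ M'} = N := by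
  obtain ⟨e, he, f, hf, hef, -, -, hte, htf⟩ := hg.exists_idempotents hM hM' hne
  let t : M'.toAddSubgroup →+ O ⧸ Ideal.span {π} :=
    { toFun := fun b => Ideal.Quotient.mk _ (S.tr b.1)
      map_zero' := by simp [S.tr_zero]
      map_add' := fun x y => by simp [S.tr_add] }
  have ht : Function.Surjective t := by
    intro c
    obtain ⟨c, rfl⟩ := Ideal.Quotient.mk_surjective c
    refine ⟨⟨algebraMap O R c * f, Ideal.mul_mem_left _ _ hf⟩, ?_⟩
    change Ideal.Quotient.mk _ (S.tr (algebraMap O R c * f)) = _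
    rw [Ideal.Quotient.eq, S.tr_algebraMap_mul, Ideal.mem_span_singleton]
    have : c * S.tr f - c = c * (S.tr f - 1) := by ring
    rw [this]; exact Dvd.dvd.mul_left htf c
  have hker : t.ker.index = N := by
    rw [AddSubgroup.index_ker, AddMonoidHom.range_eq_top.2 ht, ← hg.card_quot]
    exact Nat.card_congr AddSubgroup.topEquiv.toEquiv
  have mem_ker : ∀ b : M'.toAddSubgroup, b ∈ t.ker ↔ π ∣ S.tr b.1 := fun b => by
    rw [AddMonoidHom.mem_ker]
    change Ideal.Quotient.mk _ (S.tr b.1) = 0 ↔ _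
    rw [Ideal.Quotient.eq_zero_iff_mem, Ideal.mem_span_singleton]
  set P' : AddSubgroup M'.toAddSubgroup :=
    (scalarIdeal R (Ideal.span {π})).toAddSubgroup.addSubgroupOf M'.toAddSubgroup with hP'
  have hP'le : P' ≤ t.ker := by
    intro b hb
    rw [mem_ker]
    obtain ⟨z, hz⟩ := mem_scalarIdeal_singleton.1
      (show b.1 ∈ scalarIdeal R (Ideal.span {π}) from hb)
    rw [hz, S.tr_algebraMap_mul]
    exact dvd_mul_right _ _
  have hcard : Nat.card (t.ker ⧸ P'.addSubgroupOf t.ker) = N := by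
    have h1 := AddSubgroup.relIndex_mul_index hP'le
    have h2 : P'.index = N ^ 2 := hg.relIndex_scalarIdeal hM'
    rw [h2, hker] at h1
    have := hg.one_lt
    exact Nat.eq_of_mul_eq_mul_right (show 0 < N by omega) (h1.trans (sq N))
  have hex : ∀ b : t.ker, ∃ A : {A : Ideal R // A ∈ S.normIdeals π ∧ A ≠ M'}, e + b.1.1 ∈ A.1 := by
    intro b
    have hb := (mem_ker _).1 b.2
    have h1 : π ∣ S.n (e + b.1.1) := by
      have h2 : e + b.1.1 = (b.1.1 - f) + 1 := by rw [← hef]; abel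
      rw [h2, S.n_add, ← map_one (algebraMap O R), S.conj_algebraMap, map_one, mul_one, S.n_one,
        S.tr_sub]
      have h3 : π ∣ S.n (b.1.1 - f) := dvd_n_of_mem hM' (sub_mem b.1.2 hf)
      have h4 : S.n (b.1.1 - f) + (S.tr b.1.1 - S.tr f) + 1
        = S.n (b.1.1 - f) + S.tr b.1.1 - (S.tr f - 1) := by ring
      rw [h4]
      exact dvd_sub (dvd_add h3 hb) htf
    obtain ⟨A, hA, hA'⟩ := hg.exists_mem_normIdeals h1
    refine ⟨⟨A, hA, ?_⟩, hA'⟩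
    rintro rfl
    have h5 : e + b.1.1 - b.1.1 + f ∈ A := add_mem (sub_mem hA' b.1.2) hf
    rw [add_sub_cancel_right, hef] at h5
    exact hg.one_notMem hM' h5
  have hnot : ∀ b : t.ker, e + b.1.1 ∉ scalarIdeal R (Ideal.span {π}) := fun b hb => by
    have h5 : e + b.1.1 - b.1.1 + f ∈ M' :=
      add_mem (sub_mem (scalarIdeal_le hM' hb) b.1.2) hf
    rw [add_sub_cancel_right, hef] at h5
    exact hg.one_notMem hM' h5
  choose g hgm using hex
  have hg1 : ∀ b b' : t.ker, g b = g b' ↔ -b + b' ∈ P'.addSubgroupOf t.ker := by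
    intro b b'
    change _ ↔ -b.1.1 + b'.1.1 ∈ scalarIdeal R (Ideal.span {π})
    constructor
    · intro h
      rw [← hg.inf_eq (g b).2.1 hM' (g b).2.2]
      refine ⟨?_, add_mem (neg_mem b.1.2) b'.1.2⟩
      have h1 := hgm b'
      rw [← h] at h1
      have := sub_mem h1 (hgm b)
      rwa [add_sub_add_left_eq_sub, sub_eq_neg_add] at this
    · intro h
      apply Subtype.ext
      refine hg.eq_of_mem_of_mem (g b).2.1 (g b').2.1 (x := e + b'.1.1) ?_ (hgm b') (hnot b')
      have := add_mem (hgm b) (scalarIdeal_le (g b).2.1 h)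
      rwa [add_assoc, add_neg_cancel_left] at this
  rw [← hcard]
  symm
  refine Nat.card_eq_of_bijective
    (Quotient.lift g (fun b b' h => (hg1 b b').2 (QuotientAddGroup.leftRel_apply.1 h))) ⟨?_, ?_⟩
  · rintro ⟨b⟩ ⟨b'⟩ h
    exact Quotient.sound (QuotientAddGroup.leftRel_apply.2 ((hg1 b b').1 h))
  · rintro ⟨A, hA, hA'⟩
    have h := hg.sup_eq_top hA hM' hA'
    rw [Ideal.eq_top_iff_one, Submodule.mem_sup] at h
    obtain ⟨a, ha, c, hc, hac⟩ := h
    have hfc : a = e + (f - c) := by rw [← add_sub_assoc, hef, ← hac]; abel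
    have hb : f - c ∈ M' := sub_mem hf hc
    have hbt : π ∣ S.tr (f - c) := by
      have h1 := dvd_n_of_mem hA ha
      have h2 : a = -c + 1 := by rw [← hac]; abel
      rw [h2, S.n_add, ← map_one (algebraMap O R), S.conj_algebraMap, map_one, mul_one, S.n_one,
        S.tr_neg] at h1
      have h3 : π ∣ S.n (-c) := dvd_n_of_mem hM' (neg_mem hc)
      have h4 : S.tr (f - c) = (S.n (-c) + - S.tr c + 1) - S.n (-c) + (S.tr f - 1) := by
        rw [S.tr_sub]; ring
      rw [h4]
      exact dvd_add (dvd_sub h1 h3) htf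
    refine ⟨Quotient.mk _ ⟨⟨f - c, hb⟩, (mem_ker _).2 hbt⟩, ?_⟩
    apply Subtype.ext
    refine hg.eq_of_mem_of_mem (g _).2.1 hA (hgm _) ?_ (hnot _)
    change e + (f - c) ∈ A
    rwa [← hfc]

end IsGoodPrime
end StdInvolution

/-! ### The number of left ideals of prime norm -/

namespace StdInvolution

variable {O R : Type*} [CommRing O] [Ring R] [Algebra O R] {S : StdInvolution O R}
variable {π : O} {N : ℕ}

theorem tr_mem_of_mem_scalarIdeal {I : Ideal O} {x : R} (hx : x ∈ scalarIdeal R I) :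
    S.tr x ∈ I := by
  refine scalarIdeal_induction (p := fun x => S.tr x ∈ I) hx (fun r hr m => ?_)
    (fun x y hx hy => ?_)
  · rw [S.tr_algebraMap_mul]; exact I.mul_mem_right _ hr
  · rw [S.tr_add]; exact I.add_mem hx hy

variable (S) in
/-- The prime element `π` divides the reduced discriminant. -/
def DvdDisc (π : O) : Prop := ∀ x y z, π ∣ S.tr ((x * y - y * x) * S.conj z)

namespace IsGoodPrime

variable (hg : S.IsGoodPrime π N)
include hg

/-- If only one left ideal lies above `π`, it is two-sided with commutative quotient, so that
`π` divides the discriminant. -/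
theorem dvdDisc_of_subsingleton (h : (S.normIdeals π).Subsingleton) : S.DvdDisc π := by
  obtain ⟨M, hM, -⟩ := hg.exists_mem_normIdeals (x := 0) (by rw [S.n_zero]; exact dvd_zero _)
  have hmem : ∀ x, x ∈ M ↔ S.n x ∈ Ideal.span {π} := fun x => by
    rw [Ideal.mem_span_singleton]
    refine ⟨dvd_n_of_mem hM, fun hx => ?_⟩
    obtain ⟨M', hM', hx'⟩ := hg.exists_mem_normIdeals hx
    rwa [h hM hM']
  have h2 : M.IsTwoSided := ⟨fun {x} c hx => by
    rw [hmem] at hx ⊢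
    rw [S.n_mul]
    exact Ideal.mul_mem_right _ _ hx⟩
  have hfin : Finite (R ⧸ M) := by
    have h1 : Nat.card (R ⧸ M) = N ^ 2 := hg.index_of_mem hM
    have := hg.one_lt
    exact Nat.finite_of_card_ne_zero (by rw [h1]; positivity)
  intro x y z
  have h3 := S.commutator_mem_of_mem_iff hg.isMaximal.isPrime M hmem x y
  have h4 : (x * y - y * x) * S.conj z ∈ M := h2.mul_mem_of_left _ h3
  set u := (x * y - y * x) * S.conj z
  have h5 : S.conj u ∈ M := by rw [hmem, S.n_conj, ← hmem]; exact h4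
  have h6 := add_mem h4 h5
  rw [S.add_conj, hmem, S.n_algebraMap, Ideal.mem_span_singleton] at h6
  exact hg.prime.dvd_of_dvd_pow h6

/-- If two different left ideals lie above `π`, then `R / π R` is a split matrix algebra and
`π` does not divide the discriminant. -/
theorem not_dvdDisc {M M' : Ideal R} (hM : M ∈ S.normIdeals π)
    (hM' : M' ∈ S.normIdeals π) (hne : M ≠ M') : ¬ S.DvdDisc π := by
  obtain ⟨e, he, f, hf, hef, h1, h2, hte, htf⟩ := hg.exists_idempotents hM hM' hne
  set P := scalarIdeal R (Ideal.span {π}) with hP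
  have hP2 : ∀ {x : R} (c : R), x ∈ P → x * c ∈ P := fun c hx => Ideal.mul_mem_right _ _ hx
  have hee : e * e - e ∈ P := by
    have : e * e - e = - (e * f) := by
      rw [show f = 1 - e by rw [← hef]; abel, mul_sub, mul_one]; abel
    rw [this]; exact neg_mem h1
  -- The corner `f R e` does not vanish: otherwise `M` would be spanned by `e` modulo `π`.
  have hcorner : ∃ x, f * x * e ∉ P := by
    by_contra! hcon
    have hMe : ∀ z ∈ M, z - algebraMap O R (S.tr (e * z * e)) * e ∈ P := by
      intro z hz
      have h3 : z * f ∈ P := by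
        rw [hP, ← hg.inf_eq hM hM' hne]
        refine ⟨?_, Ideal.mul_mem_left _ _ hf⟩
        rw [show f = 1 - e by rw [← hef]; abel, mul_sub, mul_one]
        exact sub_mem hz (Ideal.mul_mem_left _ _ he)
      have h4 : e * S.conj (e * z * e) ∈ P := by
        rw [S.conj_mul, ← mul_assoc, S.mul_conj]
        exact algebraMap_mul_mem_scalarIdeal (Ideal.mem_span_singleton.2 (dvd_n_of_mem hM he)) _
      have h5 : (e * e - e) * (z * e) ∈ P := hP2 _ hee
      have h6 : z - algebraMap O R (S.tr (e * z * e)) * e =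
          z * f + f * z * e - (e * e - e) * (z * e) - e * S.conj (e * z * e) := by
        rw [Algebra.commutes, ← S.add_conj, mul_add]
        have : z = z * f + (f * z * e + e * z * e) := by
          rw [← add_mul, ← add_mul, add_comm f e, hef, one_mul, ← mul_add, add_comm f e, hef,
            mul_one]
        nth_rewrite 1 [this]
        rw [sub_mul, ← mul_assoc, ← mul_assoc, ← mul_assoc, ← mul_assoc]
        abel
      rw [h6]
      exact sub_mem (sub_mem (add_mem h3 (hcon z)) h5) h4
    let t : O →+ M.toAddSubgroup ⧸ P.toAddSubgroup.addSubgroupOf M.toAddSubgroup :=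
      (QuotientAddGroup.mk' _).comp
        { toFun := fun c => ⟨algebraMap O R c * e, Ideal.mul_mem_left _ _ he⟩
          map_zero' := by simp
          map_add' := fun x y => by simp [add_mul] }
    have ht : Function.Surjective t := by
      rintro ⟨z, hz⟩
      refine ⟨S.tr (e * z * e), ?_⟩
      refine QuotientAddGroup.eq.2 ?_
      change -(algebraMap O R (S.tr (e * z * e)) * e) + z ∈ P
      rw [neg_add_eq_sub]
      exact hMe z hz
    have h3 : t.ker.index = N ^ 2 := by
      rw [AddSubgroup.index_ker, AddMonoidHom.range_eq_top.2 ht, ← hg.relIndex_scalarIdeal hM]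
      exact Nat.card_congr AddSubgroup.topEquiv.toEquiv
    have h4 : (Ideal.span {π}).toAddSubgroup ≤ t.ker := by
      intro c hc
      rw [AddMonoidHom.mem_ker]
      refine (QuotientAddGroup.eq_zero_iff _).2 ?_
      exact algebraMap_mul_mem_scalarIdeal (R := R) hc e
    have h5 := AddSubgroup.index_dvd_of_le h4
    have h6 : (Ideal.span {π}).toAddSubgroup.index = N := hg.card_quot
    rw [h3, h6] at h5
    have := hg.one_lt
    have := Nat.le_of_dvd (by omega) h5
    nlinarith
  obtain ⟨x, hx⟩ := hcorner
  set w := f * x * e with hw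
  have hwM : w ∈ M := Ideal.mul_mem_left _ _ he
  have hcomm : w * e - e * w - w ∈ P := by
    have : w * e - e * w - w = f * x * (e * e - e) - e * f * (x * e) := by
      rw [hw, mul_sub, ← mul_assoc, ← mul_assoc, ← mul_assoc, ← mul_assoc]; abel
    rw [this]
    exact sub_mem (Ideal.mul_mem_left _ _ hee) (hP2 _ h1)
  intro hD
  have htr : ∀ u, π ∣ S.tr (u * w) := by
    intro u
    have h3 := hD w e (S.conj u)
    rw [S.conj_conj, S.tr_mul_comm] at h3
    have h4 : S.tr (u * w) = S.tr (u * (w * e - e * w)) - S.tr (u * (w * e - e * w - w)) := by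
      rw [← S.tr_sub, ← mul_sub, sub_sub_cancel]
    rw [h4]
    refine dvd_sub h3 ?_
    rw [← Ideal.mem_span_singleton]
    exact tr_mem_of_mem_scalarIdeal (Ideal.mul_mem_left _ _ hcomm)
  have h3 := he
  rw [hg.sup_eq hM hwM hx, Submodule.mem_sup] at h3
  obtain ⟨a, ha, p, hp, hap⟩ := h3
  obtain ⟨u, rfl⟩ := Ideal.mem_span_singleton'.1 ha
  have h4 : π ∣ S.tr e := by
    rw [← hap, S.tr_add]
    exact dvd_add (htr u) (Ideal.mem_span_singleton.1 (tr_mem_of_mem_scalarIdeal hp))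
  have h5 := dvd_sub h4 hte
  rw [sub_sub_cancel] at h5
  exact hg.prime.not_isUnit (isUnit_of_dvd_one h5)

theorem finite_normIdeals : (S.normIdeals π).Finite := by
  by_cases h : (S.normIdeals π).Subsingleton
  · exact h.finite
  · rw [Set.not_subsingleton_iff] at h
    obtain ⟨M, hM, M', hM', hne⟩ := h
    have h1 := hg.card_normIdeals_diff hM hM' hne
    have := hg.one_lt
    have h2 : {A | A ∈ S.normIdeals π ∧ A ≠ M'}.Finite :=
      Nat.finite_of_card_ne_zero (by rw [Set.coe_ofPred, h1]; omega)
    refine (h2.insert M').subset fun A hA => ?_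
    by_cases h3 : A = M'
    · exact Or.inl h3
    · exact Or.inr ⟨hA, h3⟩

open Classical in
/-- The number of left ideals above `π` is one if `π` divides the discriminant, and `N + 1`
otherwise. -/
theorem ncard_normIdeals :
    (S.normIdeals π).ncard = (if S.DvdDisc π then 0 else N) + 1 := by
  by_cases h : (S.normIdeals π).Subsingleton
  · rw [if_pos (hg.dvdDisc_of_subsingleton h)]
    obtain ⟨M, hM, -⟩ := hg.exists_mem_normIdeals (x := 0) (by rw [S.n_zero]; exact dvd_zero _)
    rw [h.eq_singleton_of_mem hM, Set.ncard_singleton]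
  · rw [Set.not_subsingleton_iff] at h
    obtain ⟨M, hM, M', hM', hne⟩ := h
    rw [if_neg (hg.not_dvdDisc hM hM' hne), ← hg.card_normIdeals_diff hM hM' hne]
    rw [← Set.ncard_sdiff_singleton_add_one hM' hg.finite_normIdeals]
    rfl

end IsGoodPrime
end StdInvolution

/-! ### Elements of given norm: recursion at a prime -/

namespace StdInvolution

variable {O R : Type*} [CommRing O] [IsDomain O] [Ring R] [Algebra O R] {S : StdInvolution O R}
variable {π : O} {N : ℕ}

variable (S) in
/-- The number of elements of norm `c`. -/
def repNum (c : O) : ℕ := {x | S.n x = c}.ncard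

theorem mul_right_injective {y : R} (hy : S.n y ≠ 0) : Function.Injective (· * y) := by
  intro u v huv
  have h : S.n ((u - v) * y) = 0 := by
    rw [sub_mul, sub_eq_zero.2 huv, S.n_zero]
  rw [S.n_mul] at h
  exact sub_eq_zero.1 (S.eq_zero_of_n _ ((mul_eq_zero.1 h).resolve_right hy))

/-- Right multiplication by `y` matches elements of norm `c` with the elements of norm
`c * n y` in the left ideal of `y`. -/
theorem ncard_norm_eq_mem_span {y : R} {c d : O} (hy : S.n y = d) (hd : d ≠ 0) :
    {x | S.n x = d * c ∧ x ∈ Ideal.span {y}}.ncard = S.repNum c := by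
  have : {x | S.n x = d * c ∧ x ∈ Ideal.span {y}} = (· * y) '' {x | S.n x = c} := by
    ext x
    simp only [Set.mem_ofPred_eq, Set.mem_image]
    constructor
    · rintro ⟨hx, hxy⟩
      obtain ⟨z, rfl⟩ := Ideal.mem_span_singleton'.1 hxy
      refine ⟨z, ?_, rfl⟩
      rw [S.n_mul, hy, mul_comm] at hx
      exact mul_left_cancel₀ hd hx
    · rintro ⟨z, hz, rfl⟩
      refine ⟨by rw [S.n_mul, hy, hz, mul_comm],
        Ideal.mul_mem_left _ _ (Ideal.mem_span_singleton_self _)⟩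
  rw [this, Set.ncard_image_of_injective _ (mul_right_injective (hy ▸ hd)), repNum]

omit [IsDomain O] in
theorem span_algebraMap_eq (c : O) :
    Ideal.span {algebraMap O R c} = scalarIdeal R (Ideal.span {c}) := by
  ext x
  rw [Ideal.mem_span_singleton', mem_scalarIdeal_singleton]
  exact ⟨fun ⟨a, ha⟩ => ⟨a, by rw [← ha, Algebra.commutes]⟩,
    fun ⟨a, ha⟩ => ⟨a, by rw [ha, Algebra.commutes]⟩⟩

theorem ncard_norm_eq_mem_scalarIdeal {c δ : O} (hc : c ≠ 0) :
    {x | S.n x = c ^ 2 * δ ∧ x ∈ scalarIdeal R (Ideal.span {c})}.ncard = S.repNum δ := by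
  rw [← span_algebraMap_eq]
  exact ncard_norm_eq_mem_span (S.n_algebraMap c) (pow_ne_zero _ hc)

namespace IsGoodPrime

variable (hg : S.IsGoodPrime π N) (hfin : ∀ c, {x | S.n x = c}.Finite)
include hg hfin

variable (S π N) in
open Classical in
omit hg hfin [IsDomain O] in
/-- The number of left ideals above `π`, minus one. -/
def _root_.QuatOrder.StdInvolution.excess : ℕ := if S.DvdDisc π then 0 else N

/-- Double counting of the pairs of an element of norm `π α` and a left ideal of norm `π`
containing it. -/
theorem excess_add_one_mul_repNum (α : O) :
    (S.excess π N + 1) * S.repNum α = S.repNum (π * α) + S.excess π N *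
      {x | S.n x = π * α ∧ x ∈ scalarIdeal R (Ideal.span {π})}.ncard := by
  classical
  set X := (hfin (π * α)).toFinset with hX
  set Y := hg.finite_normIdeals.toFinset with hY
  have hYc : Y.card = S.excess π N + 1 := by
    rw [hY, ← Set.ncard_eq_toFinset_card _ hg.finite_normIdeals, hg.ncard_normIdeals, excess]
  have hXc : X.card = S.repNum (π * α) := by
    rw [hX, ← Set.ncard_eq_toFinset_card _ (hfin _), repNum]
  have key := Finset.sum_card_bipartiteAbove_eq_sum_card_bipartiteBelow (s := X) (t := Y)
    (fun x M => x ∈ M)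
  have h1 : ∀ M ∈ Y, (Finset.bipartiteBelow (fun x M => x ∈ M) X M).card = S.repNum α := by
    intro M hM
    rw [hY, Set.Finite.mem_toFinset] at hM
    obtain ⟨y, hy, rfl⟩ := hM
    rw [← ncard_norm_eq_mem_span hy hg.prime.ne_zero, ← Set.ncard_coe_finset]
    congr 1
    ext x
    simp [Finset.bipartiteBelow, hX]
  have h2 : ∀ x ∈ X, (Finset.bipartiteAbove (fun x M => x ∈ M) Y x).card =
      1 + if x ∈ scalarIdeal R (Ideal.span {π}) then S.excess π N else 0 := by
    intro x hx
    rw [hX, Set.Finite.mem_toFinset, Set.mem_ofPred_eq] at hx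
    split_ifs with hxP
    · rw [add_comm, ← hYc]
      congr 1
      refine Finset.filter_true_of_mem fun M hM => ?_
      rw [hY, Set.Finite.mem_toFinset] at hM
      exact scalarIdeal_le hM hxP
    · obtain ⟨M, hM, hxM⟩ := hg.exists_mem_normIdeals (x := x) (hx ▸ dvd_mul_right _ _)
      rw [add_zero, Finset.card_eq_one]
      refine ⟨M, ?_⟩
      ext M'
      simp only [Finset.mem_bipartiteAbove, hY, Set.Finite.mem_toFinset, Finset.mem_singleton]
      constructor
      · rintro ⟨hM', hxM'⟩
        exact hg.eq_of_mem_of_mem hM' hM hxM' hxM hxP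
      · rintro rfl
        exact ⟨hM, hxM⟩
  rw [Finset.sum_congr rfl h2, Finset.sum_congr rfl h1, Finset.sum_const, smul_eq_mul, hYc,
    Finset.sum_add_distrib, Finset.sum_const, smul_eq_mul, mul_one, hXc, ← Finset.sum_filter,
    Finset.sum_const, smul_eq_mul] at key
  rw [← key, mul_comm (S.excess π N), ← Set.ncard_coe_finset]
  congr 3
  ext x
  simp [hX]

theorem repNum_mul_of_not_dvd {γ : O} (hγ : ¬ π ∣ γ) :
    S.repNum (π * γ) = (S.excess π N + 1) * S.repNum γ := by
  rw [hg.excess_add_one_mul_repNum hfin]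
  have : {x | S.n x = π * γ ∧ x ∈ scalarIdeal R (Ideal.span {π})} = ∅ := by
    rw [Set.eq_empty_iff_forall_notMem]
    rintro x ⟨hx, hxP⟩
    obtain ⟨y, rfl⟩ := mem_scalarIdeal_singleton.1 hxP
    rw [S.n_mul, S.n_algebraMap, sq, mul_assoc] at hx
    have := mul_left_cancel₀ hg.prime.ne_zero hx
    exact hγ ⟨_, this.symm⟩
  rw [this, Set.ncard_empty, mul_zero, add_zero]

theorem repNum_sq_mul (δ : O) : (S.excess π N + 1) * S.repNum (π * δ) =
    S.repNum (π ^ 2 * δ) + S.excess π N * S.repNum δ := by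
  rw [hg.excess_add_one_mul_repNum hfin, ← mul_assoc, ← sq,
    ncard_norm_eq_mem_scalarIdeal hg.prime.ne_zero]

theorem repNum_pow_mul {γ : O} (hγ : ¬ π ∣ γ) (e : ℕ) :
    S.repNum (π ^ e * γ) = (∑ i ∈ Finset.range (e + 1), S.excess π N ^ i) * S.repNum γ := by
  induction e using Nat.strong_induction_on with
  | _ e ih =>
    match e with
    | 0 => simp
    | 1 => simp [hg.repNum_mul_of_not_dvd hfin hγ, Finset.sum_range_succ, add_comm]
    | e + 2 =>
      have h1 := hg.repNum_sq_mul hfin (π ^ e * γ)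
      rw [← mul_assoc, ← mul_assoc, ← pow_succ', ← pow_add, add_comm 2 e, ih (e + 1) (by omega),
        ih e (by omega)] at h1
      set w := S.excess π N
      have h2 : ∀ k, w * ∑ i ∈ Finset.range k, w ^ i + 1 = ∑ i ∈ Finset.range (k + 1), w ^ i := by
        intro k
        rw [Finset.sum_range_succ', Finset.mul_sum, pow_zero]
        congr 1
        exact Finset.sum_congr rfl fun i _ => (pow_succ' w i).symm
      have h3 := h2 (e + 2)
      have h4 := h2 (e + 1)
      rw [show e + 2 = e + 1 + 1 by ring] at *
      rw [← h3]
      rw [← h4] at h1 ⊢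
      have h5 : (w + 1) * ((w * ∑ i ∈ Finset.range (e + 1), w ^ i + 1) * S.repNum γ) =
        (w * (w * ∑ i ∈ Finset.range (e + 1), w ^ i + 1) + 1) * S.repNum γ +
          w * ((∑ i ∈ Finset.range (e + 1), w ^ i) * S.repNum γ) := by ring
      exact (Nat.add_right_cancel (h5.symm.trans h1)).symm

end IsGoodPrime
end StdInvolution

/-! ### Multiplicativity of the divisor sum -/

section Sigma

variable {K : Type*} [Field K] [NumberField K]

/-- The ideals summed over in `sigma`. -/
def sigmaSet (𝔇 : Ideal (𝓞 K)) (𝔞 : Ideal (𝓞 K)) : Set (Ideal (𝓞 K)) :=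
  {δ | δ ∣ 𝔞 ∧ ∀ 𝔭 : Ideal (𝓞 K), Prime 𝔭 → 𝔭 ∣ 𝔇 → ¬ 𝔭 ∣ δ}

theorem sigma_eq (𝔇 : Ideal (𝓞 K)) (α : 𝓞 K) :
    sigma 𝔇 α = ∑ᶠ δ ∈ sigmaSet 𝔇 (Ideal.span {α}), Ideal.absNorm δ := rfl

theorem finite_sigmaSet (𝔇 : Ideal (𝓞 K)) {𝔞 : Ideal (𝓞 K)} (h : 𝔞 ≠ 0) :
    (sigmaSet 𝔇 𝔞).Finite := by
  have := UniqueFactorizationMonoid.fintypeSubtypeDvd 𝔞 h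
  have h1 : {δ : Ideal (𝓞 K) | δ ∣ 𝔞}.Finite := @Set.toFinite _ _ (Finite.of_fintype {δ // δ ∣ 𝔞})
  exact h1.subset fun δ hδ => hδ.1

theorem dvd_of_dvd_prime_pow_mul {p δ c : Ideal (𝓞 K)} (hp : Prime p) (hδ : ¬ p ∣ δ) (e : ℕ)
    (h : δ ∣ p ^ e * c) : δ ∣ c := by
  induction e with
  | zero => simpa using h
  | succ e ih =>
    apply ih
    rw [pow_succ', mul_assoc] at h
    obtain ⟨k, hk⟩ := h
    obtain ⟨k', rfl⟩ := (hp.dvd_or_dvd (hk ▸ dvd_mul_right _ _)).resolve_left hδ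
    rw [mul_left_comm δ] at hk
    exact ⟨k', mul_left_cancel₀ hp.ne_zero hk⟩

open Classical in
theorem sigma_pow_succ_mul (𝔇 : Ideal (𝓞 K)) {π γ : 𝓞 K} (hπ : Prime π) (hγ : γ ≠ 0)
    (hπγ : ¬ π ∣ γ) (e : ℕ) : sigma 𝔇 (π ^ (e + 1) * γ) = sigma 𝔇 γ +
      (if Ideal.span {π} ∣ 𝔇 then 0 else Ideal.absNorm (Ideal.span {π})) *
        sigma 𝔇 (π ^ e * γ) := by
  set p := Ideal.span {π} with hpdef
  have hp : Prime p := by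
    rw [hpdef, Ideal.prime_iff_isPrime (by simpa using hπ.ne_zero)]
    exact (Ideal.span_singleton_prime hπ.ne_zero).2 hπ
  set c := Ideal.span {γ} with hc
  have hc0 : c ≠ 0 := by simpa [hc] using hγ
  have hpc : ¬ p ∣ c := by
    rwa [hpdef, hc, Ideal.dvd_iff_le, Ideal.span_singleton_le_span_singleton]
  have hspan : ∀ e, Ideal.span {π ^ e * γ} = p ^ e * c := fun e => by
    rw [hpdef, hc, Ideal.span_singleton_pow, Ideal.span_singleton_mul_span_singleton]
  simp only [sigma_eq, hspan, ← hc]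
  have hne : ∀ e, p ^ e * c ≠ 0 := fun e => mul_ne_zero (pow_ne_zero _ hp.ne_zero) hc0
  have hsplit : sigmaSet 𝔇 (p ^ (e + 1) * c) = sigmaSet 𝔇 c ∪
      {δ | p ∣ δ ∧ δ ∈ sigmaSet 𝔇 (p ^ (e + 1) * c)} := by
    ext δ
    constructor
    · intro hδ
      by_cases h : p ∣ δ
      · exact Or.inr ⟨h, hδ⟩
      · exact Or.inl ⟨dvd_of_dvd_prime_pow_mul hp h _ hδ.1, hδ.2⟩
    · rintro (hδ | hδ)
      · exact ⟨hδ.1.trans (dvd_mul_left _ _), hδ.2⟩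
      · exact hδ.2
  rw [hsplit, finsum_mem_union]
  · congr 1
    split_ifs with hpD
    · rw [zero_mul]
      have : {δ | p ∣ δ ∧ δ ∈ sigmaSet 𝔇 (p ^ (e + 1) * c)} = ∅ := by
        rw [Set.eq_empty_iff_forall_notMem]
        rintro δ ⟨h1, h2⟩
        exact h2.2 p hp hpD h1
      rw [this, finsum_mem_empty]
    · have : {δ | p ∣ δ ∧ δ ∈ sigmaSet 𝔇 (p ^ (e + 1) * c)} =
          (p * ·) '' sigmaSet 𝔇 (p ^ e * c) := by
        ext δ
        constructor
        · rintro ⟨⟨δ', rfl⟩, h1, h2⟩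
          refine ⟨δ', ⟨?_, fun p' hp' hd h => h2 p' hp' hd (h.mul_left _)⟩, rfl⟩
          rw [pow_succ', mul_assoc] at h1
          exact (mul_dvd_mul_iff_left hp.ne_zero).1 h1
        · rintro ⟨δ', ⟨h1, h2⟩, rfl⟩
          refine ⟨dvd_mul_right _ _, ?_, fun p' hp' hd h => ?_⟩
          · change p * δ' ∣ _
            rw [pow_succ', mul_assoc]
            exact mul_dvd_mul_left _ h1
          · rcases hp'.dvd_or_dvd h with h | h
            · exact hpD (((hp'.dvd_prime_iff_associated hp).1 h).symm.dvd.trans hd)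
            · exact h2 p' hp' hd h
      rw [this, finsum_mem_image (fun x _ y _ h => mul_left_cancel₀ hp.ne_zero h),
        finsum_mem_eq_finite_toFinset_sum _ (finite_sigmaSet 𝔇 (hne e)),
        finsum_mem_eq_finite_toFinset_sum _ (finite_sigmaSet 𝔇 (hne e)), Finset.mul_sum]
      simp only [map_mul]
  · rw [Set.disjoint_left]
    rintro δ ⟨h1, -⟩ ⟨h2, -⟩
    exact hpc (h2.trans h1)
  · exact finite_sigmaSet _ hc0
  · exact (finite_sigmaSet _ (hne (e + 1))).subset fun δ h => h.2

open Classical in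
theorem sigma_pow_mul (𝔇 : Ideal (𝓞 K)) {π γ : 𝓞 K} (hπ : Prime π) (hγ : γ ≠ 0)
    (hπγ : ¬ π ∣ γ) (e : ℕ) : sigma 𝔇 (π ^ e * γ) = (∑ i ∈ Finset.range (e + 1),
      (if Ideal.span {π} ∣ 𝔇 then 0 else Ideal.absNorm (Ideal.span {π})) ^ i) * sigma 𝔇 γ := by
  induction e with
  | zero => simp
  | succ e ih =>
    rw [sigma_pow_succ_mul 𝔇 hπ hγ hπγ, ih, Finset.sum_range_succ' _ (e + 1), pow_zero, add_mul,
      one_mul, add_comm, ← mul_assoc, Finset.mul_sum]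
    simp only [pow_succ']

theorem sigma_unit (𝔇 : Ideal (𝓞 K)) {ε : 𝓞 K} (hε : IsUnit ε) : sigma 𝔇 ε = 1 := by
  have : sigmaSet 𝔇 (Ideal.span {ε}) = {1} := by
    ext δ
    rw [Ideal.span_singleton_eq_top.2 hε, ← Ideal.one_eq_top]
    constructor
    · intro h; exact (Ideal.isUnit_iff.1 (isUnit_of_dvd_one h.1)).trans Ideal.one_eq_top.symm
    · rintro rfl
      exact ⟨dvd_rfl, fun p hp _ h => hp.not_isUnit (isUnit_of_dvd_one h)⟩
  rw [sigma_eq, this, finsum_mem_singleton, map_one]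

theorem sigma_mul_prime (𝔇 : Ideal (𝓞 K)) {π γ : 𝓞 K} (hπ : Prime π) (hπγ : ¬ π ∣ γ) :
    sigma (Ideal.span {π} * 𝔇) γ = sigma 𝔇 γ := by
  have hp : Prime (Ideal.span {π}) := by
    rw [Ideal.prime_iff_isPrime (by simpa using hπ.ne_zero)]
    exact (Ideal.span_singleton_prime hπ.ne_zero).2 hπ
  suffices hset : sigmaSet (Ideal.span {π} * 𝔇) (Ideal.span {γ}) =
      sigmaSet 𝔇 (Ideal.span {γ}) by
    rw [sigma_eq, sigma_eq, hset]
  ext δ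
  constructor
  · rintro ⟨h1, h2⟩
    exact ⟨h1, fun p hp hd => h2 p hp (hd.mul_left _)⟩
  · rintro ⟨h1, h2⟩
    refine ⟨h1, fun p' hp' hd h => ?_⟩
    rcases hp'.dvd_or_dvd hd with h3 | h3
    · have h4 := ((hp'.dvd_prime_iff_associated hp).1 h3).symm.dvd.trans (h.trans h1)
      rw [Ideal.dvd_iff_le, Ideal.span_singleton_le_span_singleton] at h4
      exact hπγ h4
    · exact h2 p' hp' h3 h

end Sigma

/-! ### Perceptive suborders with cyclic quotient of order `β²` -/

namespace StdInvolution

variable {O R : Type*} [CommRing O] [IsDomain O] [Ring R] [Algebra O R] {S : StdInvolution O R}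
variable {β : O} {q : ℕ}

/-- The left ideal of elements annihilating `m` modulo `I R`. -/
def annMod (m : R) (I : Ideal O) : Ideal R where
  carrier := {x | x * m ∈ scalarIdeal R I}
  add_mem' := fun {x y} hx hy => by
    simp only [Set.mem_ofPred_eq, add_mul]
    exact add_mem hx hy
  zero_mem' := by simp
  smul_mem' := fun c x hx => by
    simp only [smul_eq_mul, Set.mem_ofPred_eq, mul_assoc]
    exact Ideal.mul_mem_left _ _ hx

omit [IsDomain O] in
theorem mem_annMod {m x : R} {I : Ideal O} : x ∈ annMod m I ↔ x * m ∈ scalarIdeal R I := Iff.rfl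

variable (S) in
/-- Cramer's rule for the discriminant form, with integral coefficients. -/
def HasCramer : Prop := ∀ x y w z : R, ∃ c : O,
  algebraMap O R (S.tr ((x * y - y * x) * S.conj w)) * z =
    algebraMap O R (S.tr (z * (y * S.conj w - S.conj w * y))) * x +
    algebraMap O R (S.tr (z * (S.conj w * x - x * S.conj w))) * y +
    algebraMap O R (S.tr (z * (y * x - x * y))) * w + algebraMap O R c

omit [IsDomain O] in
/-- The trace form is nondegenerate modulo every power of a prime not dividing the
discriminant. -/
theorem mem_scalarIdeal_of_tr_mul_mem (hcr : S.HasCramer) {𝔭 : Ideal O} (hp : 𝔭.IsMaximal) (k : ℕ)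
    {x y w : R} (hδ : S.tr ((x * y - y * x) * S.conj w) ∉ 𝔭) {t : R}
    (hδk : ∀ c, S.tr ((x * y - y * x) * S.conj w) * c ∈ 𝔭 ^ k → c ∈ 𝔭 ^ k)
    (ht : ∀ z, S.tr (t * z) ∈ 𝔭 ^ k) : t ∈ scalarIdeal R (𝔭 ^ k) := by
  obtain ⟨c, hc⟩ := hcr x y w t
  set D := (x * y - y * x) * S.conj w with hD
  set δ := S.tr D with hδdef
  have h1 : algebraMap O R δ * t - algebraMap O R c ∈ scalarIdeal R (𝔭 ^ k) := by
    rw [hc, add_sub_cancel_right]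
    refine add_mem (add_mem ?_ ?_) ?_ <;> exact algebraMap_mul_mem_scalarIdeal (ht _) _
  have h2 : c * δ ∈ 𝔭 ^ k := by
    have h3 : S.tr ((algebraMap O R δ * t - algebraMap O R c) * D) ∈ 𝔭 ^ k :=
      tr_mem_of_mem_scalarIdeal (Ideal.mul_mem_right _ _ h1)
    rw [sub_mul, S.tr_sub, S.tr_algebraMap_mul, mul_assoc, S.tr_algebraMap_mul] at h3
    have h4 := sub_mem (Ideal.mul_mem_left _ δ (ht D)) h3
    rwa [sub_sub_cancel] at h4
  have h3 : c ∈ 𝔭 ^ k := hδk c (by rwa [mul_comm])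
  refine mem_scalarIdeal_of_mul_mem hp k hδ ?_
  have := add_mem h1 (algebraMap_mem_scalarIdeal (R := R) h3)
  rwa [sub_add_cancel] at this

namespace IsGoodPrime

variable (hg : S.IsGoodPrime β q)
include hg

omit [IsDomain O] in
/-- The left ideals strictly between `β R` and `R` are those generated by an element of
norm `β`. -/
theorem mem_normIdeals_of_lt {J : Ideal R} (h1 : scalarIdeal R (Ideal.span {β}) ≤ J)
    (hJ1 : (1 : R) ∉ J) {x : R} (hx : x ∈ J) (hx' : x ∉ scalarIdeal R (Ideal.span {β})) :
    J ∈ S.normIdeals β := by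
  have hn : ∀ z ∈ J, β ∣ S.n z := by
    intro z hz
    by_contra hc
    apply hJ1
    have h2 : algebraMap O R (S.n z) ∈ J := by
      rw [← S.conj_mul_self]; exact Ideal.mul_mem_left _ _ hz
    obtain ⟨a, b, hb, hab⟩ := hg.isMaximal.exists_inv
      (x := S.n z) (by rwa [Ideal.mem_span_singleton])
    rw [← map_one (algebraMap O R), ← hab, map_add, map_mul]
    exact add_mem (Ideal.mul_mem_left _ _ h2) (h1 (algebraMap_mem_scalarIdeal hb))
  have hle : ∀ A ∈ S.normIdeals β, ∀ z ∈ A, z ∈ J → z ∉ scalarIdeal R (Ideal.span {β}) →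
      A ≤ J := by
    intro A hA z hzA hzJ hz
    rw [hg.sup_eq hA hzA hz]
    exact sup_le (by rwa [Ideal.span_singleton_le_iff_mem]) h1
  obtain ⟨A, hA, hxA⟩ := hg.exists_mem_normIdeals (hn x hx)
  have hAJ := hle A hA x hxA hx hx'
  suffices J ≤ A by rwa [le_antisymm this hAJ]
  intro z hz
  by_contra hzA
  obtain ⟨B, hB, hzB⟩ := hg.exists_mem_normIdeals (hn z hz)
  have hBJ := hle B hB z hzB hz (fun h => hzA (scalarIdeal_le hA h))
  have h3 := hg.sup_eq_top hA hB (fun h => hzA (h ▸ hzB))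
  exact hJ1 (sup_le hAJ hBJ (h3 ▸ Submodule.mem_top))

theorem pow_dvd_of_dvd_mul {δ c : O} (hδ : ¬ β ∣ δ) (k : ℕ) (h : β ^ k ∣ δ * c) : β ^ k ∣ c :=
  hg.prime.pow_dvd_of_dvd_mul_left k hδ h

end IsGoodPrime

variable (S β q) in
/-- A suborder `G` with `R / G` cyclic of order `β²`, cut out by a functional `φ` on `R`, that
meets every orbit of the norm one units. -/
structure IsPerceptiveSub (G : Subalgebra O R) (φ : R →ₗ[O] O ⧸ Ideal.span {β ^ 2}) : Prop where
  good : S.IsGoodPrime β q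
  cramer : S.HasCramer
  not_dvdDisc : ¬ S.DvdDisc β
  card_quot_sq : Nat.card (O ⧸ Ideal.span {β ^ 2}) = q ^ 2
  surj : Function.Surjective φ
  ker : ∀ x, φ x = 0 ↔ x ∈ G
  perc : ∀ x, ∃ u, S.n u = 1 ∧ u * x ∈ G

/-- An element `m` whose trace functional defines `G` modulo `β²`. -/
structure IsDefining (S : StdInvolution O R) (β : O) (G : Subalgebra O R) (m h₀ : R) : Prop where
  mem_iff : ∀ z, z ∈ G ↔ β ^ 2 ∣ S.tr (z * m)
  not_dvd : ¬ β ∣ S.tr (h₀ * m)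
  generates : ∀ z, ∃ t, z - algebraMap O R t * h₀ ∈ G

namespace IsPerceptiveSub

variable {G : Subalgebra O R} {φ : R →ₗ[O] O ⧸ Ideal.span {β ^ 2}}
variable (hG : S.IsPerceptiveSub β q G φ)
include hG

/-- By Cramer's rule a functional vanishing on scalars is a combination of trace functionals, with
the discriminant, which is prime to `β`, as denominator. -/
theorem exists_isDefining : ∃ m h₀, IsDefining S β G m h₀ := by
  have h := hG.not_dvdDisc
  simp only [DvdDisc, not_forall] at h
  obtain ⟨x, y, w, hδ⟩ := h
  set δ := S.tr ((x * y - y * x) * S.conj w) with hδdef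
  obtain ⟨f₁, h₁⟩ := Ideal.Quotient.mk_surjective (φ x)
  obtain ⟨f₂, h₂⟩ := Ideal.Quotient.mk_surjective (φ y)
  obtain ⟨f₃, h₃⟩ := Ideal.Quotient.mk_surjective (φ w)
  set m := algebraMap O R f₁ * (y * S.conj w - S.conj w * y) +
    algebraMap O R f₂ * (S.conj w * x - x * S.conj w) + algebraMap O R f₃ * (y * x - x * y) with hm
  have hφ1 : ∀ c, φ (algebraMap O R c) = 0 := fun c => (hG.ker _).2 (G.algebraMap_mem c)
  have hφm : ∀ c z, φ (algebraMap O R c * z) = Ideal.Quotient.mk _ c * φ z := fun c z => by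
    rw [← Algebra.smul_def, map_smul, Algebra.smul_def]; rfl
  have key : ∀ z, Ideal.Quotient.mk _ δ * φ z =
      Ideal.Quotient.mk (Ideal.span {β ^ 2}) (S.tr (z * m)) := by
    intro z
    obtain ⟨c, hc⟩ := hG.cramer x y w z
    have h4 := congrArg φ hc
    rw [map_add, map_add, map_add, hφm, hφm, hφm, hφm, hφ1, add_zero, ← h₁, ← h₂, ← h₃] at h4
    rw [h4, hm, ← map_mul, ← map_mul, ← map_mul, ← map_add, ← map_add]
    have : ∀ f A, S.tr (z * (algebraMap O R f * A)) = f * S.tr (z * A) := fun f A => by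
      rw [← S.tr_algebraMap_mul, ← mul_assoc, ← mul_assoc, Algebra.commutes]
    rw [mul_add, mul_add, S.tr_add, S.tr_add, this, this, this]
    congr 1
    ring
  have hmem : ∀ z, z ∈ G ↔ β ^ 2 ∣ S.tr (z * m) := by
    intro z
    rw [← hG.ker, ← Ideal.mem_span_singleton, ← Ideal.Quotient.eq_zero_iff_mem, ← key]
    constructor
    · intro h; rw [h, mul_zero]
    · obtain ⟨t, ht⟩ := Ideal.Quotient.mk_surjective (φ z)
      rw [← ht, ← map_mul, Ideal.Quotient.eq_zero_iff_mem, Ideal.Quotient.eq_zero_iff_mem,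
        Ideal.mem_span_singleton, Ideal.mem_span_singleton]
      exact hG.good.pow_dvd_of_dvd_mul hδ 2
  obtain ⟨h₀, hh⟩ := hG.surj 1
  refine ⟨m, h₀, hmem, fun hd => ?_, fun z => ?_⟩
  · have h5 := key h₀
    rw [hh, mul_one, Ideal.Quotient.eq, Ideal.mem_span_singleton] at h5
    have h6 := dvd_add ((dvd_pow_self β two_ne_zero).trans h5) hd
    rw [sub_add_cancel] at h6
    exact hδ h6
  · obtain ⟨t, ht⟩ := Ideal.Quotient.mk_surjective (φ z)
    refine ⟨t, ?_⟩
    rw [← hG.ker, map_sub, hφm, hh, mul_one, ht, sub_self]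

variable {m h₀ : R} (hm : IsDefining S β G m h₀)
include hm

omit hm in
theorem mem_scalarIdeal_of_tr (k : ℕ) {t : R} (ht : ∀ z, β ^ k ∣ S.tr (z * t)) :
    t ∈ scalarIdeal R (Ideal.span {β ^ k}) := by
  have h := hG.not_dvdDisc
  simp only [DvdDisc, not_forall] at h
  obtain ⟨x, y, w, hδ⟩ := h
  rw [← Ideal.span_singleton_pow]
  refine mem_scalarIdeal_of_tr_mul_mem hG.cramer hG.good.isMaximal k (x := x) (y := y) (w := w)
    (by rwa [Ideal.mem_span_singleton]) (fun c => ?_) (fun z => ?_)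
  · rw [Ideal.span_singleton_pow, Ideal.mem_span_singleton, Ideal.mem_span_singleton]
    exact hG.good.pow_dvd_of_dvd_mul hδ k
  · rw [Ideal.span_singleton_pow, Ideal.mem_span_singleton, S.tr_mul_comm]
    exact ht z

omit hG [IsDomain O] in
theorem annMod_sq_le {x : R} (hx : x ∈ annMod m (Ideal.span {β ^ 2})) : x ∈ G := by
  rw [hm.mem_iff, ← Ideal.mem_span_singleton]
  exact tr_mem_of_mem_scalarIdeal hx

theorem algebraMap_mem_annMod (c : O) (k : ℕ) :
    algebraMap O R c ∈ annMod m (Ideal.span {β ^ k}) ↔ β ^ k ∣ c := by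
  constructor
  · intro h
    have h1 : S.tr (h₀ * (algebraMap O R c * m)) ∈ Ideal.span {β ^ k} :=
      tr_mem_of_mem_scalarIdeal (Ideal.mul_mem_left _ _ h)
    rw [← mul_assoc, ← Algebra.commutes, mul_assoc, S.tr_algebraMap_mul, mul_comm,
      Ideal.mem_span_singleton] at h1
    exact hG.good.pow_dvd_of_dvd_mul hm.not_dvd k h1
  · intro h
    exact algebraMap_mul_mem_scalarIdeal (Ideal.mem_span_singleton.2 h) m

/-- Every element of `G` acts on `m` by a scalar modulo `β²`. -/
theorem exists_sub_mem {g : R} (hgG : g ∈ G) :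
    ∃ s, g - algebraMap O R s ∈ annMod m (Ideal.span {β ^ 2}) := by
  have hinv : ∃ d, β ^ 2 ∣ d * S.tr (h₀ * m) - 1 := by
    have hc : IsCoprime (S.tr (h₀ * m)) (β ^ 2) := by
      refine IsCoprime.pow_right ?_
      obtain ⟨a, b, hb, hab⟩ := hG.good.isMaximal.exists_inv
        (x := S.tr (h₀ * m)) (by rw [Ideal.mem_span_singleton]; exact hm.not_dvd)
      obtain ⟨b', rfl⟩ := Ideal.mem_span_singleton'.1 hb
      exact ⟨a, b', hab⟩
    obtain ⟨a, b, hab⟩ := hc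
    exact ⟨a, -b, by linear_combination hab⟩
  obtain ⟨d, hd⟩ := hinv
  refine ⟨d * S.tr (h₀ * (g * m)), ?_⟩
  rw [mem_annMod, sub_mul]
  refine hG.mem_scalarIdeal_of_tr 2 fun z => ?_
  obtain ⟨t, ht⟩ := hm.generates z
  have h1 := (hm.mem_iff _).1 ht
  have h2 := (hm.mem_iff _).1 (G.mul_mem ht hgG)
  rw [mul_assoc, sub_mul, S.tr_sub, mul_assoc, S.tr_algebraMap_mul] at h2
  rw [sub_mul, S.tr_sub, mul_assoc, S.tr_algebraMap_mul] at h1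
  rw [mul_sub, S.tr_sub, ← mul_assoc z (algebraMap O R _), ← Algebra.commutes, mul_assoc,
    S.tr_algebraMap_mul]
  have : S.tr (z * (g * m)) - d * S.tr (h₀ * (g * m)) * S.tr (z * m) =
    (S.tr (z * (g * m)) - t * S.tr (h₀ * (g * m))) -
      d * S.tr (h₀ * (g * m)) * (S.tr (z * m) - t * S.tr (h₀ * m)) -
      t * S.tr (h₀ * (g * m)) * (d * S.tr (h₀ * m) - 1) := by ring
  rw [this]
  exact dvd_sub (dvd_sub h2 (Dvd.dvd.mul_left h1 _)) (Dvd.dvd.mul_left hd _)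

omit hG hm [IsDomain O] in
theorem annMod_sq_le_annMod : annMod m (Ideal.span {β ^ 2}) ≤ annMod m (Ideal.span {β}) := by
  intro x hx
  obtain ⟨y, hy⟩ := mem_scalarIdeal_singleton.1 hx
  rw [mem_annMod, hy, sq, map_mul, mul_assoc]
  exact algebraMap_mul_mem_scalarIdeal (Ideal.mem_span_singleton_self _) _

omit hG [IsDomain O] in
theorem notMem_scalarIdeal : m ∉ scalarIdeal R (Ideal.span {β}) := fun h => by
  apply hm.not_dvd
  rw [← Ideal.mem_span_singleton]
  exact tr_mem_of_mem_scalarIdeal (Ideal.mul_mem_left _ _ h)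

/-- If `m` were invertible modulo `β`, then `G` would consist of scalars modulo `β`, and `R` would
be commutative modulo `β`. -/
theorem dvd_n : β ∣ S.n m := by
  by_contra hc
  have h1 : ∀ x ∈ annMod m (Ideal.span {β}), x ∈ scalarIdeal R (Ideal.span {β}) := by
    intro x hx
    refine hG.good.isUnit_mod hc ?_
    rw [Algebra.commutes, ← S.mul_conj, ← mul_assoc]
    exact Ideal.mul_mem_right _ _ hx
  have h2 : ∀ x : R, ∃ t s : O, ∃ p ∈ scalarIdeal R (Ideal.span {β}),
      x = algebraMap O R t * h₀ + algebraMap O R s + p := by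
    intro x
    obtain ⟨t, ht⟩ := hm.generates x
    obtain ⟨s, hs⟩ := hG.exists_sub_mem hm ht
    exact ⟨t, s, _, h1 _ (annMod_sq_le_annMod hs), by abel⟩
  have h3 : ∀ x y : R, x * y - y * x ∈ scalarIdeal R (Ideal.span {β}) := by
    intro x y
    obtain ⟨t, s, p, hp, rfl⟩ := h2 x
    obtain ⟨t', s', p', hp', rfl⟩ := h2 y
    set u := algebraMap O R t * h₀ + algebraMap O R s
    set v := algebraMap O R t' * h₀ + algebraMap O R s'
    have huv : u * v = v * u := by
      have c0 : ∀ c (z : R), Commute (algebraMap O R c) z := fun c z => Algebra.commutes c z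
      refine (Commute.add_left (Commute.add_right ?_ ?_) (c0 _ _)).eq
      · exact ((c0 t _).mul_left ((c0 t' h₀).symm.mul_right rfl))
      · exact (c0 s' _).symm
    have : (u + p) * (v + p') - (v + p') * (u + p) =
        u * p' + p * (v + p') - (v * p + p' * (u + p)) := by
      have : (u + p) * (v + p') - (v + p') * (u + p) =
        u * v - v * u + (u * p' + p * (v + p') - (v * p + p' * (u + p))) := by noncomm_ring
      rw [this, huv, sub_self, zero_add]
    rw [this]
    exact sub_mem (add_mem (Ideal.mul_mem_left _ _ hp') (Ideal.mul_mem_right _ _ hp))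
      (add_mem (Ideal.mul_mem_left _ _ hp) (Ideal.mul_mem_right _ _ hp'))
  refine hG.not_dvdDisc fun x y z => ?_
  rw [← Ideal.mem_span_singleton]
  exact tr_mem_of_mem_scalarIdeal (Ideal.mul_mem_right _ _ (h3 x y))

theorem annMod_mem_normIdeals : annMod m (Ideal.span {β}) ∈ S.normIdeals β := by
  have h1 : S.conj m ∈ annMod m (Ideal.span {β}) := by
    rw [mem_annMod, S.conj_mul_self]
    exact algebraMap_mem_scalarIdeal (Ideal.mem_span_singleton.2 (hG.dvd_n hm))
  refine hG.good.mem_normIdeals_of_lt (fun x hx => Ideal.mul_mem_right _ _ hx) ?_ h1 ?_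
  · rw [mem_annMod, one_mul]; exact notMem_scalarIdeal hm
  · intro h
    obtain ⟨y, hy⟩ := mem_scalarIdeal_singleton.1 h
    apply notMem_scalarIdeal hm
    rw [← S.conj_conj m, hy, S.conj_mul, S.conj_algebraMap, ← Algebra.commutes]
    exact algebraMap_mul_mem_scalarIdeal (Ideal.mem_span_singleton_self _) _

end IsPerceptiveSub
end StdInvolution

/-! ### Indices of the annihilators of a defining element -/

namespace StdInvolution

variable {O R : Type*} [CommRing O] [IsDomain O] [Ring R] [Algebra O R] {S : StdInvolution O R}
variable {β : O} {q : ℕ}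

omit [IsDomain O] in
/-- If `A` is generated by scalars modulo `B`, and the scalars in `B` are those in `I`, then
`A / B` has the order of `O / I`. -/
theorem relIndex_eq_of_scalars {A B : AddSubgroup R} {I : Ideal O}
    (hA : ∀ c, algebraMap O R c ∈ A) (h : ∀ x ∈ A, ∃ c, x - algebraMap O R c ∈ B)
    (hB : ∀ c, algebraMap O R c ∈ B ↔ c ∈ I) : B.relIndex A = Nat.card (O ⧸ I) := by
  let t : O →+ A ⧸ B.addSubgroupOf A :=
    (QuotientAddGroup.mk' _).comp ((algebraMap O R : O →+ R).codRestrict A hA)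
  have ht : Function.Surjective t := by
    rintro ⟨x, hx⟩
    obtain ⟨c, hc⟩ := h x hx
    refine ⟨c, QuotientAddGroup.eq.2 ?_⟩
    change -(algebraMap O R c) + x ∈ B
    rwa [neg_add_eq_sub]
  have hk : t.ker = I.toAddSubgroup := by
    ext c
    rw [AddMonoidHom.mem_ker]
    exact (QuotientAddGroup.eq_zero_iff _).trans (hB c)
  have h1 : t.ker.index = B.relIndex A := by
    rw [AddSubgroup.index_ker, AddMonoidHom.range_eq_top.2 ht]
    exact Nat.card_congr AddSubgroup.topEquiv.toEquiv
  rw [← h1, hk]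
  rfl

namespace IsPerceptiveSub

variable {G : Subalgebra O R} {φ : R →ₗ[O] O ⧸ Ideal.span {β ^ 2}}
variable (hG : S.IsPerceptiveSub β q G φ) {m h₀ : R} (hm : IsDefining S β G m h₀)
include hG

/-- The underlying additive group of a subalgebra. -/
abbrev addG (G : Subalgebra O R) : AddSubgroup R := (Subalgebra.toSubmodule G).toAddSubgroup

omit [IsDomain O] in
theorem index_addG : (addG G).index = q ^ 2 := by
  have h1 : φ.toAddMonoidHom.ker = addG G := by
    ext x
    rw [AddMonoidHom.mem_ker]
    exact hG.ker x
  rw [← h1, AddSubgroup.index_ker, AddMonoidHom.range_eq_top.2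
    (show Function.Surjective φ.toAddMonoidHom from hG.surj),
    ← hG.card_quot_sq]
  exact Nat.card_congr AddSubgroup.topEquiv.toEquiv

include hm

theorem relIndex_addG :
    (annMod m (Ideal.span {β ^ 2})).toAddSubgroup.relIndex (addG G) = q ^ 2 := by
  rw [← hG.card_quot_sq]
  exact relIndex_eq_of_scalars (fun c => G.algebraMap_mem c) (fun x hx => hG.exists_sub_mem hm hx)
    (fun c => by rw [Ideal.mem_span_singleton]; exact hG.algebraMap_mem_annMod hm c 2)

theorem algebraMap_mem_annMod_one (c : O) :
    algebraMap O R c ∈ annMod m (Ideal.span {β}) ↔ β ∣ c := by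
  have := hG.algebraMap_mem_annMod hm c 1
  rwa [pow_one] at this

theorem relIndex_annMod_addG :
    (annMod m (Ideal.span {β})).toAddSubgroup.relIndex (addG G) = q := by
  rw [← hG.good.card_quot]
  refine relIndex_eq_of_scalars (fun c => G.algebraMap_mem c) (fun x hx => ?_)
    (fun c => by rw [Ideal.mem_span_singleton]; exact hG.algebraMap_mem_annMod_one hm c)
  obtain ⟨c, hc⟩ := hG.exists_sub_mem hm hx
  exact ⟨c, annMod_sq_le_annMod hc⟩

theorem index_annMod_sq : (annMod m (Ideal.span {β ^ 2})).toAddSubgroup.index = q ^ 4 := by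
  have h := AddSubgroup.relIndex_mul_index
    (show (annMod m (Ideal.span {β ^ 2})).toAddSubgroup ≤ addG G from
      fun x hx => annMod_sq_le hm hx)
  rw [hG.relIndex_addG hm, hG.index_addG] at h
  rw [← h]; ring

theorem relIndex_annMod : (annMod m (Ideal.span {β ^ 2})).toAddSubgroup.relIndex
    (annMod m (Ideal.span {β})).toAddSubgroup = q ^ 2 := by
  have h := AddSubgroup.relIndex_mul_index
    (show (annMod m (Ideal.span {β ^ 2})).toAddSubgroup ≤ (annMod m (Ideal.span {β})).toAddSubgroup
      from annMod_sq_le_annMod)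
  rw [hG.index_annMod_sq hm, hG.good.index_of_mem (hG.annMod_mem_normIdeals hm)] at h
  have := hG.good.one_lt
  exact Nat.eq_of_mul_eq_mul_right (show 0 < q ^ 2 by positivity) (by rw [h]; ring)

theorem relIndex_inf : (annMod m (Ideal.span {β ^ 2})).toAddSubgroup.relIndex
    (addG G ⊓ (annMod m (Ideal.span {β})).toAddSubgroup) = q := by
  have h := AddSubgroup.relIndex_mul_relIndex
    (H := (annMod m (Ideal.span {β ^ 2})).toAddSubgroup)
    (K := addG G ⊓ (annMod m (Ideal.span {β})).toAddSubgroup) (L := addG G)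
    (le_inf (fun x hx => annMod_sq_le hm hx) (fun x hx => annMod_sq_le_annMod hx)) inf_le_left
  rw [hG.relIndex_addG hm, AddSubgroup.inf_relIndex_left, hG.relIndex_annMod_addG hm] at h
  have := hG.good.one_lt
  exact Nat.eq_of_mul_eq_mul_right (show 0 < q by omega) (by rw [h]; ring)

/-- The annihilator of `m` modulo `β²` is generated by a product of two elements of norm `β`. -/
theorem exists_annMod_sq_eq : ∃ y, S.n y = β ^ 2 ∧
    annMod m (Ideal.span {β ^ 2}) = Ideal.span {y} := by
  obtain ⟨y₁, hy₁, hM⟩ := hG.annMod_mem_normIdeals hm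
  have h1 : y₁ ∈ annMod m (Ideal.span {β}) := hM ▸ Ideal.mem_span_singleton_self _
  obtain ⟨w, hw⟩ := mem_scalarIdeal_singleton.1 h1
  have hβ := hG.good.prime.ne_zero
  have hq := hG.good.one_lt
  set L' : Ideal R := annMod w (Ideal.span {β}) with hL'
  have hmem : ∀ z, z * y₁ ∈ annMod m (Ideal.span {β ^ 2}) ↔ z ∈ L' := by
    intro z
    rw [mem_annMod, hL', mem_annMod, mul_assoc, hw, ← mul_assoc, ← Algebra.commutes, mul_assoc,
      mem_scalarIdeal_singleton, mem_scalarIdeal_singleton]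
    refine exists_congr fun u => ?_
    rw [sq, map_mul, mul_assoc]
    constructor
    · intro h
      rw [Algebra.commutes, Algebra.commutes β (algebraMap O R β * u)] at h
      exact mul_right_injective (by rw [S.n_algebraMap]; exact pow_ne_zero _ hβ) h
    · intro h; rw [h]
  have hinj : Function.Injective (AddMonoidHom.mulRight y₁) :=
    mul_right_injective (S := S) (by rw [hy₁]; exact hβ)
  have hmapL : L'.toAddSubgroup.map (AddMonoidHom.mulRight y₁) =
      (annMod m (Ideal.span {β ^ 2})).toAddSubgroup := by
    ext x
    constructor
    · rintro ⟨z, hz, rfl⟩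
      exact (hmem z).2 hz
    · intro hx
      have hx' : x ∈ Ideal.span {y₁} := hM ▸ annMod_sq_le_annMod hx
      obtain ⟨z, rfl⟩ := Ideal.mem_span_singleton'.1 hx'
      exact ⟨z, (hmem z).1 hx, rfl⟩
  have hmapT : (⊤ : AddSubgroup R).map (AddMonoidHom.mulRight y₁) =
      (annMod m (Ideal.span {β})).toAddSubgroup := by
    rw [hM]
    ext x
    constructor
    · rintro ⟨z, -, rfl⟩
      exact Ideal.mul_mem_left _ _ (Ideal.mem_span_singleton_self _)
    · intro hx
      obtain ⟨z, rfl⟩ := Ideal.mem_span_singleton'.1 hx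
      exact ⟨z, trivial, rfl⟩
  have hidx : L'.toAddSubgroup.index = q ^ 2 := by
    rw [← AddSubgroup.relIndex_top_right, ← AddSubgroup.relIndex_map_map_of_injective _ _ hinj,
      hmapL, hmapT, hG.relIndex_annMod hm]
  have hP : scalarIdeal R (Ideal.span {β}) ≤ L' := fun x hx => Ideal.mul_mem_right _ _ hx
  have h1L : (1 : R) ∉ L' := fun h => by
    rw [(Ideal.eq_top_iff_one _).2 h] at hidx
    have h2 : (⊤ : Ideal R).toAddSubgroup.index = 1 := AddSubgroup.index_top
    rw [h2] at hidx
    nlinarith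
  have hex : ∃ x ∈ L', x ∉ scalarIdeal R (Ideal.span {β}) := by
    by_contra! hcon
    have h3 := hG.good.index_scalar
    rw [le_antisymm hP hcon, hidx] at h3
    have : q ^ 2 < q ^ 4 := Nat.pow_lt_pow_right hq (by norm_num)
    omega
  obtain ⟨x, hx, hx'⟩ := hex
  obtain ⟨y₂, hy₂, hL2⟩ := hG.good.mem_normIdeals_of_lt hP h1L hx hx'
  refine ⟨y₂ * y₁, by rw [S.n_mul, hy₁, hy₂, sq], ?_⟩
  ext x
  constructor
  · intro hx
    have hx' : x ∈ Ideal.span {y₁} := hM ▸ annMod_sq_le_annMod hx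
    obtain ⟨z, rfl⟩ := Ideal.mem_span_singleton'.1 hx'
    have hz := (hmem z).1 hx
    rw [hL2] at hz
    obtain ⟨v, rfl⟩ := Ideal.mem_span_singleton'.1 hz
    rw [mul_assoc]
    exact Ideal.mul_mem_left _ _ (Ideal.mem_span_singleton_self _)
  · intro hx
    obtain ⟨v, rfl⟩ := Ideal.mem_span_singleton'.1 hx
    rw [← mul_assoc, hmem, hL2]
    exact Ideal.mul_mem_left _ _ (Ideal.mem_span_singleton_self _)

end IsPerceptiveSub
end StdInvolution

/-! ### Units carrying an element into the suborder -/

namespace StdInvolution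

variable {O R : Type*} [CommRing O] [IsDomain O] [Ring R] [Algebra O R] {S : StdInvolution O R}
variable {β : O} {q : ℕ}

omit [IsDomain O] in
theorem mul_conj_of_n_eq_one {u : R} (hu : S.n u = 1) : u * S.conj u = 1 := by
  rw [S.mul_conj, hu, map_one]

omit [IsDomain O] in
theorem conj_mul_of_n_eq_one {u : R} (hu : S.n u = 1) : S.conj u * u = 1 := by
  rw [S.conj_mul_self, hu, map_one]

omit [IsDomain O] in
theorem ncard_map_mk {L : Ideal R} (B : AddSubgroup R) :
    (((B.map (QuotientAddGroup.mk' L.toAddSubgroup) : AddSubgroup _) :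
      Set (R ⧸ L.toAddSubgroup))).ncard = L.toAddSubgroup.relIndex B := by
  conv_rhs => rw [← QuotientAddGroup.ker_mk' L.toAddSubgroup]
  rw [AddSubgroup.relIndex_ker]
  rfl

omit [IsDomain O] in
theorem mk_mem_map_iff {L : Ideal R} {B : AddSubgroup R} (h : L.toAddSubgroup ≤ B) (x : R) :
    (x : R ⧸ L.toAddSubgroup) ∈ B.map (QuotientAddGroup.mk' L.toAddSubgroup) ↔ x ∈ B := by
  constructor
  · rintro ⟨y, hy, hxy⟩
    have h1 := h (QuotientAddGroup.eq.1 hxy)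
    have h2 := B.add_mem hy h1
    rwa [add_neg_cancel_left] at h2
  · intro hx; exact ⟨x, hx, rfl⟩

namespace IsPerceptiveSub

variable {G : Subalgebra O R} {φ : R →ₗ[O] O ⧸ Ideal.span {β ^ 2}}
variable (hG : S.IsPerceptiveSub β q G φ) {m h₀ : R} (hm : IsDefining S β G m h₀)
  (hfin : ∀ c, {x | S.n x = c}.Finite)

variable (S G) in
/-- The number of units of norm one carrying `x` into `G`. -/
def unitCount (x : R) : ℕ := {u | S.n u = 1 ∧ u * x ∈ G}.ncard

include hm hG in
/-- Up to a norm one unit every element is scalar modulo the annihilator of `m`. -/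
theorem exists_scalar (x : R) : ∃ u s, S.n u = 1 ∧
    u * x - algebraMap O R s ∈ annMod m (Ideal.span {β ^ 2}) := by
  obtain ⟨u, hu, hux⟩ := hG.perc x
  obtain ⟨s, hs⟩ := hG.exists_sub_mem hm hux
  exact ⟨u, s, hu, hs⟩

include hm in
theorem unitCount_eq {x u : R} {s : O} (hu : S.n u = 1)
    (hs : u * x - algebraMap O R s ∈ annMod m (Ideal.span {β ^ 2})) :
    unitCount S G x = unitCount S G (algebraMap O R s) := by
  have himg : {v | S.n v = 1 ∧ v * x ∈ G} =
      (· * u) '' {v | S.n v = 1 ∧ v * algebraMap O R s ∈ G} := by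
    have key : ∀ v, v * u * x ∈ G ↔ v * algebraMap O R s ∈ G := by
      intro v
      have h1 : v * u * x = v * algebraMap O R s + v * (u * x - algebraMap O R s) := by
        rw [mul_sub, mul_assoc]; abel
      have h2 : v * (u * x - algebraMap O R s) ∈ G :=
        annMod_sq_le hm (Ideal.mul_mem_left _ _ hs)
      rw [h1]
      exact ⟨fun h => by simpa using G.sub_mem h h2, fun h => G.add_mem h h2⟩
    ext v
    constructor
    · rintro ⟨hv, hvx⟩
      refine ⟨v * S.conj u, ⟨by rw [S.n_mul, S.n_conj, hu, hv, one_mul], ?_⟩, ?_⟩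
      · rw [← key, mul_assoc v, conj_mul_of_n_eq_one hu, mul_one]; exact hvx
      · simp only [mul_assoc, conj_mul_of_n_eq_one hu, mul_one]
    · rintro ⟨v, ⟨hv, hvs⟩, rfl⟩
      exact ⟨by rw [S.n_mul, hv, hu, one_mul], (key v).2 hvs⟩
  rw [unitCount, unitCount, himg, Set.ncard_image_of_injective]
  exact mul_right_injective (S := S) (by rw [hu]; exact one_ne_zero)

include hm hG in
theorem algebraMap_mul_mem_iff {t : O} (ht : ¬ β ∣ t) (z : R) :
    algebraMap O R t * z ∈ G ↔ z ∈ G := by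
  rw [hm.mem_iff, hm.mem_iff, mul_assoc, S.tr_algebraMap_mul]
  exact ⟨hG.good.pow_dvd_of_dvd_mul ht 2, fun h => Dvd.dvd.mul_left h t⟩

include hm hG in
theorem unitCount_of_notMem {x : R} (hx : x ∉ annMod m (Ideal.span {β})) :
    unitCount S G x = unitCount S G 1 := by
  obtain ⟨u, s, hu, hs⟩ := hG.exists_scalar hm x
  have hst : ¬ β ∣ s := by
    intro h
    apply hx
    have h1 := (hG.algebraMap_mem_annMod_one hm s).2 h
    have h2 := Ideal.mul_mem_left _ (S.conj u) (add_mem (annMod_sq_le_annMod hs) h1)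
    rwa [sub_add_cancel, ← mul_assoc, conj_mul_of_n_eq_one hu, one_mul] at h2
  rw [unitCount_eq hm hu hs, unitCount, unitCount]
  congr 1
  ext v
  simp only [Set.mem_ofPred_eq]
  rw [← Algebra.commutes, algebraMap_mul_mem_iff hG hm hst, mul_one]

include hm hG in
theorem unitCount_of_mem {x : R} (hx : x ∈ annMod m (Ideal.span {β}))
    (hx' : x ∉ annMod m (Ideal.span {β ^ 2})) :
    unitCount S G x = unitCount S G (algebraMap O R β) := by
  obtain ⟨u, s, hu, hs⟩ := hG.exists_scalar hm x
  have h1 : β ∣ s := by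
    rw [← hG.algebraMap_mem_annMod_one hm]
    have := sub_mem (Ideal.mul_mem_left _ u hx) (annMod_sq_le_annMod hs)
    rwa [sub_sub_cancel] at this
  obtain ⟨t, rfl⟩ := h1
  have hst : ¬ β ∣ t := by
    intro h
    apply hx'
    have h1 := (hG.algebraMap_mem_annMod hm (β * t) 2).2 (by rw [sq]; exact mul_dvd_mul_left _ h)
    have h2 := Ideal.mul_mem_left _ (S.conj u) (add_mem hs h1)
    rwa [sub_add_cancel, ← mul_assoc, conj_mul_of_n_eq_one hu, one_mul] at h2
  rw [unitCount_eq hm hu hs, unitCount, unitCount]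
  congr 1
  ext v
  simp only [Set.mem_ofPred_eq]
  rw [mul_comm β t, map_mul, ← mul_assoc, ← Algebra.commutes t v, mul_assoc,
    algebraMap_mul_mem_iff hG hm hst]

omit [IsDomain O] in
include hm in
theorem unitCount_of_mem_sq {x : R} (hx : x ∈ annMod m (Ideal.span {β ^ 2})) :
    unitCount S G x = S.repNum 1 := by
  rw [unitCount, repNum]
  congr 1
  ext v
  exact ⟨fun h => h.1, fun h => ⟨h, annMod_sq_le hm (Ideal.mul_mem_left _ _ hx)⟩⟩

omit [IsDomain O] in
include hm hfin in
/-- Double counting of the pairs of a norm one unit and a class in a stable set `A` of classes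
modulo the annihilator of `m` that it carries into `G`. -/
theorem sum_unitCount {A : Set R} [Finite (R ⧸ (annMod m (Ideal.span {β ^ 2})).toAddSubgroup)]
    (hA : ∀ u x, S.n u = 1 → x ∈ A → u * x ∈ A) {k : ℕ}
    (hk : ∀ x ∈ A, unitCount S G x = k) :
    ((QuotientAddGroup.mk : R → R ⧸ (annMod m (Ideal.span {β ^ 2})).toAddSubgroup) '' A).ncard * k =
      S.repNum 1 * ((QuotientAddGroup.mk : R → R ⧸ (annMod m (Ideal.span {β ^ 2})).toAddSubgroup) ''
        (A ∩ G)).ncard := by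
  classical
  set L := annMod m (Ideal.span {β ^ 2}) with hL
  have hLG : L.toAddSubgroup ≤ addG G := fun x hx => annMod_sq_le hm hx
  set U := (hfin 1).toFinset with hU
  set mk : R → R ⧸ L.toAddSubgroup := QuotientAddGroup.mk with hmk
  have hmkeq : ∀ x y, mk x = mk y ↔ y - x ∈ L := fun x y => by
    rw [sub_eq_neg_add]; exact QuotientAddGroup.eq
  let act : R → (R ⧸ L.toAddSubgroup) → R ⧸ L.toAddSubgroup := fun u =>
    Quotient.map' (u * ·) (fun x y h => by
      rw [QuotientAddGroup.leftRel_apply] at h ⊢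
      rw [← mul_neg, ← mul_add]
      exact Ideal.mul_mem_left L _ h)
  have hact : ∀ u x, act u (mk x) = mk (u * x) := fun u x => rfl
  set AA := (Set.toFinite (mk '' A)).toFinset with hAA
  set ℓ := (addG G).map (QuotientAddGroup.mk' L.toAddSubgroup) with hℓ
  have hmem : ∀ x, mk x ∈ ℓ ↔ x ∈ G := fun x => mk_mem_map_iff hLG x
  have key := Finset.sum_card_bipartiteAbove_eq_sum_card_bipartiteBelow (s := U) (t := AA)
    (fun u v => act u v ∈ ℓ)
  have h1 : ∀ v ∈ AA, (Finset.bipartiteBelow (fun u v => act u v ∈ ℓ) U v).card = k := by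
    intro v hv
    rw [hAA, Set.Finite.mem_toFinset] at hv
    obtain ⟨x, hx, rfl⟩ := hv
    rw [← hk x hx, unitCount, ← Set.ncard_coe_finset]
    congr 1
    ext u
    simp [Finset.bipartiteBelow, hU, hact, hmem]
  have h2 : ∀ u ∈ U, (Finset.bipartiteAbove (fun u v => act u v ∈ ℓ) AA u).card =
      (mk '' (A ∩ G)).ncard := by
    intro u hu
    rw [hU, Set.Finite.mem_toFinset] at hu
    have hu : S.n u = 1 := hu
    have hu' : S.n (S.conj u) = 1 := by rw [S.n_conj, hu]
    have hinj : Function.Injective (act (S.conj u)) := by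
      rintro ⟨x⟩ ⟨y⟩ h
      have h1 := (hmkeq _ _).1 (show mk (S.conj u * x) = mk (S.conj u * y) from h)
      refine (hmkeq _ _).2 ?_
      have h2 := Ideal.mul_mem_left L u h1
      rwa [← mul_sub, ← mul_assoc, mul_conj_of_n_eq_one hu, one_mul] at h2
    rw [← Set.ncard_image_of_injective _ hinj, ← Set.ncard_coe_finset]
    congr 1
    ext v
    simp only [Finset.coe_bipartiteAbove, hAA, Set.Finite.mem_toFinset, Set.mem_ofPred_eq]
    constructor
    · rintro ⟨⟨x, hx, rfl⟩, hv⟩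
      rw [hact, hmem] at hv
      refine ⟨mk (u * x), ⟨u * x, ⟨hA u x hu hx, hv⟩, rfl⟩, ?_⟩
      rw [hact, ← mul_assoc, conj_mul_of_n_eq_one hu, one_mul]
    · rintro ⟨-, ⟨x, ⟨hxA, hxG⟩, rfl⟩, rfl⟩
      refine ⟨⟨S.conj u * x, hA _ x hu' hxA, rfl⟩, ?_⟩
      rw [hact, hact, hmem, ← mul_assoc, mul_conj_of_n_eq_one hu, one_mul]
      exact hxG
  rw [Finset.sum_congr rfl h1, Finset.sum_congr rfl h2, Finset.sum_const, Finset.sum_const,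
    smul_eq_mul, smul_eq_mul] at key
  rw [repNum, Set.ncard_eq_toFinset_card _ (hfin 1), ← hU, key,
    Set.ncard_eq_toFinset_card _ (Set.toFinite (mk '' A))]

end IsPerceptiveSub
end StdInvolution

/-! ### Counting elements of given norm in the suborder -/

namespace StdInvolution

variable {O R : Type*} [CommRing O] [IsDomain O] [Ring R] [Algebra O R] {S : StdInvolution O R}
variable {β : O} {q : ℕ}

omit [IsDomain O] in
theorem ncard_mk_image_diff {L : Ideal R} [Finite (R ⧸ L.toAddSubgroup)] {A B : AddSubgroup R}
    (hLA : L.toAddSubgroup ≤ A) (hAB : A ≤ B) :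
    ((QuotientAddGroup.mk : R → R ⧸ L.toAddSubgroup) '' ((B : Set R) \ A)).ncard +
      L.toAddSubgroup.relIndex A = L.toAddSubgroup.relIndex B := by
  have h : (QuotientAddGroup.mk : R → R ⧸ L.toAddSubgroup) '' ((B : Set R) \ A) =
      (B.map (QuotientAddGroup.mk' L.toAddSubgroup) : Set (R ⧸ L.toAddSubgroup)) \
        A.map (QuotientAddGroup.mk' L.toAddSubgroup) := by
    ext v
    constructor
    · rintro ⟨x, ⟨hx, hx'⟩, rfl⟩
      exact ⟨⟨x, hx, rfl⟩, fun h => hx' ((mk_mem_map_iff hLA x).1 h)⟩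
    · rintro ⟨⟨x, hx, rfl⟩, h2⟩
      exact ⟨x, ⟨hx, fun h => h2 ⟨x, h, rfl⟩⟩, rfl⟩
  rw [h, ← ncard_map_mk, ← ncard_map_mk]
  exact Set.ncard_sdiff_add_ncard_of_subset (Set.image_mono hAB) (Set.toFinite _)

namespace IsPerceptiveSub

variable {G : Subalgebra O R} {φ : R →ₗ[O] O ⧸ Ideal.span {β ^ 2}}
variable (hG : S.IsPerceptiveSub β q G φ) {m h₀ : R} (hm : IsDefining S β G m h₀)
  (hfin : ∀ c, {x | S.n x = c}.Finite)
include hG hm hfin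

omit hfin in
theorem finite_quot : Finite (R ⧸ (annMod m (Ideal.span {β ^ 2})).toAddSubgroup) := by
  have h := hG.index_annMod_sq hm
  have := hG.good.one_lt
  exact Nat.finite_of_card_ne_zero (h.trans_ne (by positivity))

/-- The index of the norm one units of `G` is `q (q + 1)`. -/
theorem repNum_one_eq : S.repNum 1 = q * (q + 1) * unitCount S G 1 := by
  have hq := hG.good.one_lt
  have := hG.finite_quot hm
  set L := annMod m (Ideal.span {β ^ 2}) with hL
  set M := annMod m (Ideal.span {β}) with hM
  have hLM : L.toAddSubgroup ≤ M.toAddSubgroup := annMod_sq_le_annMod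
  have hLG : L.toAddSubgroup ≤ addG G := fun x hx => annMod_sq_le hm hx
  have h1 := sum_unitCount hm hfin (A := ((⊤ : AddSubgroup R) : Set R) \ M.toAddSubgroup)
    (k := unitCount S G 1) (fun u x hu hx => ⟨trivial, fun h => hx.2 (by
      have := Ideal.mul_mem_left M (S.conj u) h
      rwa [← mul_assoc, conj_mul_of_n_eq_one hu, one_mul] at this)⟩)
    (fun x hx => hG.unitCount_of_notMem hm hx.2)
  have h2 := ncard_mk_image_diff hLM (le_top (a := M.toAddSubgroup))
  have h3 := ncard_mk_image_diff (L := L) (A := addG G ⊓ M.toAddSubgroup) (B := addG G)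
    (le_inf hLG hLM) inf_le_left
  have hset : ((⊤ : AddSubgroup R) : Set R) \ M.toAddSubgroup ∩ G =
      (addG G : Set R) \ (addG G ⊓ M.toAddSubgroup : AddSubgroup R) := by
    ext x
    constructor
    · rintro ⟨⟨-, h4⟩, h5⟩
      exact ⟨h5, fun h => h4 h.2⟩
    · rintro ⟨h4, h5⟩
      exact ⟨⟨trivial, fun h => h5 ⟨h4, h⟩⟩, h4⟩
  rw [hset] at h1
  rw [AddSubgroup.relIndex_top_right, hG.index_annMod_sq hm, hG.relIndex_annMod hm] at h2
  rw [hG.relIndex_addG hm, hG.relIndex_inf hm] at h3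
  set a := ((QuotientAddGroup.mk : R → R ⧸ L.toAddSubgroup) ''
    (((⊤ : AddSubgroup R) : Set R) \ M.toAddSubgroup)).ncard
  set b := ((QuotientAddGroup.mk : R → R ⧸ L.toAddSubgroup) ''
    ((addG G : Set R) \ (addG G ⊓ M.toAddSubgroup : AddSubgroup R))).ncard
  have hb : 0 < b := by
    have : q < q ^ 2 := by nlinarith
    omega
  have hab : a = q * (q + 1) * b := by
    have h4 : (a : ℤ) + q ^ 2 = q ^ 4 := by exact_mod_cast h2
    have h5 : (b : ℤ) + q = q ^ 2 := by exact_mod_cast h3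
    have : (a : ℤ) = q * (q + 1) * b := by linear_combination h4 - q * (q + 1) * h5
    exact_mod_cast this
  refine Nat.eq_of_mul_eq_mul_right hb ?_
  rw [← h1, hab]; ring

/-- The analogous relation for the units carrying `β` into `G`: double counting on the classes
annihilating `m` modulo `β` but not modulo `β²`. -/
theorem repNum_one_eq' : S.repNum 1 = (q + 1) * unitCount S G (algebraMap O R β) := by
  have hq := hG.good.one_lt
  have := hG.finite_quot hm
  set L := annMod m (Ideal.span {β ^ 2}) with hL
  set M := annMod m (Ideal.span {β}) with hM
  have hLM : L.toAddSubgroup ≤ M.toAddSubgroup := annMod_sq_le_annMod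
  have hLG : L.toAddSubgroup ≤ addG G := fun x hx => annMod_sq_le hm hx
  have h1 := sum_unitCount hm hfin (A := (M.toAddSubgroup : Set R) \ L.toAddSubgroup)
    (k := unitCount S G (algebraMap O R β)) (fun u x hu hx => ⟨Ideal.mul_mem_left M u hx.1,
      fun h => hx.2 (by
        have := Ideal.mul_mem_left L (S.conj u) h
        rwa [← mul_assoc, conj_mul_of_n_eq_one hu, one_mul] at this)⟩)
    (fun x hx => hG.unitCount_of_mem hm hx.1 hx.2)
  have h2 := ncard_mk_image_diff (le_refl L.toAddSubgroup) hLM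
  have h3 := ncard_mk_image_diff (L := L) (A := L.toAddSubgroup)
    (B := addG G ⊓ M.toAddSubgroup) le_rfl (le_inf hLG hLM)
  have hset : (M.toAddSubgroup : Set R) \ L.toAddSubgroup ∩ G =
      ((addG G ⊓ M.toAddSubgroup : AddSubgroup R) : Set R) \ L.toAddSubgroup := by
    ext x
    constructor
    · rintro ⟨⟨h6, h4⟩, h5⟩
      exact ⟨⟨h5, h6⟩, h4⟩
    · rintro ⟨⟨h4, h6⟩, h5⟩
      exact ⟨⟨h6, h5⟩, h4⟩
  rw [hset] at h1
  rw [AddSubgroup.relIndex_self, hG.relIndex_annMod hm] at h2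
  rw [AddSubgroup.relIndex_self, hG.relIndex_inf hm] at h3
  set a := ((QuotientAddGroup.mk : R → R ⧸ L.toAddSubgroup) ''
    ((M.toAddSubgroup : Set R) \ L.toAddSubgroup)).ncard
  set b := ((QuotientAddGroup.mk : R → R ⧸ L.toAddSubgroup) ''
    (((addG G ⊓ M.toAddSubgroup : AddSubgroup R) : Set R) \ L.toAddSubgroup)).ncard
  have hb : 0 < b := by omega
  have hab : a = (q + 1) * b := by
    have h4 : (a : ℤ) + 1 = q ^ 2 := by exact_mod_cast h2
    have h5 : (b : ℤ) + 1 = q := by exact_mod_cast h3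
    have : (a : ℤ) = (q + 1) * b := by linear_combination h4 - (q + 1) * h5
    exact_mod_cast this
  refine Nat.eq_of_mul_eq_mul_right hb ?_
  rw [← h1, hab]; ring

variable (S G) in
omit hG hm hfin [IsDomain O] in
/-- The number of elements of norm `c` in the suborder `G`. -/
def _root_.QuatOrder.StdInvolution.repSub (c : O) : ℕ := {x | S.n x = c ∧ x ∈ G}.ncard

/-- Double counting of the pairs of an element of norm `α` and a norm one unit carrying it
into `G`. -/
theorem repSub_mul (α : O) : q * (q + 1) * repSub S G α +
    {x | S.n x = α ∧ x ∈ annMod m (Ideal.span {β})}.ncard = S.repNum α +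
      q * {x | S.n x = α ∧ x ∈ annMod m (Ideal.span {β})}.ncard +
      q ^ 2 * {x | S.n x = α ∧ x ∈ annMod m (Ideal.span {β ^ 2})}.ncard := by
  classical
  have hq := hG.good.one_lt
  set L := annMod m (Ideal.span {β ^ 2}) with hL
  set M := annMod m (Ideal.span {β}) with hM
  set k := unitCount S G 1 with hk
  have hh := hG.repNum_one_eq hm hfin
  have hk1 : unitCount S G (algebraMap O R β) = q * k := by
    have h1 := hG.repNum_one_eq' hm hfin
    rw [hh] at h1
    refine Nat.eq_of_mul_eq_mul_left (show 0 < q + 1 by omega) ?_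
    rw [← h1]; ring
  have hkpos : 0 < k := by
    rw [hk, unitCount, Set.ncard_pos ((hfin 1).subset fun x hx => hx.1)]
    exact ⟨1, S.n_one, by rw [mul_one]; exact G.one_mem⟩
  set U := (hfin 1).toFinset with hU
  set X := (hfin α).toFinset with hX
  have key := Finset.sum_card_bipartiteAbove_eq_sum_card_bipartiteBelow (s := U) (t := X)
    (fun u x => u * x ∈ G)
  have h1 : ∀ u ∈ U, (Finset.bipartiteAbove (fun u x => u * x ∈ G) X u).card = repSub S G α := by
    intro u hu
    rw [hU, Set.Finite.mem_toFinset] at hu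
    have hu : S.n u = 1 := hu
    have hinj : Function.Injective (S.conj u * ·) := by
      intro x y h
      have h2 := congrArg (u * ·) h
      simpa only [← mul_assoc, mul_conj_of_n_eq_one hu, one_mul] using h2
    rw [repSub, ← Set.ncard_image_of_injective _ hinj, ← Set.ncard_coe_finset]
    congr 1
    ext x
    simp only [Finset.coe_bipartiteAbove, hX, Set.Finite.mem_toFinset, Set.mem_ofPred_eq]
    constructor
    · rintro ⟨hx, hxG⟩
      refine ⟨u * x, ⟨by rw [S.n_mul, hu, hx, one_mul], hxG⟩, ?_⟩
      simp only [← mul_assoc, conj_mul_of_n_eq_one hu, one_mul]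
    · rintro ⟨y, ⟨hy, hyG⟩, rfl⟩
      refine ⟨by rw [S.n_mul, S.n_conj, hu, hy, one_mul], ?_⟩
      rw [← mul_assoc, mul_conj_of_n_eq_one hu, one_mul]
      exact hyG
  have h2 : ∀ x ∈ X, (Finset.bipartiteBelow (fun u x => u * x ∈ G) U x).card +
      (if x ∈ M then k else 0) =
      k + q * (if x ∈ M then k else 0) + q ^ 2 * (if x ∈ L then k else 0) := by
    intro x hx
    have h3 : (Finset.bipartiteBelow (fun u x => u * x ∈ G) U x).card = unitCount S G x := by
      rw [unitCount, ← Set.ncard_coe_finset]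
      congr 1
      ext u
      simp [Finset.bipartiteBelow, hU]
    rw [h3]
    by_cases hxM : x ∈ M
    · by_cases hxL : x ∈ L
      · rw [unitCount_of_mem_sq hm hxL, hh, if_pos hxM, if_pos hxL, ← hk]; ring
      · rw [hG.unitCount_of_mem hm hxM hxL, hk1, if_pos hxM, if_neg hxL]; ring
    · have hxL : x ∉ L := fun h => hxM (annMod_sq_le_annMod h)
      rw [hG.unitCount_of_notMem hm hxM, if_neg hxM, if_neg hxL, ← hk]
      ring
  have h3 := Finset.sum_congr rfl h2
  have hcount : ∀ J : Ideal R, ∑ x ∈ X, (if x ∈ J then k else 0) =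
      {x | S.n x = α ∧ x ∈ J}.ncard * k := by
    intro J
    rw [← Finset.sum_filter, Finset.sum_const, smul_eq_mul, ← Set.ncard_coe_finset]
    congr 2
    ext x
    simp [hX]
  rw [Finset.sum_add_distrib, Finset.sum_add_distrib, Finset.sum_add_distrib, ← key,
    Finset.sum_congr rfl h1, Finset.sum_const, Finset.sum_const, ← Finset.mul_sum,
    ← Finset.mul_sum, hcount, hcount, smul_eq_mul, smul_eq_mul] at h3
  have hUc : U.card = S.repNum 1 := by
    rw [hU, ← Set.ncard_eq_toFinset_card _ (hfin _), repNum]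
  have hXc : X.card = S.repNum α := by
    rw [hX, ← Set.ncard_eq_toFinset_card _ (hfin _), repNum]
  rw [hUc, hXc, hh, ← hk] at h3
  refine Nat.eq_of_mul_eq_mul_right hkpos ?_
  linarith

omit hm in
/-- The number of elements of norm `β ^ e γ` in `G`, in terms of the number of elements of norm
`γ` in the big order. -/
theorem repSub_eq {γ : O} (hγ : ¬ β ∣ γ) {s : ℕ} (hs : S.repNum γ = S.repNum 1 * s) (e : ℕ) :
    (repSub S G (β ^ e * γ) : ℤ) = unitCount S G 1 * s * localFactor q e := by
  classical
  obtain ⟨m, h₀, hm⟩ := hG.exists_isDefining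
  have hq := hG.good.one_lt
  have hβ := hG.good.prime.ne_zero
  have hex : S.excess β q = q := if_neg hG.not_dvdDisc
  have hrep : ∀ e, S.repNum (β ^ e * γ) = (∑ i ∈ Finset.range (e + 1), q ^ i) * S.repNum γ :=
    fun e => by rw [hG.good.repNum_pow_mul hfin hγ, hex]
  obtain ⟨y₁, hy₁, hM⟩ := hG.annMod_mem_normIdeals hm
  obtain ⟨y₂, hy₂, hL⟩ := hG.exists_annMod_sq_eq hm
  have hM1 : ∀ δ, {x | S.n x = β * δ ∧ x ∈ annMod m (Ideal.span {β})}.ncard = S.repNum δ :=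
    fun δ => by rw [hM]; exact ncard_norm_eq_mem_span hy₁ hβ
  have hL1 : ∀ δ, {x | S.n x = β ^ 2 * δ ∧ x ∈ annMod m (Ideal.span {β ^ 2})}.ncard =
      S.repNum δ := fun δ => by rw [hL]; exact ncard_norm_eq_mem_span hy₂ (pow_ne_zero 2 hβ)
  have hL0 : ∀ α, ¬ β ^ 2 ∣ α →
      {x | S.n x = α ∧ x ∈ annMod m (Ideal.span {β ^ 2})}.ncard = 0 := by
    intro α hα
    rw [hL]
    convert Set.ncard_empty R
    rw [Set.eq_empty_iff_forall_notMem]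
    rintro x ⟨hx, hx'⟩
    obtain ⟨z, rfl⟩ := Ideal.mem_span_singleton'.1 hx'
    exact hα (by rw [← hx, S.n_mul, hy₂]; exact dvd_mul_left _ _)
  have hM0 : ∀ α, ¬ β ∣ α →
      {x | S.n x = α ∧ x ∈ annMod m (Ideal.span {β})}.ncard = 0 := by
    intro α hα
    rw [hM]
    convert Set.ncard_empty R
    rw [Set.eq_empty_iff_forall_notMem]
    rintro x ⟨hx, hx'⟩
    obtain ⟨z, rfl⟩ := Ideal.mem_span_singleton'.1 hx'
    exact hα (by rw [← hx, S.n_mul, hy₁]; exact dvd_mul_left _ _)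
  have hmain := hG.repSub_mul hm hfin (β ^ e * γ)
  rw [hrep] at hmain
  have hh := hG.repNum_one_eq hm hfin
  rw [hh] at hs
  have hq0 : (q : ℤ) * (q + 1) ≠ 0 := by positivity
  set k := unitCount S G 1
  apply mul_left_cancel₀ hq0
  match e with
  | 0 =>
    have h2 : ¬ β ^ 2 ∣ γ := fun h => hγ ((dvd_pow_self β two_ne_zero).trans h)
    rw [pow_zero, one_mul] at hmain ⊢
    rw [hM0 _ hγ, hL0 _ h2, hs] at hmain
    zify at hmain
    rw [localFactor, if_pos rfl]
    simp only [zero_add, Finset.sum_range_one, pow_zero, mul_zero, add_zero, one_mul] at hmain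
    linear_combination hmain
  | 1 =>
    have h2 : ¬ β ^ 2 ∣ β ^ 1 * γ := fun h => hγ (by
      rw [pow_one, sq] at h; exact (mul_dvd_mul_iff_left hβ).1 h)
    rw [hL0 _ h2] at hmain
    rw [pow_one] at hmain ⊢
    rw [hM1, hs] at hmain
    zify at hmain
    rw [localFactor, if_neg one_ne_zero, if_pos rfl]
    simp only [Finset.sum_range_succ, Finset.sum_range_zero, zero_add, pow_zero, pow_one, mul_zero,
      add_zero] at hmain
    linear_combination hmain
  | e + 2 =>
    have h1 : {x | S.n x = β ^ (e + 2) * γ ∧ x ∈ annMod m (Ideal.span {β})}.ncard =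
        (∑ i ∈ Finset.range (e + 2), q ^ i) * S.repNum γ := by
      rw [← hrep (e + 1), ← hM1, ← mul_assoc, ← pow_succ']
    have h2 : {x | S.n x = β ^ (e + 2) * γ ∧ x ∈ annMod m (Ideal.span {β ^ 2})}.ncard =
        (∑ i ∈ Finset.range (e + 1), q ^ i) * S.repNum γ := by
      rw [← hrep e, ← hL1, ← mul_assoc, ← pow_add, add_comm 2 e]
    rw [h1, h2, hs] at hmain
    zify at hmain
    have h3 : ∑ i ∈ Finset.Icc 1 (e + 2), (q : ℤ) ^ i =
        ∑ i ∈ Finset.range (e + 3), (q : ℤ) ^ i - 1 := by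
      rw [Finset.sum_range_succ' _ (e + 2), pow_zero, add_sub_cancel_right, Finset.range_eq_Ico,
        Finset.sum_Ico_add' (fun i => (q : ℤ) ^ i) 0 (e + 2) 1]
      rfl
    have h4 : (q : ℤ) * ∑ i ∈ Finset.range (e + 1), (q : ℤ) ^ i =
        ∑ i ∈ Finset.range (e + 2), (q : ℤ) ^ i - 1 := by
      rw [Finset.sum_range_succ' _ (e + 1), pow_zero, add_sub_cancel_right, Finset.mul_sum]
      simp only [pow_succ']
    have h5 : ∑ i ∈ Finset.range (e + 2 + 1), (q : ℤ) ^ i =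
        ∑ i ∈ Finset.range (e + 2), (q : ℤ) ^ i + (q : ℤ) ^ (e + 2) :=
      Finset.sum_range_succ _ _
    have h6 : (q : ℤ) * ∑ i ∈ Finset.range (e + 2), (q : ℤ) ^ i =
        ∑ i ∈ Finset.range (e + 3), (q : ℤ) ^ i - 1 := by
      rw [Finset.sum_range_succ' _ (e + 2), pow_zero, add_sub_cancel_right, Finset.mul_sum]
      simp only [pow_succ']
    simp only [localFactor, Nat.add_eq_zero_iff, OfNat.ofNat_ne_zero, and_false, if_false,
      show e + 2 ≠ 1 by omega, h3]
    have h7 : ∑ i ∈ Finset.range (e + 3), (q : ℤ) ^ i =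
      ∑ i ∈ Finset.range (e + 2 + 1), (q : ℤ) ^ i := rfl
    rw [h7] at h6 ⊢
    generalize ∑ i ∈ Finset.range (e + 2 + 1), (q : ℤ) ^ i = s3 at *
    generalize ∑ i ∈ Finset.range (e + 2), (q : ℤ) ^ i = s2 at *
    generalize ∑ i ∈ Finset.range (e + 1), (q : ℤ) ^ i = s1 at *
    set T : ℤ := (q : ℤ) * (q + 1) * k * s with hT
    linear_combination hmain + T * q * h4 + T * 2 * h6 + T * h5

end IsPerceptiveSub
end StdInvolution

/-! ### Orders in definite quaternion algebras -/

section OrderBasics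

variable {K : Type*} [Field K] {a b : K}

theorem algebraMap_int_eq (c : 𝓞 K) :
    algebraMap (𝓞 K) (Quat K a b) c = algebraMap K (Quat K a b) (c : K) := rfl

theorem isIntegral_star {x : Quat K a b} (hx : IsIntegral (𝓞 K) x) : IsIntegral (𝓞 K) (star x) := by
  obtain ⟨P, hP, h⟩ := hx
  refine ⟨P, hP, ?_⟩
  rw [Polynomial.eval₂_eq_sum_range] at h ⊢
  have h1 := congrArg star h
  rw [star_sum, star_zero] at h1
  rw [← h1]
  refine Finset.sum_congr rfl fun i _ => ?_
  rw [star_mul, star_pow, algebraMap_int_eq, star_algebraMap, Algebra.commutes]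

theorem isIntegral_trd_and_nrd {x : Quat K a b} (hx : IsIntegral (𝓞 K) x) :
    IsIntegral (𝓞 K) (trd x) ∧ IsIntegral (𝓞 K) (nrd x) := by
  have hcomm : IsMulCommutative (Algebra.adjoin (𝓞 K) {x, star x}) := by
    apply Algebra.isMulCommutative_adjoin
    have h : x * star x = star x * x := by rw [mul_star_eq_nrd, star_mul_eq_nrd]
    rintro u (rfl | rfl) v (rfl | rfl)
    · rfl
    · exact h
    · exact h.symm
    · rfl
  set A := Algebra.adjoin (𝓞 K) {x, star x}
  let _ : CommRing A := { (inferInstance : Ring A) with mul_comm := hcomm.is_comm.comm }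
  have hinj : Function.Injective A.val := Subtype.val_injective
  let y : A := ⟨x, Algebra.subset_adjoin (Or.inl rfl)⟩
  let z : A := ⟨star x, Algebra.subset_adjoin (Or.inr rfl)⟩
  have hy : IsIntegral (𝓞 K) y := (isIntegral_algHom_iff A.val hinj).1 hx
  have hz : IsIntegral (𝓞 K) z := (isIntegral_algHom_iff A.val hinj).1 (isIntegral_star hx)
  have h1 : IsIntegral (𝓞 K) (x + star x) :=
    (isIntegral_algHom_iff A.val hinj (x := y + z)).2 (hy.add hz)
  have h2 : IsIntegral (𝓞 K) (x * star x) :=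
    (isIntegral_algHom_iff A.val hinj (x := y * z)).2 (hy.mul hz)
  rw [add_star_eq_trd] at h1
  rw [mul_star_eq_nrd] at h2
  exact ⟨(isIntegral_algebraMap_iff algebraMap_injective).1 h1,
    (isIntegral_algebraMap_iff algebraMap_injective).1 h2⟩

variable {H : Subalgebra (𝓞 K) (Quat K a b)}

theorem IsOrder.isIntegral (hH : IsOrder H) {x : Quat K a b} (hx : x ∈ H) :
    IsIntegral (𝓞 K) x := IsIntegral.of_mem_of_fg H hH.fg x hx

theorem exists_int_of_isIntegral {c : K} (hc : IsIntegral (𝓞 K) c) : ∃ d : 𝓞 K, (d : K) = c :=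
  ⟨⟨c, isIntegral_trans (R := ℤ) (A := 𝓞 K) c hc⟩, rfl⟩

theorem IsOrder.exists_trd (hH : IsOrder H) {x : Quat K a b} (hx : x ∈ H) :
    ∃ d : 𝓞 K, (d : K) = trd x :=
  exists_int_of_isIntegral (isIntegral_trd_and_nrd (hH.isIntegral hx)).1

theorem IsOrder.exists_nrd (hH : IsOrder H) {x : Quat K a b} (hx : x ∈ H) :
    ∃ d : 𝓞 K, (d : K) = nrd x :=
  exists_int_of_isIntegral (isIntegral_trd_and_nrd (hH.isIntegral hx)).2

theorem IsOrder.star_mem (hH : IsOrder H) {x : Quat K a b} (hx : x ∈ H) : star x ∈ H := by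
  obtain ⟨d, hd⟩ := hH.exists_trd hx
  rw [star_eq, ← hd, ← algebraMap_int_eq]
  exact H.sub_mem (H.algebraMap_mem d) hx

theorem IsOrder.exists_of_algebraMap_mem (hH : IsOrder H) {c : K}
    (hc : algebraMap K (Quat K a b) c ∈ H) : ∃ d : 𝓞 K, (d : K) = c :=
  exists_int_of_isIntegral ((isIntegral_algebraMap_iff algebraMap_injective).1 (hH.isIntegral hc))

variable [NumberField K] [NumberField.IsTotallyReal K]

theorem nonempty_realEmbedding : Nonempty (K →+* ℝ) := by
  obtain ⟨v⟩ := (inferInstance : Nonempty (NumberField.InfinitePlace K))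
  exact ⟨v.embedding_of_isReal (NumberField.IsTotallyReal.isReal v)⟩

theorem IsTotallyPositive.ne_zero {c : K} (hc : IsTotallyPositive c) : c ≠ 0 := by
  obtain ⟨σ⟩ := nonempty_realEmbedding (K := K)
  rintro rfl
  exact absurd (hc σ) (by simp)

theorem eq_zero_of_nrd (hdef : IsDefinite K a b) {x : Quat K a b} (hx : nrd x = 0) : x = 0 := by
  by_contra h
  exact (hdef x h).ne_zero hx

/-- The anti-involution structure on an order of a definite quaternion algebra. -/
def IsOrder.std (hH : IsOrder H) (hdef : IsDefinite K a b) : StdInvolution (𝓞 K) H where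
  conj x := ⟨star x.1, hH.star_mem x.2⟩
  tr x := (hH.exists_trd x.2).choose
  n x := (hH.exists_nrd x.2).choose
  conj_add x y := Subtype.ext (star_add _ _)
  conj_mul x y := Subtype.ext (star_mul _ _)
  conj_algebraMap c := Subtype.ext (star_algebraMap _)
  add_conj x := Subtype.ext (by
    change x.1 + star x.1 = algebraMap K _ ((hH.exists_trd x.2).choose : K)
    rw [(hH.exists_trd x.2).choose_spec, add_star_eq_trd])
  mul_conj x := Subtype.ext (by
    change x.1 * star x.1 = algebraMap K _ ((hH.exists_nrd x.2).choose : K)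
    rw [(hH.exists_nrd x.2).choose_spec, mul_star_eq_nrd])
  inj x y h := by
    have h1 : algebraMap K (Quat K a b) (x : K) = algebraMap K (Quat K a b) (y : K) :=
      congrArg Subtype.val h
    exact NumberField.RingOfIntegers.ext (algebraMap_injective h1)
  eq_zero_of_n x h := Subtype.ext (eq_zero_of_nrd hdef (by
    rw [← (hH.exists_nrd x.2).choose_spec, h]; rfl))

variable (hH : IsOrder H) (hdef : IsDefinite K a b)

theorem IsOrder.coe_tr (x : H) : ((hH.std hdef).tr x : K) = trd x.1 :=
  (hH.exists_trd x.2).choose_spec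

theorem IsOrder.coe_n (x : H) : ((hH.std hdef).n x : K) = nrd x.1 :=
  (hH.exists_nrd x.2).choose_spec

theorem IsOrder.n_eq_iff (x : H) (c : 𝓞 K) : (hH.std hdef).n x = c ↔ nrd x.1 = c := by
  rw [← hH.coe_n hdef]
  exact ⟨fun h => by rw [h], fun h => NumberField.RingOfIntegers.ext h⟩

theorem IsOrder.hasCramer : (hH.std hdef).HasCramer := by
  intro x y w z
  obtain ⟨c, hc⟩ := exists_discForm_smul_eq x.1 y.1 w.1 z.1
  have hcoe : ∀ u : H, algebraMap K (Quat K a b) (trd u.1) =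
      (algebraMap (𝓞 K) H ((hH.std hdef).tr u)).1 := fun u => by
    rw [← hH.coe_tr hdef]; rfl
  have h1 := hcoe ((x * y - y * x) * (hH.std hdef).conj w)
  have h2 := hcoe (z * (y * (hH.std hdef).conj w - (hH.std hdef).conj w * y))
  have h3 := hcoe (z * ((hH.std hdef).conj w * x - x * (hH.std hdef).conj w))
  have h4 := hcoe (z * (y * x - x * y))
  rw [Algebra.smul_def, Algebra.smul_def, Algebra.smul_def, Algebra.smul_def] at hc
  have hc' :
      (algebraMap (𝓞 K) H ((hH.std hdef).tr ((x * y - y * x) * (hH.std hdef).conj w))).1 * z.1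
      = (algebraMap (𝓞 K) H ((hH.std hdef).tr
          (z * (y * (hH.std hdef).conj w - (hH.std hdef).conj w * y)))).1 * x.1 +
        (algebraMap (𝓞 K) H ((hH.std hdef).tr
          (z * ((hH.std hdef).conj w * x - x * (hH.std hdef).conj w)))).1 * y.1 +
        (algebraMap (𝓞 K) H ((hH.std hdef).tr (z * (y * x - x * y)))).1 * w.1 +
        algebraMap K _ c := by
    rw [← h1, ← h2, ← h3, ← h4]
    exact hc
  have hmem : algebraMap K (Quat K a b) c ∈ H := by
    rw [← sub_eq_iff_eq_add'] at hc'
    rw [← hc']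
    exact H.sub_mem (H.mul_mem (Subtype.prop _) z.2) (H.add_mem (H.add_mem
      (H.mul_mem (Subtype.prop _) x.2) (H.mul_mem (Subtype.prop _) y.2))
      (H.mul_mem (Subtype.prop _) w.2))
  obtain ⟨d, rfl⟩ := hH.exists_of_algebraMap_mem hmem
  exact ⟨d, Subtype.ext hc'⟩

end OrderBasics

section Finiteness

variable {K : Type*} [Field K] [NumberField K] [NumberField.IsTotallyReal K] {a b : K}

theorem finite_isIntegral_sq_le (B : K) :
    {y : K | IsIntegral ℤ y ∧ ∀ σ : K →+* ℝ, σ y ^ 2 ≤ σ B}.Finite := by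
  obtain ⟨M, hM⟩ := (Set.finite_range fun φ : K →+* ℂ => ‖φ B‖).bddAbove
  refine (NumberField.Embeddings.finite_of_norm_le K ℂ (M + 1)).subset ?_
  rintro y ⟨hy, hσ⟩
  refine ⟨hy, fun φ => ?_⟩
  have hφ : NumberField.ComplexEmbedding.IsReal φ :=
    NumberField.IsTotallyReal.complexEmbedding_isReal φ
  have h1 := hσ hφ.embedding
  have h2 : ∀ z : K, ‖φ z‖ = |hφ.embedding z| := fun z => by
    rw [← NumberField.ComplexEmbedding.IsReal.coe_embedding_apply hφ z, Complex.norm_real,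
      Real.norm_eq_abs]
  have h3 : ‖φ B‖ ≤ M := hM ⟨φ, rfl⟩
  rw [h2] at h3 ⊢
  have h4 := (le_abs_self _).trans h3
  rw [← sq_abs] at h1
  have h5 : 0 ≤ |hφ.embedding y| := abs_nonneg _
  nlinarith [sq_nonneg (|hφ.embedding y| - 1)]

omit [NumberField K] [NumberField.IsTotallyReal K] in
theorem Quat.ext_coords {x y : Quat K a b} (h0 : QuaternionAlgebra.re x = QuaternionAlgebra.re y)
    (h1 : QuaternionAlgebra.imI x = QuaternionAlgebra.imI y)
    (h2 : QuaternionAlgebra.imJ x = QuaternionAlgebra.imJ y)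
    (h3 : QuaternionAlgebra.imK x = QuaternionAlgebra.imK y) : x = y :=
  QuaternionAlgebra.ext h0 h1 h2 h3

theorem finite_image_coord {H : Subalgebra (𝓞 K) (Quat K a b)} (hH : IsOrder H) (c : K)
    (ℓ : Quat K a b →ₗ[K] K) {v : K} (hv : IsTotallyPositive v)
    (hℓ : ∀ (x : Quat K a b) (σ : K →+* ℝ), σ (v * ℓ x ^ 2) ≤ σ (nrd x)) :
    (ℓ '' {x | x ∈ H ∧ nrd x = c}).Finite := by
  have hfg : ((Subalgebra.toSubmodule H).map (ℓ.restrictScalars (𝓞 K))).FG := hH.fg.map _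
  obtain ⟨d, hd, hint⟩ := FractionalIdeal.isFractional_of_fg (S := nonZeroDivisors (𝓞 K)) hfg
  have hd0 : (d : K) ≠ 0 := by
    simpa using nonZeroDivisors.ne_zero hd
  refine Set.Finite.of_finite_image (f := fun y => (d : K) * y) ?_
    (fun x _ y _ h => mul_left_cancel₀ hd0 h)
  refine (finite_isIntegral_sq_le ((d : K) ^ 2 * (v⁻¹ * c))).subset ?_
  rintro _ ⟨_, ⟨x, ⟨hx, hxc⟩, rfl⟩, rfl⟩
  refine ⟨?_, fun σ => ?_⟩
  · obtain ⟨e, he⟩ := hint (ℓ x) ⟨x, hx, rfl⟩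
    have h1 : (e : K) = d * ℓ x := by
      rw [Algebra.smul_def] at he
      exact he
    change IsIntegral ℤ ((d : K) * ℓ x)
    rw [← h1]
    exact e.isIntegral_coe
  · have h1 := hℓ x σ
    have h2 := hv σ
    rw [hxc] at h1
    simp only [map_mul, map_pow, map_inv₀] at h1 ⊢
    rw [mul_pow]
    refine mul_le_mul_of_nonneg_left ?_ (sq_nonneg _)
    rw [inv_mul_eq_div, le_div_iff₀ h2]
    linarith

/-- A definite order has finitely many elements of given reduced norm: their coordinates have
bounded denominators and bounded conjugates. -/
theorem finite_nrd_eq {H : Subalgebra (𝓞 K) (Quat K a b)} (hH : IsOrder H)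
    (hdef : IsDefinite K a b) (c : K) : {x | x ∈ H ∧ nrd x = c}.Finite := by
  have hnz : ∀ {q : ℍ[K,a,b]}, q ≠ 0 → IsTotallyPositive (nrd (show Quat K a b from q)) :=
    fun hq => hdef _ hq
  have ha : IsTotallyPositive (-a) := by
    have := hnz (q := ⟨0, 1, 0, 0⟩) (fun h => one_ne_zero (congrArg QuaternionAlgebra.imI h))
    rwa [show nrd (show Quat K a b from (⟨0, 1, 0, 0⟩ : ℍ[K,a,b])) = -a by
      rw [nrd_mk]; ring] at this
  have hb : IsTotallyPositive (-b) := by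
    have := hnz (q := ⟨0, 0, 1, 0⟩) (fun h => one_ne_zero (congrArg QuaternionAlgebra.imJ h))
    rwa [show nrd (show Quat K a b from (⟨0, 0, 1, 0⟩ : ℍ[K,a,b])) = -b by
      rw [nrd_mk]; ring] at this
  have hab : IsTotallyPositive (a * b) := fun σ => by
    have h1 := ha σ
    have h2 := hb σ
    rw [map_neg] at h1 h2
    rw [map_mul]
    nlinarith
  have key : ∀ (x : Quat K a b) (σ : K →+* ℝ), 0 ≤ σ (-a * QuaternionAlgebra.imI x ^ 2) ∧
      0 ≤ σ (-b * QuaternionAlgebra.imJ x ^ 2) ∧ 0 ≤ σ (a * b * QuaternionAlgebra.imK x ^ 2) ∧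
      0 ≤ σ (QuaternionAlgebra.re x ^ 2) ∧
      σ (nrd x) = σ (QuaternionAlgebra.re x ^ 2) + σ (-a * QuaternionAlgebra.imI x ^ 2) +
        σ (-b * QuaternionAlgebra.imJ x ^ 2) + σ (a * b * QuaternionAlgebra.imK x ^ 2) := by
    intro x σ
    refine ⟨?_, ?_, ?_, ?_, ?_⟩
    · rw [map_mul, map_pow]; exact mul_nonneg (ha σ).le (sq_nonneg _)
    · rw [map_mul, map_pow]; exact mul_nonneg (hb σ).le (sq_nonneg _)
    · rw [map_mul _ (a * b), map_pow]; exact mul_nonneg (hab σ).le (sq_nonneg _)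
    · rw [map_pow]; exact sq_nonneg _
    · rw [← map_add, ← map_add, ← map_add, nrd_eq]
      congr 1; ring
  have h0 := finite_image_coord hH c (v := 1)
    { toFun := fun x => QuaternionAlgebra.re x
      map_add' := fun _ _ => rfl
      map_smul' := fun _ _ => rfl } (fun σ => by simp) (fun x σ => by
      obtain ⟨h1, h2, h3, h4, h5⟩ := key x σ
      rw [one_mul]
      change σ (QuaternionAlgebra.re x ^ 2) ≤ _
      linarith)
  have h1 := finite_image_coord hH c (v := -a)
    { toFun := fun x => QuaternionAlgebra.imI x
      map_add' := fun _ _ => rfl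
      map_smul' := fun _ _ => rfl } ha (fun x σ => by
      obtain ⟨h1, h2, h3, h4, h5⟩ := key x σ
      change σ (-a * QuaternionAlgebra.imI x ^ 2) ≤ _
      linarith)
  have h2 := finite_image_coord hH c (v := -b)
    { toFun := fun x => QuaternionAlgebra.imJ x
      map_add' := fun _ _ => rfl
      map_smul' := fun _ _ => rfl } hb (fun x σ => by
      obtain ⟨h1, h2, h3, h4, h5⟩ := key x σ
      change σ (-b * QuaternionAlgebra.imJ x ^ 2) ≤ _
      linarith)
  have h3 := finite_image_coord hH c (v := a * b)
    { toFun := fun x => QuaternionAlgebra.imK x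
      map_add' := fun _ _ => rfl
      map_smul' := fun _ _ => rfl } hab (fun x σ => by
      obtain ⟨h1, h2, h3, h4, h5⟩ := key x σ
      change σ (a * b * QuaternionAlgebra.imK x ^ 2) ≤ _
      linarith)
  refine Set.Finite.of_finite_image (f := fun x : Quat K a b => ((QuaternionAlgebra.re x : K),
    (QuaternionAlgebra.imI x : K), (QuaternionAlgebra.imJ x : K), (QuaternionAlgebra.imK x : K)))
    ((h0.prod (h1.prod (h2.prod h3))).subset ?_) ?_
  · rintro _ ⟨x, hx, rfl⟩
    exact ⟨⟨x, hx, rfl⟩, ⟨x, hx, rfl⟩, ⟨x, hx, rfl⟩, ⟨x, hx, rfl⟩⟩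
  · intro x _ y _ h
    simp only [Prod.mk.injEq] at h
    exact Quat.ext_coords h.1 h.2.1 h.2.2.1 h.2.2.2

end Finiteness

/-! ### Indices of scalar and principal left ideals -/

namespace StdInvolution

variable {O R : Type*} [CommRing O] [IsDomain O] [Ring R] [Algebra O R] {S : StdInvolution O R}

theorem index_span_mul (y : R) {z : R} (hz : S.n z ≠ 0) :
    (Ideal.span {y * z}).toAddSubgroup.index =
      (Ideal.span {y}).toAddSubgroup.index * (Ideal.span {z}).toAddSubgroup.index := by
  have hinj : Function.Injective (AddMonoidHom.mulRight z) := mul_right_injective hz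
  have hmap : ∀ x : R, (Ideal.span {x}).toAddSubgroup.map (AddMonoidHom.mulRight z) =
      (Ideal.span {x * z}).toAddSubgroup := by
    intro x
    ext u
    constructor
    · rintro ⟨v, hv, rfl⟩
      obtain ⟨c, rfl⟩ := Ideal.mem_span_singleton'.1 hv
      exact Ideal.mem_span_singleton'.2 ⟨c, (mul_assoc _ _ _).symm⟩
    · intro hu
      obtain ⟨c, rfl⟩ := Ideal.mem_span_singleton'.1 hu
      exact ⟨c * x, Ideal.mul_mem_left _ _ (Ideal.mem_span_singleton_self _), mul_assoc _ _ _⟩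
  have hle : (Ideal.span {y * z}).toAddSubgroup ≤ (Ideal.span {z}).toAddSubgroup := by
    intro u hu
    obtain ⟨c, rfl⟩ := Ideal.mem_span_singleton'.1 hu
    rw [← mul_assoc]
    exact Ideal.mul_mem_left _ _ (Ideal.mem_span_singleton_self _)
  have h1 := AddSubgroup.relIndex_mul_index hle
  have h2 := AddSubgroup.relIndex_map_map_of_injective (Ideal.span {y}).toAddSubgroup
    (Ideal.span {(1 : R)}).toAddSubgroup hinj
  rw [hmap, hmap, one_mul] at h2
  rw [← h1, h2, Ideal.span_singleton_one]
  congr 1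
  exact AddSubgroup.relIndex_top_right _

/-- The index of a principal left ideal is the square of the index of its norm, if every element
is conjugate to its image under the involution and scalars have the expected index. -/
theorem index_span_eq_sq (N : O → ℕ)
    (hconj : ∀ y, ∃ w, S.n w ≠ 0 ∧ S.conj y * w = w * y)
    (hN : ∀ c, c ≠ 0 → (Ideal.span {algebraMap O R c}).toAddSubgroup.index = N c ^ 4)
    (hN0 : ∀ c, c ≠ 0 → N c ≠ 0) {y : R} (hy : S.n y ≠ 0) :
    (Ideal.span {y}).toAddSubgroup.index = N (S.n y) ^ 2 := by
  have hpos : ∀ w : R, S.n w ≠ 0 → (Ideal.span {w}).toAddSubgroup.index ≠ 0 := by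
    intro w hw h0
    have h1 := index_span_mul (S.conj w) hw
    rw [S.conj_mul_self, hN _ hw, h0, mul_zero] at h1
    exact pow_ne_zero 4 (hN0 _ hw) h1
  obtain ⟨w, hw, hwy⟩ := hconj y
  have h1 := index_span_mul (S.conj y) hw
  rw [hwy, index_span_mul w hy, mul_comm] at h1
  have h2 := Nat.eq_of_mul_eq_mul_right (Nat.pos_of_ne_zero (hpos w hw)) h1
  have h3 := index_span_mul (S.conj y) hy
  rw [S.conj_mul_self, hN _ hy, ← h2] at h3
  have h4 : (N (S.n y) ^ 2) ^ 2 = (Ideal.span {y}).toAddSubgroup.index ^ 2 := by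
    rw [← pow_mul, h3, sq]
  exact (Nat.pow_left_injective two_ne_zero h4).symm

end StdInvolution

section

variable {K : Type*} [Field K] [NumberField K] {a b : K}

theorem IsLattice.exists_smul_mem {L : Submodule (𝓞 K) (Quat K a b)} (hL : IsLattice L)
    (x : Quat K a b) : ∃ d : 𝓞 K, d ≠ 0 ∧ d • x ∈ L := by
  have hx : x ∈ Submodule.span K (L : Set (Quat K a b)) := hL.span_eq_top ▸ Submodule.mem_top
  induction hx using Submodule.span_induction with
  | mem x hx => exact ⟨1, one_ne_zero, by rwa [one_smul]⟩
  | zero => exact ⟨1, one_ne_zero, by rw [smul_zero]; exact L.zero_mem⟩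
  | add x y _ _ hx hy =>
    obtain ⟨d, hd, hdx⟩ := hx
    obtain ⟨e, he, hey⟩ := hy
    refine ⟨d * e, mul_ne_zero hd he, ?_⟩
    rw [smul_add, mul_smul, mul_smul, smul_comm d e x]
    exact L.add_mem (L.smul_mem _ hdx) (L.smul_mem _ hey)
  | smul k x _ hx =>
    obtain ⟨d, hd, hdx⟩ := hx
    obtain ⟨n, m, hm, rfl⟩ := IsFractionRing.div_surjective (A := 𝓞 K) k
    have hm0 := nonZeroDivisors.ne_zero hm
    refine ⟨m * d, mul_ne_zero hm0 hd, ?_⟩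
    have : (m * d) • (algebraMap (𝓞 K) K n / algebraMap (𝓞 K) K m) • x = n • d • x := by
      rw [← smul_assoc, ← mul_smul, Algebra.smul_def (m * d), ← algebraMap_smul K (n * d) x]
      congr 1
      have : algebraMap (𝓞 K) K m ≠ 0 := by simpa using hm0
      simp only [map_mul]
      field_simp
    rw [this]
    exact L.smul_mem _ hdx

/-- Multiplication by a nonzero scalar `c` has index `N(c) ^ 4` on an order, by comparison with a
free suborder of finite index. -/
theorem IsOrder.index_span_algebraMap {H : Subalgebra (𝓞 K) (Quat K a b)} (hH : IsOrder H)
    {c : 𝓞 K} (hc : c ≠ 0) : (Ideal.span {algebraMap (𝓞 K) H c}).toAddSubgroup.index =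
      Ideal.absNorm (Ideal.span {c}) ^ 4 := by
  have hfinK : Module.Finite K (Quat K a b) :=
    Module.finite_of_finrank_pos (by rw [finrank_quat]; norm_num)
  let bas := Module.finBasisOfFinrankEq K (Quat K a b) finrank_quat
  choose d hd hdH using fun i => hH.exists_smul_mem (bas i)
  let v : Fin 4 → H := fun i => ⟨d i • bas i, hdH i⟩
  let B : (Fin 4 → 𝓞 K) →ₗ[𝓞 K] H := Fintype.linearCombination (𝓞 K) v
  have hB : ∀ f, (B f : Quat K a b) = ∑ i, ((f i : K) * d i) • bas i := by
    intro f
    rw [Fintype.linearCombination_apply, AddSubmonoidClass.coe_finsetSum]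
    refine Finset.sum_congr rfl fun i _ => ?_
    change f i • d i • bas i = _
    rw [← mul_smul, ← algebraMap_smul K (f i * d i), map_mul]
  have hBinj : Function.Injective B := by
    rw [← LinearMap.ker_eq_bot, LinearMap.ker_eq_bot']
    intro f hf
    have h1 := hB f
    rw [hf] at h1
    have h2 := Fintype.linearIndependent_iff.1 bas.linearIndependent _ h1.symm
    ext i
    have h3 := h2 i
    have h4 : (d i : K) ≠ 0 := by simpa using hd i
    simpa [h4] using h3
  set F : AddSubgroup H := B.toAddMonoidHom.range with hF
  -- The quotient by the free part is torsion and finitely generated, hence finite.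
  have hFfin : F.index ≠ 0 := by
    have hMF : Module.Finite (𝓞 K) H := .of_fg hH.fg
    have hMZ : Module.Finite ℤ H := Module.Finite.trans (𝓞 K) H
    have hQZ : Module.Finite ℤ (H ⧸ F) :=
      Module.Finite.of_surjective (QuotientAddGroup.mk' F).toIntLinearMap
        (QuotientAddGroup.mk'_surjective F)
    have htors : Module.IsTorsion ℤ (H ⧸ F) := by
      rintro ⟨x⟩
      have h1 : ∃ s : 𝓞 K, s ≠ 0 ∧ s • x ∈ F := by
        obtain ⟨⟨s, hs⟩, hs'⟩ := IsLocalization.exist_integer_multiples_of_finite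
          (nonZeroDivisors (𝓞 K)) (fun i => bas.repr x i / d i)
        refine ⟨s, nonZeroDivisors.ne_zero hs, ?_⟩
        choose f hf using hs'
        refine ⟨f, Subtype.ext ?_⟩
        change (B f : Quat K a b) = s • x.1
        rw [hB, ← bas.sum_repr x.1, Finset.smul_sum]
        refine Finset.sum_congr rfl fun i _ => ?_
        have h4 : (d i : K) ≠ 0 := by simpa using hd i
        have h5 : (f i : K) = s * (bas.repr x i / d i) := by
          have h6 := hf i
          rw [Algebra.smul_def] at h6
          exact h6
        rw [h5, ← algebraMap_smul K s, ← mul_smul]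
        congr 1
        field_simp
      obtain ⟨s, hs, hsx⟩ := h1
      have h2 : (Ideal.absNorm (Ideal.span {s}) : 𝓞 K) ∈ Ideal.span {s} := Ideal.absNorm_mem _
      obtain ⟨t, ht⟩ := Ideal.mem_span_singleton'.1 h2
      have h3 : (Ideal.absNorm (Ideal.span {s}) : ℤ) ≠ 0 := by
        simpa [Ideal.absNorm_eq_zero_iff] using hs
      refine ⟨⟨_, mem_nonZeroDivisors_of_ne_zero h3⟩, ?_⟩
      refine (QuotientAddGroup.eq_zero_iff (N := F)
        ((Ideal.absNorm (Ideal.span {s}) : ℤ) • x)).2 ?_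
      have h4 : (Ideal.absNorm (Ideal.span {s}) : ℤ) • x = t • s • x := by
        rw [← mul_smul, ht, natCast_zsmul, Nat.cast_smul_eq_nsmul]
      rw [h4]
      obtain ⟨f, hf⟩ := hsx
      exact ⟨t • f, by rw [← hf]; exact map_smul B t f⟩
    have hfin := Module.finite_of_fg_torsion (H ⧸ F) htors
    exact AddSubgroup.index_ne_zero_of_finite (H := F)
  have hcinj : Function.Injective (AddMonoidHom.mulRight (algebraMap (𝓞 K) H c)) := by
    intro x y hxy
    have h1 : x.1 * algebraMap K (Quat K a b) c = y.1 * algebraMap K (Quat K a b) c :=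
      congrArg Subtype.val hxy
    rw [← Algebra.commutes, ← Algebra.commutes, ← Algebra.smul_def, ← Algebra.smul_def] at h1
    have h2 : (c : K) ≠ 0 := by simpa using hc
    exact Subtype.ext (smul_right_injective _ h2 h1)
  have hmapT : (⊤ : AddSubgroup H).map (AddMonoidHom.mulRight (algebraMap (𝓞 K) H c)) =
      (Ideal.span {algebraMap (𝓞 K) H c}).toAddSubgroup := by
    ext x
    constructor
    · rintro ⟨z, -, rfl⟩
      exact Ideal.mul_mem_left _ _ (Ideal.mem_span_singleton_self _)
    · intro hx
      obtain ⟨z, rfl⟩ := Ideal.mem_span_singleton'.1 hx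
      exact ⟨z, trivial, rfl⟩
  set cF := F.map (AddMonoidHom.mulRight (algebraMap (𝓞 K) H c)) with hcF
  have hcomp : ∀ f, B f * algebraMap (𝓞 K) H c = B (c • f) := fun f => by
    rw [map_smul, Algebra.smul_def, Algebra.commutes]
  have h1 : cF.relIndex F = Ideal.absNorm (Ideal.span {c}) ^ 4 := by
    let t : (Fin 4 → 𝓞 K) →+ (Fin 4 → 𝓞 K ⧸ Ideal.span {c}) :=
      { toFun := fun f i => Ideal.Quotient.mk _ (f i)
        map_zero' := by ext; simp
        map_add' := fun f g => by ext; simp }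
    have ht : Function.Surjective t := fun g => by
      choose f hf using fun i => Ideal.Quotient.mk_surjective (g i)
      exact ⟨f, funext hf⟩
    have h2 : cF = t.ker.map B.toAddMonoidHom := by
      ext x
      constructor
      · rintro ⟨_, ⟨f, rfl⟩, rfl⟩
        refine ⟨c • f, ?_, (hcomp f).symm⟩
        change t (c • f) = 0
        ext i
        change Ideal.Quotient.mk _ (c * f i) = 0
        rw [Ideal.Quotient.eq_zero_iff_mem]
        exact Ideal.mul_mem_right _ _ (Ideal.mem_span_singleton_self _)
      · rintro ⟨f, hf, rfl⟩
        have h3 : ∀ i, ∃ g, g * c = f i := fun i => by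
          have h4 : Ideal.Quotient.mk (Ideal.span {c}) (f i) = 0 := congrFun hf i
          rw [Ideal.Quotient.eq_zero_iff_mem] at h4
          exact Ideal.mem_span_singleton'.1 h4
        choose g hg using h3
        refine ⟨B g, ⟨g, rfl⟩, ?_⟩
        change B g * algebraMap (𝓞 K) H c = B f
        rw [hcomp]
        congr 1
        ext i
        rw [← hg i, Pi.smul_apply, smul_eq_mul, mul_comm]
    have h3 : F = (⊤ : AddSubgroup _).map B.toAddMonoidHom := AddMonoidHom.range_eq_map _
    rw [h2, h3, AddSubgroup.relIndex_map_map_of_injective _ _ hBinj,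
      AddSubgroup.relIndex_top_right, AddSubgroup.index_ker, AddMonoidHom.range_eq_top.2 ht,
      Nat.card_congr AddSubgroup.topEquiv.toEquiv, Nat.card_fun]
    simp [Ideal.absNorm_apply, Submodule.cardQuot_apply]
  have h2 : cF.relIndex (Ideal.span {algebraMap (𝓞 K) H c}).toAddSubgroup = F.index := by
    rw [← hmapT, hcF, AddSubgroup.relIndex_map_map_of_injective _ _ hcinj,
      AddSubgroup.relIndex_top_right]
  have h3 := AddSubgroup.relIndex_mul_index (show cF ≤ F from by
    rintro _ ⟨_, ⟨f, rfl⟩, rfl⟩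
    exact ⟨c • f, (hcomp f).symm⟩)
  have h4 := AddSubgroup.relIndex_mul_index
    (show cF ≤ (Ideal.span {algebraMap (𝓞 K) H c}).toAddSubgroup from
      hmapT ▸ AddSubgroup.map_mono le_top)
  rw [h1, ← h4, h2, mul_comm] at h3
  exact (Nat.eq_of_mul_eq_mul_left (Nat.pos_of_ne_zero hFfin) h3).symm

variable [NumberField.IsTotallyReal K]

theorem IsOrder.index_span {H : Subalgebra (𝓞 K) (Quat K a b)} (hH : IsOrder H)
    (hdef : IsDefinite K a b) {y : H} (hy : (hH.std hdef).n y ≠ 0) :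
    (Ideal.span {y}).toAddSubgroup.index =
      Ideal.absNorm (Ideal.span {(hH.std hdef).n y}) ^ 2 := by
  refine (hH.std hdef).index_span_eq_sq (fun c => Ideal.absNorm (Ideal.span {c})) (fun y => ?_)
    (fun c hc => hH.index_span_algebraMap hc) (fun c hc => by
      simpa [Ideal.absNorm_eq_zero_iff] using hc) hy
  obtain ⟨w, hw, hwy⟩ := exists_star_mul_eq_mul y.1
  obtain ⟨d, hd, hdw⟩ := hH.exists_smul_mem w
  refine ⟨⟨d • w, hdw⟩, fun h => ?_, Subtype.ext ?_⟩
  · have h1 : d • w = 0 := congrArg Subtype.val ((hH.std hdef).eq_zero_of_n _ h)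
    rw [← algebraMap_smul K d] at h1
    have h2 : (d : K) ≠ 0 := by simpa using hd
    exact hw ((smul_eq_zero.1 h1).resolve_left h2)
  · change star y.1 * d • w = d • w * y.1
    rw [mul_smul_comm, smul_mul_assoc, hwy]

end

/-! ### Principal left ideals of the maximal order -/

section

variable {K : Type*} [Field K] [NumberField K] {a b : K}
variable {G H : Subalgebra (𝓞 K) (Quat K a b)}

theorem fg_of_le {L M : Submodule (𝓞 K) (Quat K a b)} (hM : M.FG) (h : L ≤ M) : L.FG := by
  have := isNoetherian_of_fg_of_noetherian M hM
  have h1 := (IsNoetherian.noetherian (L.submoduleOf M)).map M.subtype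
  rwa [Submodule.submoduleOf, Submodule.map_comap_subtype, inf_eq_right.2 h] at h1

omit [NumberField K] in
theorem rightOrder_toSubmodule (G : Subalgebra (𝓞 K) (Quat K a b)) :
    rightOrder (Subalgebra.toSubmodule G) = G := by
  ext x
  constructor
  · intro h
    have := h 1 G.one_mem
    rwa [one_mul] at this
  · intro h y hy
    exact G.mul_mem hy h

omit [NumberField K] in
/-- Over an order of class number one, every lattice with that right order is principal. -/
theorem exists_eq_map_mulLeft (hG : IsOrder G) (hcls : classNumber G = 1)
    {L : Submodule (𝓞 K) (Quat K a b)} (hL : IsLattice L) (hLG : rightOrder L = G) :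
    ∃ x : Quat K a b, L = (Subalgebra.toSubmodule G).map (LinearMap.mulLeft (𝓞 K) x) := by
  obtain ⟨c, hc⟩ := Set.ncard_eq_one.1 hcls
  have h1 : Quotient.mk (rightEquivalence K a b) L ∈ classSet G := ⟨L, hL, hLG, rfl⟩
  have h2 : Quotient.mk (rightEquivalence K a b) (Subalgebra.toSubmodule G) ∈ classSet G :=
    ⟨_, hG, rightOrder_toSubmodule G, rfl⟩
  rw [hc, Set.mem_singleton_iff] at h1 h2
  obtain ⟨x, hx⟩ := Quotient.exact (h1.trans h2.symm)
  exact ⟨x, hx⟩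

/-- The left order of a left ideal of a maximal order that contains a nonzero scalar is the
maximal order. -/
theorem IsMaximalOrder.mem_of_mul_mem (hH : IsMaximalOrder H) {J : Ideal H} {c : 𝓞 K} (hc : c ≠ 0)
    (hcJ : algebraMap (𝓞 K) H c ∈ J) {z : Quat K a b}
    (hz : ∀ j ∈ J, ∃ j' ∈ J, z * j.1 = j'.1) : z ∈ H := by
  let Λ : Subalgebra (𝓞 K) (Quat K a b) :=
    { carrier := {z | ∀ j ∈ J, ∃ j' ∈ J, z * j.1 = j'.1}
      mul_mem' := fun {x y} hx hy j hj => by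
        obtain ⟨j₁, hj₁, h₁⟩ := hy j hj
        obtain ⟨j₂, hj₂, h₂⟩ := hx j₁ hj₁
        exact ⟨j₂, hj₂, by rw [mul_assoc, h₁, h₂]⟩
      add_mem' := fun {x y} hx hy j hj => by
        obtain ⟨j₁, hj₁, h₁⟩ := hy j hj
        obtain ⟨j₂, hj₂, h₂⟩ := hx j hj
        exact ⟨j₂ + j₁, J.add_mem hj₂ hj₁, by rw [add_mul, h₁, h₂]; rfl⟩
      algebraMap_mem' := fun r j hj => ⟨algebraMap (𝓞 K) H r * j, J.mul_mem_left _ hj, rfl⟩ }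
  have hle : H ≤ Λ := fun h hh j hj => ⟨⟨h, hh⟩ * j, J.mul_mem_left _ hj, rfl⟩
  have hΛ : IsOrder Λ := by
    have hO := hH.1
    refine ⟨?_, ?_⟩
    · have hinj : Function.Injective (LinearMap.lsmul (𝓞 K) (Quat K a b) c) := by
        intro x y hxy
        have h1 : c • x = c • y := hxy
        rw [← algebraMap_smul K c x, ← algebraMap_smul K c y] at h1
        have h2 : (c : K) ≠ 0 := by simpa using hc
        exact smul_right_injective _ h2 h1
      refine Submodule.fg_of_fg_map_injective _ hinj (fg_of_le hO.fg ?_)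
      rintro _ ⟨x, hx, rfl⟩
      obtain ⟨j, hj, h⟩ := hx _ hcJ
      change c • x ∈ H
      rw [Algebra.smul_def, Algebra.commutes]
      change x * (algebraMap (𝓞 K) H c).1 ∈ H
      rw [h]
      exact j.2
    · rw [eq_top_iff, ← hO.span_eq_top]
      exact Submodule.span_mono hle
  exact hH.2 hΛ hle hz

omit [NumberField K] in
theorem coprime_smul_mem {M : Submodule (𝓞 K) (Quat K a b)} {𝔮 : Ideal (𝓞 K)} (hq : 𝔮.IsMaximal)
    {c : 𝓞 K} (hc : c ∉ 𝔮) (k : ℕ) {z : Quat K a b} (h1 : c • z ∈ M)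
    (h2 : ∀ t ∈ 𝔮 ^ k, t • z ∈ M) : z ∈ M := by
  have hcop : IsCoprime (Ideal.span {c}) (𝔮 ^ k) := by
    apply IsCoprime.pow_right
    rw [Ideal.isCoprime_iff_exists]
    obtain ⟨s, t, ht, hst⟩ := hq.exists_inv hc
    exact ⟨s * c, Ideal.mem_span_singleton'.2 ⟨s, rfl⟩, t, ht, hst⟩
  obtain ⟨i, hi, t, ht, hit⟩ := Ideal.isCoprime_iff_exists.1 hcop
  obtain ⟨s, rfl⟩ := Ideal.mem_span_singleton'.1 hi
  have : z = s • c • z + t • z := by rw [← mul_smul, ← add_smul, hit, one_smul]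
  rw [this]
  exact M.add_mem (M.smul_mem _ h1) (h2 t ht)

/-- A left ideal of the maximal order that contains a scalar prime to `𝔮` is principal: its
intersection with the suborder `G` has left order `G`, hence is principal, and by perceptivity
a generator of it generates the ideal. -/
theorem exists_eq_span (hH : IsMaximalOrder H) (hG : IsOrder G)
    (hperc : IsPerceptive G H) (hcls : classNumber G = 1) {𝔮 : Ideal (𝓞 K)} (hq : 𝔮.IsMaximal)
    (hq2 : ∀ t ∈ 𝔮 ^ 2, ∀ x ∈ H, t • x ∈ G) (J : Ideal H) {c : 𝓞 K} (hc : c ∉ 𝔮)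
    (hcJ : algebraMap (𝓞 K) H c ∈ J) : ∃ y, J = Ideal.span {y} := by
  have hc0 : c ≠ 0 := fun h => hc (h ▸ 𝔮.zero_mem)
  have hcK : (c : K) ≠ 0 := by simpa using hc0
  have hHo : IsOrder H := hH.1
  have hsmul : ∀ (r : 𝓞 K) (x : Quat K a b), star (r • x) = r • star x := fun r x => by
    rw [← algebraMap_smul K r x, star_smul_quat, algebraMap_smul]
  let L : Submodule (𝓞 K) (Quat K a b) :=
    { carrier := {x | star x ∈ G ∧ ∃ h : star x ∈ H, (⟨star x, h⟩ : H) ∈ J}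
      add_mem' := fun {x y} hx hy => by
        obtain ⟨hx1, hx2, hx3⟩ := hx
        obtain ⟨hy1, hy2, hy3⟩ := hy
        have := J.add_mem hx3 hy3
        simp only [Set.mem_ofPred_eq, star_add]
        exact ⟨G.add_mem hx1 hy1, H.add_mem hx2 hy2, this⟩
      zero_mem' := by
        simp only [Set.mem_ofPred_eq, star_zero]
        exact ⟨G.zero_mem, H.zero_mem, J.zero_mem⟩
      smul_mem' := fun r x hx => by
        obtain ⟨hx1, hx2, hx3⟩ := hx
        have := J.mul_mem_left (algebraMap (𝓞 K) H r) hx3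
        simp only [Set.mem_ofPred_eq, (hsmul r x).trans (Algebra.smul_def _ _)]
        exact ⟨G.mul_mem (G.algebraMap_mem r) hx1, H.mul_mem (H.algebraMap_mem r) hx2, this⟩ }
  have hLJ : ∀ j : H, star j.1 ∈ L ↔ j.1 ∈ G ∧ j ∈ J := by
    intro j
    change (star (star j.1) ∈ G ∧ ∃ h : star (star j.1) ∈ H, (⟨star (star j.1), h⟩ : H) ∈ J) ↔ _
    simp only [star_star]
    exact and_congr_right fun _ => ⟨fun ⟨_, h⟩ => h, fun h => ⟨j.2, h⟩⟩
  have hLH : ∀ x ∈ L, ∃ j : H, j.1 ∈ G ∧ j ∈ J ∧ x = star j.1 := by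
    rintro x ⟨h1, h2, h3⟩
    exact ⟨⟨star x, h2⟩, h1, h3, (star_star x).symm⟩
  have hLlat : IsLattice L := by
    refine ⟨fg_of_le hHo.fg ?_, ?_⟩
    · intro x hx
      obtain ⟨j, -, -, rfl⟩ := hLH x hx
      exact hHo.star_mem j.2
    · rw [eq_top_iff, ← hG.span_eq_top, Submodule.span_le]
      intro x hx
      have h1 : c • x ∈ L := by
        have hx' := hG.star_mem hx
        have h2 : star (c • star x) ∈ L := (hLJ ⟨c • star x, H.smul_mem (hperc.1 hx') c⟩).2
          ⟨G.smul_mem hx' c, by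
            have h3 := J.mul_mem_left ⟨star x, hperc.1 hx'⟩ hcJ
            convert h3 using 1
            refine Subtype.ext ?_
            change c • star x = star x * algebraMap (𝓞 K) _ c
            rw [← Algebra.commutes, Algebra.smul_def]⟩
        rwa [hsmul, star_star] at h2
      have h2 := Submodule.smul_mem (Submodule.span K (L : Set (Quat K a b))) (c : K)⁻¹
        (Submodule.subset_span h1)
      rwa [← algebraMap_smul K c x, inv_smul_smul₀ hcK] at h2
  have hLord : rightOrder L = G := by
    ext x
    constructor
    · intro hx
      have hz : ∀ j : H, j.1 ∈ G → j ∈ J → ∃ j' : H, j'.1 ∈ G ∧ j' ∈ J ∧ star x * j.1 = j'.1 := by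
        intro j hjG hjJ
        obtain ⟨j', h1, h2, h3⟩ := hLH _ (hx _ ((hLJ j).2 ⟨hjG, hjJ⟩))
        refine ⟨j', h1, h2, ?_⟩
        rw [← star_star j'.1, ← h3, star_mul, star_star]
      have h1 : ∀ t ∈ 𝔮 ^ 2, t • star x ∈ H := by
        intro t ht
        refine hH.mem_of_mul_mem hc0 hcJ fun j hj => ?_
        obtain ⟨j', h1, h2, h3⟩ := hz (algebraMap (𝓞 K) H t * j) (by
          have := hq2 t ht j.1 j.2
          rwa [Algebra.smul_def] at this) (J.mul_mem_left _ hj)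
        refine ⟨j', h2, ?_⟩
        rw [← h3, Algebra.smul_def, Algebra.commutes, mul_assoc]
        rfl
      have h2 : c • star x ∈ G := by
        obtain ⟨j', h1, h2, h3⟩ := hz (algebraMap (𝓞 K) H c) (G.algebraMap_mem c) hcJ
        rw [Algebra.smul_def, Algebra.commutes]
        change star x * (algebraMap (𝓞 K) H c).1 ∈ G
        rwa [h3]
      have h3 : star x ∈ H :=
        coprime_smul_mem (M := Subalgebra.toSubmodule H) hq hc 2 (hperc.1 h2) h1
      have h4 : star x ∈ G :=
        coprime_smul_mem (M := Subalgebra.toSubmodule G) hq hc 2 h2 (fun t ht => hq2 t ht _ h3)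
      have := hG.star_mem h4
      rwa [star_star] at this
    · intro hx y hy
      obtain ⟨j, h1, h2, rfl⟩ := hLH y hy
      have hx' := hG.star_mem hx
      have h3 := (hLJ (⟨star x, hperc.1 hx'⟩ * j)).2 ⟨G.mul_mem hx' h1, J.mul_mem_left _ h2⟩
      change star (star x * j.1) ∈ L at h3
      rwa [star_mul, star_star] at h3
  obtain ⟨x, hx⟩ := exists_eq_map_mulLeft hG hcls hLlat hLord
  have hxL : x ∈ L := hx ▸ ⟨1, G.one_mem, mul_one x⟩
  obtain ⟨y, hyG, hyJ, rfl⟩ := hLH x hxL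
  refine ⟨y, le_antisymm (fun j hj => ?_) (by rwa [Ideal.span_singleton_le_iff_mem])⟩
  obtain ⟨u, ⟨huH, hu⟩, huj⟩ := hperc.2 j.1 j.2
  have h1 := (hLJ (⟨u, huH⟩ * j)).2 ⟨huj, J.mul_mem_left _ hj⟩
  rw [hx] at h1
  obtain ⟨g, hg, h2⟩ := h1
  have h3 : star y.1 * g = star (u * j.1) := h2
  have h4 : u * j.1 = star g * y.1 := by rw [← star_star (u * j.1), ← h3, star_mul, star_star]
  refine Ideal.mem_span_singleton'.2 ⟨⟨star u, hHo.star_mem huH⟩ *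
    ⟨star g, hHo.star_mem (hperc.1 hg)⟩, Subtype.ext ?_⟩
  change star u * star g * y.1 = j.1
  rw [mul_assoc, ← h4, ← mul_assoc, star_mul_eq_nrd, hu, map_one, one_mul]

end

/-! ### Zero divisors modulo a prime -/

namespace StdInvolution

section Norms

variable {O R : Type*} [CommRing O] [Ring R] [Algebra O R] {S : StdInvolution O R}

theorem algebraMap_mul_cancel [IsDomain O] (S : StdInvolution O R) {c : O} (hc : c ≠ 0) {u v : R}
    (h : algebraMap O R c * u = algebraMap O R c * v) : u = v := by
  rw [Algebra.commutes, Algebra.commutes c v] at h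
  exact mul_right_injective (S := S) (by rw [S.n_algebraMap]; exact pow_ne_zero _ hc) h

theorem n_mem_of_mem_scalarIdeal {I : Ideal O} {x : R} (hx : x ∈ scalarIdeal R I) : S.n x ∈ I := by
  suffices x ∈ scalarIdeal R I ∧ S.n x ∈ I from this.2
  refine scalarIdeal_induction (p := fun x => x ∈ scalarIdeal R I ∧ S.n x ∈ I) hx
    (fun r hr m => ⟨algebraMap_mul_mem_scalarIdeal hr m, ?_⟩)
    (fun x y hx hy => ⟨add_mem hx.1 hy.1, ?_⟩)
  · rw [S.n_mul, S.n_algebraMap, sq, mul_assoc]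
    exact I.mul_mem_right _ hr
  · rw [S.n_add]
    exact I.add_mem (I.add_mem hx.2 (tr_mem_of_mem_scalarIdeal (Ideal.mul_mem_right _ _ hx.1))) hy.2

theorem n_mem_of_mem_sup {I : Ideal O} {x z : R} (hx : S.n x ∈ I)
    (hz : z ∈ Ideal.span {x} ⊔ scalarIdeal R I) : S.n z ∈ I := by
  obtain ⟨u, hu, p, hp, rfl⟩ := Submodule.mem_sup.1 hz
  obtain ⟨h, rfl⟩ := Ideal.mem_span_singleton'.1 hu
  rw [S.n_add, S.n_mul, S.tr_mul_comm]
  refine I.add_mem (I.add_mem (I.mul_mem_left _ hx) ?_) (n_mem_of_mem_scalarIdeal hp)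
  rw [← S.tr_conj, S.conj_mul, S.conj_conj]
  exact tr_mem_of_mem_scalarIdeal (Ideal.mul_mem_left _ _ hp)

/-- If `R` has an element of norm divisible by a prime `𝔭` exactly when the element is itself
divisible, then `R / 𝔭 R` is a field of degree at most two over the residue field: an element is
determined up to conjugation by its trace and its norm. -/
theorem index_le_of_forall {𝔭 : Ideal O} (hp : 𝔭.IsMaximal) [Finite (O ⧸ 𝔭)]
    (hfin : Finite (R ⧸ scalarIdeal R 𝔭)) (h : ∀ x : R, S.n x ∈ 𝔭 → x ∈ scalarIdeal R 𝔭) :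
    Nat.card (R ⧸ scalarIdeal R 𝔭) ≤ 2 * Nat.card (O ⧸ 𝔭) ^ 2 := by
  classical
  have hiff : ∀ x : R, x ∈ scalarIdeal R 𝔭 ↔ S.n x ∈ 𝔭 := fun x =>
    ⟨n_mem_of_mem_scalarIdeal, h x⟩
  have hcomm := S.commutator_mem_of_mem_iff hp.isPrime (scalarIdeal R 𝔭) hiff
  have := Fintype.ofFinite (R ⧸ scalarIdeal R 𝔭)
  have := Fintype.ofFinite (O ⧸ 𝔭)
  have hsurj := Ideal.Quotient.mk_surjective (I := scalarIdeal R 𝔭)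
  choose g hg using hsurj
  let f : (R ⧸ scalarIdeal R 𝔭) → (O ⧸ 𝔭) × (O ⧸ 𝔭) := fun v =>
    (Ideal.Quotient.mk 𝔭 (S.tr (g v)), Ideal.Quotient.mk 𝔭 (S.n (g v)))
  have hfib : ∀ c ∈ Finset.univ.image f, (Finset.univ.filter fun v => f v = c).card ≤ 2 := by
    intro c hc
    obtain ⟨v, -, rfl⟩ := Finset.mem_image.1 hc
    refine (Finset.card_le_card (t := {v, Ideal.Quotient.mk _ (S.conj (g v))}) ?_).trans
      Finset.card_le_two
    intro w hw
    rw [Finset.mem_filter] at hw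
    have h1 : S.tr (g w) - S.tr (g v) ∈ 𝔭 := Ideal.Quotient.eq.1 (congrArg Prod.fst hw.2)
    have h2 : S.n (g w) - S.n (g v) ∈ 𝔭 := Ideal.Quotient.eq.1 (congrArg Prod.snd hw.2)
    set x := g v with hx
    set y := g w with hy
    have h3 : (y - x) * (y - S.conj x) ∈ scalarIdeal R 𝔭 := by
      have h4 : (y - x) * (y - S.conj x) = (y * x - x * y) +
          (algebraMap O R (S.tr y - S.tr x) * y - algebraMap O R (S.n y - S.n x)) := by
        rw [map_sub, map_sub, sub_mul (algebraMap O R (S.tr y)), ← S.conj_mul_self y,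
          ← S.mul_conj x, S.conj_eq y, S.conj_eq x, Algebra.commutes (S.tr x) y]
        noncomm_ring
      rw [h4]
      exact add_mem (hcomm y x) (sub_mem (algebraMap_mul_mem_scalarIdeal h1 y)
        (algebraMap_mem_scalarIdeal h2))
    rw [hiff, S.n_mul] at h3
    rw [Finset.mem_insert, Finset.mem_singleton]
    rcases hp.isPrime.mem_or_mem h3 with h5 | h5
    · left
      rw [← hg w, ← hg v]
      exact Ideal.Quotient.eq.2 (h _ h5)
    · right
      rw [← hg w]
      exact Ideal.Quotient.eq.2 (h _ h5)
  have h1 := Finset.card_le_mul_card_image Finset.univ 2 hfib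
  have h2 := Finset.card_le_univ (Finset.univ.image f)
  rw [Fintype.card_prod] at h2
  rw [Nat.card_eq_fintype_card, Nat.card_eq_fintype_card, sq]
  rw [Finset.card_univ] at h1
  exact h1.trans (Nat.mul_le_mul_left 2 h2)

end Norms

section Dedekind

variable {O R : Type*} [CommRing O] [IsDedekindDomain O] [Ring R] [Algebra O R]
  {S : StdInvolution O R}

/-- If the left ideal generated by a prime `𝔭` and a zero divisor `x` modulo `𝔭` is principal,
then its generator has norm generating `𝔭`. -/
theorem span_n_eq {𝔭 : Ideal O} (hp : 𝔭.IsMaximal) (hp0 : 𝔭 ≠ ⊥) {x y : R} (hx : S.n x ∈ 𝔭)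
    (hx' : x ∉ scalarIdeal R 𝔭) (hy : Ideal.span {x} ⊔ scalarIdeal R 𝔭 = Ideal.span {y}) :
    Ideal.span {S.n y} = 𝔭 := by
  have hpp : Prime 𝔭 := (Ideal.prime_iff_isPrime hp0).2 hp.isPrime
  have hny : S.n y ∈ 𝔭 := n_mem_of_mem_sup hx (hy ▸ Ideal.mem_span_singleton_self y)
  have hdiv : ∀ c ∈ 𝔭, ∃ z, z * y = algebraMap O R c := fun c hc =>
    Ideal.mem_span_singleton'.1 (hy ▸ Ideal.mem_sup_right (algebraMap_mem_scalarIdeal hc))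
  have hlt : ¬ 𝔭 ≤ 𝔭 ^ 2 := by
    rw [← Ideal.dvd_iff_le]
    intro h
    have h1 : 𝔭 ^ 2 ∣ 𝔭 ^ 1 := by rwa [pow_one]
    exact absurd ((pow_dvd_pow_iff hpp.ne_zero hpp.not_isUnit).1 h1) (by norm_num)
  obtain ⟨c, hc, hc2⟩ := SetLike.not_le_iff_exists.1 hlt
  obtain ⟨z, hz⟩ := hdiv c hc
  have hzn : S.n z * S.n y = c ^ 2 := by rw [← S.n_mul, hz, S.n_algebraMap]
  -- If `𝔭²` divides the norm of `y`, then `y` is divisible by `𝔭`, hence so is `x`.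
  have hny2 : S.n y ∉ 𝔭 ^ 2 := by
    intro h
    have hznot : S.n z ∉ 𝔭 := by
      intro hz'
      have h1 : c * c ∈ 𝔭 ^ 3 := by
        rw [← sq, ← hzn, pow_succ', ]
        exact Ideal.mul_mem_mul hz' h
      obtain ⟨J, hJ⟩ := Ideal.dvd_span_singleton.2 hc
      have h2 : ¬ 𝔭 ∣ J := by
        rintro ⟨J', rfl⟩
        apply hc2
        rw [← Ideal.dvd_span_singleton, hJ, sq, ← mul_assoc]
        exact dvd_mul_right _ _
      have h3 : 𝔭 ^ 3 ∣ 𝔭 ^ 2 * (J * J) := by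
        have h4 := Ideal.dvd_span_singleton.2 h1
        rw [← Ideal.span_singleton_mul_span_singleton, hJ] at h4
        convert h4 using 1
        ring
      rw [pow_succ, mul_dvd_mul_iff_left (pow_ne_zero 2 hpp.ne_zero)] at h3
      exact (hpp.dvd_or_dvd h3).elim h2 h2
    -- `z` is invertible modulo `𝔭`, so that `y` would be divisible by `𝔭`.
    have h1 : y ∈ scalarIdeal R 𝔭 := by
      have h2 : algebraMap O R (S.n z) * y ∈ scalarIdeal R (𝔭 ^ 1) := by
        rw [pow_one, ← S.conj_mul_self, mul_assoc, hz]
        exact Ideal.mul_mem_left _ _ (algebraMap_mem_scalarIdeal hc)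
      have := mem_scalarIdeal_of_mul_mem hp 1 hznot h2
      rwa [pow_one] at this
    apply hx'
    have h2 : x ∈ Ideal.span {y} := hy ▸ Ideal.mem_sup_left (Ideal.mem_span_singleton_self x)
    obtain ⟨u, rfl⟩ := Ideal.mem_span_singleton'.1 h2
    exact Ideal.mul_mem_left _ _ h1
  obtain ⟨J, hJ⟩ := Ideal.dvd_span_singleton.2 hny
  -- No other prime divides the norm of `y`, which divides the squares of the elements of `𝔭`.
  suffices J = ⊤ by rw [hJ, this, Ideal.mul_top]
  by_contra hJt
  obtain ⟨𝔪, hm, hJm⟩ := Ideal.exists_le_maximal J hJt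
  by_cases hmp : 𝔪 = 𝔭
  · apply hny2
    rw [hmp] at hJm
    rw [← Ideal.dvd_span_singleton, hJ, sq]
    exact mul_dvd_mul_left _ (Ideal.dvd_iff_le.2 hJm)
  · have h1 : ¬ 𝔭 ≤ 𝔪 := fun h => hmp (hp.eq_of_le hm.ne_top h).symm
    obtain ⟨d, hd, hdm⟩ := SetLike.not_le_iff_exists.1 h1
    obtain ⟨w, hw⟩ := hdiv d hd
    have h2 : S.n w * S.n y = d ^ 2 := by rw [← S.n_mul, hw, S.n_algebraMap]
    have h3 : S.n y ∈ 𝔪 := by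
      have h4 : S.n y ∈ Ideal.span {S.n y} := Ideal.mem_span_singleton_self _
      rw [hJ] at h4
      exact hJm (Ideal.mul_le_right h4)
    have h4 : d ^ 2 ∈ 𝔪 := by
      rw [← h2]
      exact Ideal.mul_mem_left _ _ h3
    exact hdm (hm.isPrime.mem_of_pow_mem 2 h4)

/-- At a prime `𝔮` not dividing the discriminant, the left ideal generated by `𝔮` and a zero
divisor modulo `𝔮` is principal as soon as left ideals containing a scalar prime to `𝔮` are: it is
a multiple of such an ideal. -/
theorem exists_sup_eq_span (hcr : S.HasCramer) {𝔮 : Ideal O} (hq : 𝔮.IsMaximal) (hq0 : 𝔮 ≠ ⊥)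
    (hdisc : ∃ x y w, S.tr ((x * y - y * x) * S.conj w) ∉ 𝔮)
    (hPI : ∀ (J : Ideal R) (c : O), c ∉ 𝔮 → algebraMap O R c ∈ J → ∃ y, J = Ideal.span {y})
    {x : R} (hx : S.n x ∈ 𝔮) (hx' : x ∉ scalarIdeal R 𝔮) :
    ∃ y, Ideal.span {x} ⊔ scalarIdeal R 𝔮 = Ideal.span {y} := by
  have hqp : Prime 𝔮 := (Ideal.prime_iff_isPrime hq0).2 hq.isPrime
  have hlt : ¬ 𝔮 ≤ 𝔮 ^ 2 := by
    rw [← Ideal.dvd_iff_le]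
    intro h
    have h1 : 𝔮 ^ 2 ∣ 𝔮 ^ 1 := by rwa [pow_one]
    exact absurd ((pow_dvd_pow_iff hqp.ne_zero hqp.not_isUnit).1 h1) (by norm_num)
  -- A zero divisor whose norm is divisible by `𝔮` exactly once.
  have hexact : ∃ x₁, Ideal.span {x} ⊔ scalarIdeal R 𝔮 = Ideal.span {x₁} ⊔ scalarIdeal R 𝔮 ∧
      S.n x₁ ∈ 𝔮 ∧ S.n x₁ ∉ 𝔮 ^ 2 := by
    by_cases h : S.n x ∈ 𝔮 ^ 2
    · have htr : ∃ z, S.tr (x * z) ∉ 𝔮 := by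
        by_contra! hcon
        obtain ⟨u, v, w, huv⟩ := hdisc
        apply hx'
        have := mem_scalarIdeal_of_tr_mul_mem hcr hq 1 huv (t := x) (fun c hc => by
          rw [pow_one] at hc ⊢
          exact (hq.isPrime.mem_or_mem hc).resolve_left huv) (by simpa using hcon)
        rwa [pow_one] at this
      obtain ⟨z, hz⟩ := htr
      obtain ⟨t, ht, ht2⟩ := SetLike.not_le_iff_exists.1 hlt
      have hp : algebraMap O R t * S.conj z ∈ scalarIdeal R 𝔮 := algebraMap_mul_mem_scalarIdeal ht _
      refine ⟨x + algebraMap O R t * S.conj z, ?_, ?_, ?_⟩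
      · apply le_antisymm
        · refine sup_le ?_ le_sup_right
          rw [Ideal.span_singleton_le_iff_mem]
          have := sub_mem (Ideal.mem_sup_left (T := scalarIdeal R 𝔮)
            (Ideal.mem_span_singleton_self (x + algebraMap O R t * S.conj z)))
            (Ideal.mem_sup_right hp)
          rwa [add_sub_cancel_right] at this
        · refine sup_le ?_ le_sup_right
          rw [Ideal.span_singleton_le_iff_mem]
          exact add_mem (Ideal.mem_sup_left (Ideal.mem_span_singleton_self x))
            (Ideal.mem_sup_right hp)
      · exact n_mem_of_mem_sup hx (add_mem (Ideal.mem_sup_left (Ideal.mem_span_singleton_self x))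
          (Ideal.mem_sup_right hp))
      · intro hcon
        rw [S.n_add, S.conj_mul, S.conj_conj, S.conj_algebraMap, ← mul_assoc, ← Algebra.commutes,
          S.tr_algebraMap_mul, S.n_mul, S.n_algebraMap] at hcon
        have h1 : t ^ 2 * S.n (S.conj z) ∈ 𝔮 ^ 2 :=
          Ideal.mul_mem_right _ _ (Ideal.pow_mem_pow ht 2)
        have h2 : t * S.tr (x * z) ∈ 𝔮 ^ 2 := by
          have := sub_mem (sub_mem hcon h1) h
          rwa [add_sub_cancel_right, add_sub_cancel_left] at this
        rw [mul_comm] at h2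
        rcases hq.isPrime.mul_mem_pow 𝔮 h2 with h3 | h3
        · exact hz h3
        · exact ht2 h3
    · exact ⟨x, rfl, hx, h⟩
  obtain ⟨x₁, hJ, hn, hn2⟩ := hexact
  rw [hJ]
  set J := Ideal.span {x₁} ⊔ scalarIdeal R 𝔮 with hJdef
  have hn0 : S.n x₁ ≠ 0 := fun h => hn2 (h ▸ zero_mem _)
  obtain ⟨B, hB⟩ := Ideal.dvd_span_singleton.2 hn
  have hBq : ¬ B ≤ 𝔮 := fun h => hn2 (by
    rw [← Ideal.dvd_span_singleton, hB, sq]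
    exact mul_dvd_mul_left _ (Ideal.dvd_iff_le.2 h))
  obtain ⟨t, htB, htq⟩ := SetLike.not_le_iff_exists.1 hBq
  have ht0 : t ≠ 0 := fun h => htq (h ▸ zero_mem _)
  have hxJ : x₁ ∈ J := Ideal.mem_sup_left (Ideal.mem_span_singleton_self _)
  have hP : ∀ p ∈ scalarIdeal R 𝔮, ∃ z, algebraMap O R t * p = algebraMap O R (S.n x₁) * z := by
    intro p hp
    refine scalarIdeal_induction
      (p := fun p => ∃ z, algebraMap O R t * p = algebraMap O R (S.n x₁) * z) hp
      (fun c hc y => ?_) (fun p₁ p₂ h₁ h₂ => ?_)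
    · have h1 : c * t ∈ Ideal.span {S.n x₁} := hB ▸ Ideal.mul_mem_mul hc htB
      obtain ⟨d, hd⟩ := Ideal.mem_span_singleton'.1 h1
      refine ⟨algebraMap O R d * y, ?_⟩
      rw [← mul_assoc, ← mul_assoc, ← map_mul, ← map_mul, mul_comm t c, ← hd, mul_comm d]
    · obtain ⟨z₁, h₁⟩ := h₁
      obtain ⟨z₂, h₂⟩ := h₂
      exact ⟨z₁ + z₂, by rw [mul_add, mul_add, h₁, h₂]⟩
  have hdiv : ∀ j ∈ J, ∃ z, algebraMap O R t * j = z * x₁ := by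
    intro j hj
    have h1 : j * S.conj x₁ ∈ scalarIdeal R 𝔮 := by
      obtain ⟨u, hu, p, hp, rfl⟩ := Submodule.mem_sup.1 hj
      obtain ⟨h, rfl⟩ := Ideal.mem_span_singleton'.1 hu
      rw [add_mul, mul_assoc, S.mul_conj]
      exact add_mem (Ideal.mul_mem_left _ _ (algebraMap_mem_scalarIdeal hn))
        (Ideal.mul_mem_right _ _ hp)
    obtain ⟨z, hz⟩ := hP _ h1
    refine ⟨z, S.algebraMap_mul_cancel hn0 ?_⟩
    rw [← mul_assoc _ z, ← hz, mul_assoc, mul_assoc, S.conj_mul_self, ← Algebra.commutes _ j,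
      ← mul_assoc, ← mul_assoc, ← map_mul, ← map_mul, mul_comm]
  -- The left ideal `t J x₁⁻¹`, which contains the scalar `t` prime to `𝔮`.
  let J' : Ideal R :=
    { carrier := {z | ∃ j ∈ J, algebraMap O R t * j = z * x₁}
      add_mem' := by
        rintro z₁ z₂ ⟨j₁, hj₁, h₁⟩ ⟨j₂, hj₂, h₂⟩
        exact ⟨j₁ + j₂, add_mem hj₁ hj₂, by rw [mul_add, h₁, h₂, add_mul]⟩
      zero_mem' := ⟨0, zero_mem _, by rw [mul_zero, zero_mul]⟩
      smul_mem' := by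
        rintro c z ⟨j, hj, h⟩
        exact ⟨c * j, Ideal.mul_mem_left _ _ hj, by
          rw [smul_eq_mul, mul_assoc, ← h, ← mul_assoc, Algebra.commutes, mul_assoc]⟩ }
  obtain ⟨z₀, hz₀⟩ := hPI J' t htq ⟨x₁, hxJ, rfl⟩
  obtain ⟨y₀, hy₀, h₀⟩ : z₀ ∈ J' := hz₀ ▸ Ideal.mem_span_singleton_self z₀
  refine ⟨y₀, le_antisymm (fun j hj => ?_) (by rwa [Ideal.span_singleton_le_iff_mem])⟩
  obtain ⟨z, hz⟩ := hdiv j hj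
  have hzJ : z ∈ J' := ⟨j, hj, hz⟩
  rw [hz₀] at hzJ
  obtain ⟨u, rfl⟩ := Ideal.mem_span_singleton'.1 hzJ
  refine Ideal.mem_span_singleton'.2 ⟨u, S.algebraMap_mul_cancel ht0 ?_⟩
  rw [hz, mul_assoc, ← h₀, ← mul_assoc, ← mul_assoc, Algebra.commutes]

end Dedekind

end StdInvolution

/-! ### Left ideals above a prime -/

open StdInvolution

section

variable {K : Type*} [Field K] [NumberField K] {a b : K}
variable {G H : Subalgebra (𝓞 K) (Quat K a b)}

theorem IsOrder.finite_quot_scalarIdeal (hH : IsOrder H) {𝔭 : Ideal (𝓞 K)} (hp0 : 𝔭 ≠ ⊥) :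
    Finite (H ⧸ scalarIdeal H 𝔭) := by
  obtain ⟨c, hc, hc0⟩ := Submodule.exists_mem_ne_zero_of_ne_bot hp0
  have h1 := hH.index_span_algebraMap hc0
  have h2 : (Ideal.span {algebraMap (𝓞 K) H c}).toAddSubgroup ≤
      (scalarIdeal H 𝔭).toAddSubgroup := by
    change Ideal.span {algebraMap (𝓞 K) H c} ≤ scalarIdeal H 𝔭
    rw [Ideal.span_singleton_le_iff_mem]
    exact algebraMap_mem_scalarIdeal hc
  have h3 : (scalarIdeal H 𝔭).toAddSubgroup.index ≠ 0 := by
    refine ne_zero_of_dvd_ne_zero ?_ (AddSubgroup.index_dvd_of_le h2)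
    rw [h1]
    exact pow_ne_zero _ (by simpa [Ideal.absNorm_eq_zero_iff] using hc0)
  have : (scalarIdeal H 𝔭).toAddSubgroup.FiniteIndex := ⟨h3⟩
  exact (scalarIdeal H 𝔭).toAddSubgroup.finite_quotient_of_finiteIndex

/-- By Nakayama's lemma, the reduction of an order modulo a prime has dimension at least four. -/
theorem IsOrder.pow_four_le_card (hH : IsOrder H) {𝔭 : Ideal (𝓞 K)} (hp : 𝔭.IsMaximal)
    (hp0 : 𝔭 ≠ ⊥) : Ideal.absNorm 𝔭 ^ 4 ≤ Nat.card (H ⧸ scalarIdeal H 𝔭) := by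
  let _ : Field (𝓞 K ⧸ 𝔭) := Ideal.Quotient.field 𝔭
  have hfinH : Module.Finite (𝓞 K) H := Module.Finite.iff_fg.2 hH.fg
  let M := H ⧸ (𝔭 • (⊤ : Submodule (𝓞 K) H))
  have hcard : Nat.card (H ⧸ scalarIdeal H 𝔭) = Nat.card M := by
    change (scalarIdeal H 𝔭).toAddSubgroup.index = (𝔭 • (⊤ : Submodule (𝓞 K) H)).toAddSubgroup.index
    congr 1
  have hfinM : Module.Finite (𝓞 K ⧸ 𝔭) M := Module.Finite.of_restrictScalars_finite (𝓞 K) _ _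
  have h1 : Nat.card M = Ideal.absNorm 𝔭 ^ Module.finrank (𝓞 K ⧸ 𝔭) M := by
    rw [Module.natCard_eq_pow_finrank (K := 𝓞 K ⧸ 𝔭)]
    rfl
  have hN : 0 < Ideal.absNorm 𝔭 := Nat.pos_of_ne_zero (by rwa [Ne, Ideal.absNorm_eq_zero_iff])
  rw [hcard, h1]
  refine Nat.pow_le_pow_right hN ?_
  let bas := Module.finBasis (𝓞 K ⧸ 𝔭) M
  choose v hv using fun i => Submodule.mkQ_surjective (𝔭 • (⊤ : Submodule (𝓞 K) H)) (bas i)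
  have hsup : (⊤ : Submodule (𝓞 K) H) ≤ Submodule.span (𝓞 K) (Set.range v) ⊔ 𝔭 • ⊤ := by
    intro x _
    choose f hf using fun i => Ideal.Quotient.mk_surjective (I := 𝔭)
      (bas.repr (Submodule.mkQ (𝔭 • (⊤ : Submodule (𝓞 K) H)) x) i)
    have h2 : x - ∑ i, f i • v i ∈ 𝔭 • (⊤ : Submodule (𝓞 K) H) := by
      rw [← Submodule.Quotient.mk_eq_zero, ← Submodule.mkQ_apply, map_sub, map_sum, sub_eq_zero,
        ← bas.sum_repr (Submodule.mkQ (𝔭 • (⊤ : Submodule (𝓞 K) H)) x)]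
      refine Finset.sum_congr rfl fun i _ => ?_
      rw [map_smul, hv, ← hf]
      rfl
    rw [← add_sub_cancel (∑ i, f i • v i) x]
    exact Submodule.add_mem_sup (Submodule.sum_mem _ fun i _ =>
      Submodule.smul_mem _ _ (Submodule.subset_span ⟨i, rfl⟩)) h2
  obtain ⟨r, hr, hle⟩ := Submodule.exists_sub_one_mem_and_smul_le_of_fg_of_le_sup
    hfinH.fg_top le_rfl hsup
  have hr0 : r ≠ 0 := by
    rintro rfl
    rw [zero_sub, neg_mem_iff] at hr
    exact hp.ne_top ((Ideal.eq_top_iff_one _).2 hr)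
  have hrK : (r : K) ≠ 0 := by simpa using hr0
  have hspan : Submodule.span K (Set.range fun i => (v i : Quat K a b)) = ⊤ := by
    rw [eq_top_iff, ← hH.span_eq_top, Submodule.span_le]
    intro x hx
    have h2 : r • (⟨x, hx⟩ : H) ∈ Submodule.span (𝓞 K) (Set.range v) :=
      hle (Submodule.smul_mem_pointwise_smul _ r _ trivial)
    have h3 : ∀ y ∈ Submodule.span (𝓞 K) (Set.range v),
        y.1 ∈ Submodule.span K (Set.range fun i => (v i : Quat K a b)) := by
      intro y hy
      induction hy using Submodule.span_induction with
      | mem y hy =>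
        obtain ⟨i, rfl⟩ := hy
        exact Submodule.subset_span ⟨i, rfl⟩
      | zero => exact Submodule.zero_mem _
      | add y z _ _ hy hz => exact Submodule.add_mem _ hy hz
      | smul s y _ hy =>
        have := Submodule.smul_mem _ (s : K) hy
        rwa [algebraMap_smul K s y.1] at this
    have h4 := Submodule.smul_mem _ (r : K)⁻¹ (h3 _ h2)
    change (r : K)⁻¹ • r • x ∈ _ at h4
    rwa [← algebraMap_smul K r x, inv_smul_smul₀ hrK] at h4
  have h2 := finrank_range_le_card (R := K) fun i => (v i : Quat K a b)
  rw [Set.finrank, hspan, finrank_top, finrank_quat, Fintype.card_fin] at h2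
  exact h2

variable [NumberField.IsTotallyReal K]

/-- Modulo every prime an order has zero divisors, as its reduction is too large to be a field
of degree two. -/
theorem IsOrder.exists_not_mem_scalarIdeal (hH : IsOrder H) (hdef : IsDefinite K a b)
    {𝔭 : Ideal (𝓞 K)} (hp : 𝔭.IsMaximal) (hp0 : 𝔭 ≠ ⊥) :
    ∃ x, (hH.std hdef).n x ∈ 𝔭 ∧ x ∉ scalarIdeal H 𝔭 := by
  by_contra! hcon
  have hfin := hH.finite_quot_scalarIdeal hp0
  have hfin' : Finite (𝓞 K ⧸ 𝔭) := Ideal.finiteQuotientOfFreeOfNeBot 𝔭 hp0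
  have h1 := index_le_of_forall (S := hH.std hdef) hp hfin hcon
  have h2 := hH.pow_four_le_card hp hp0
  have h3 : Nat.card (𝓞 K ⧸ 𝔭) = Ideal.absNorm 𝔭 := rfl
  rw [h3] at h1
  have h4 : 1 < Ideal.absNorm 𝔭 := by
    have h5 : Ideal.absNorm 𝔭 ≠ 1 := by rw [Ne, Ideal.absNorm_eq_one_iff]; exact hp.ne_top
    have h6 : Ideal.absNorm 𝔭 ≠ 0 := by rwa [Ne, Ideal.absNorm_eq_zero_iff]
    omega
  generalize Ideal.absNorm 𝔭 = N at *
  have h5 : N ^ 2 * N ^ 2 ≤ 2 * N ^ 2 := by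
    rw [← pow_add]; exact h2.trans h1
  have h6 := Nat.le_of_mul_le_mul_right h5 (by positivity)
  nlinarith

/-- The left ideal generated by a prime `𝔭` and a zero divisor modulo `𝔭` is principal, and the
norm of a generator generates `𝔭`. -/
theorem IsMaximalOrder.exists_sup_eq_span (hH : IsMaximalOrder H) (hdef : IsDefinite K a b)
    (hG : IsOrder G) (hperc : IsPerceptive G H) (hcls : classNumber G = 1) {𝔮 : Ideal (𝓞 K)}
    (hq : 𝔮.IsMaximal) (hq2 : ∀ t ∈ 𝔮 ^ 2, ∀ x ∈ H, t • x ∈ G) (hdisc : ¬ 𝔮 ∣ discrd H)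
    {𝔭 : Ideal (𝓞 K)} (hp : 𝔭.IsMaximal) (hp0 : 𝔭 ≠ ⊥) {x : H}
    (hx : (hH.1.std hdef).n x ∈ 𝔭) (hx' : x ∉ scalarIdeal H 𝔭) :
    ∃ y, Ideal.span {x} ⊔ scalarIdeal H 𝔭 = Ideal.span {y} ∧
      Ideal.span {(hH.1.std hdef).n y} = 𝔭 := by
  suffices ∃ y, Ideal.span {x} ⊔ scalarIdeal H 𝔭 = Ideal.span {y} by
    obtain ⟨y, hy⟩ := this
    exact ⟨y, hy, span_n_eq hp hp0 hx hx' hy⟩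
  by_cases hpq : 𝔭 = 𝔮
  · subst hpq
    refine StdInvolution.exists_sup_eq_span (hH.1.hasCramer hdef) hp hp0 ?_ (fun J c hc hcJ =>
      exists_eq_span hH hG hperc hcls hq hq2 J hc hcJ) hx hx'
    by_contra! hcon
    apply hdisc
    rw [Ideal.dvd_iff_le, discrd, Ideal.span_le]
    rintro d ⟨x, hx, y, hy, z, hz, hd⟩
    have h1 := hcon ⟨x, hx⟩ ⟨y, hy⟩ ⟨z, hz⟩
    have h2 := hH.1.coe_tr hdef ((⟨x, hx⟩ * ⟨y, hy⟩ - ⟨y, hy⟩ * ⟨x, hx⟩) *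
      (hH.1.std hdef).conj ⟨z, hz⟩)
    rwa [NumberField.RingOfIntegers.ext (h2.trans hd.symm)] at h1
  · have h1 : ¬ 𝔭 ≤ 𝔮 := fun h => hpq (hp.eq_of_le hq.ne_top h)
    obtain ⟨c, hc, hcq⟩ := SetLike.not_le_iff_exists.1 h1
    exact exists_eq_span hH hG hperc hcls hq hq2 _ hcq
      (Ideal.mem_sup_right (algebraMap_mem_scalarIdeal hc))

theorem IsOrder.isTotallyPositive_n (hH : IsOrder H) (hdef : IsDefinite K a b) {y : H}
    (hy : (hH.std hdef).n y ≠ 0) : IsTotallyPositive ((hH.std hdef).n y : K) := by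
  rw [hH.coe_n hdef]
  refine hdef _ fun h => hy ?_
  rw [show y = 0 from Subtype.ext h, n_zero]

omit [NumberField K] [NumberField.IsTotallyReal K] in
theorem smul_mem_of_quot_equiv {𝔮 : Ideal (𝓞 K)} {k : ℕ}
    (hquot : Nonempty ((↥(Subalgebra.toSubmodule H) ⧸
      (Subalgebra.toSubmodule G).submoduleOf (Subalgebra.toSubmodule H)) ≃ₗ[𝓞 K] (𝓞 K ⧸ 𝔮 ^ k)))
    (t : 𝓞 K) (ht : t ∈ 𝔮 ^ k) (x : Quat K a b) (hx : x ∈ H) : t • x ∈ G := by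
  obtain ⟨f⟩ := hquot
  have h1 : f (Submodule.Quotient.mk (t • (⟨x, hx⟩ : ↥(Subalgebra.toSubmodule H)))) = 0 := by
    rw [Submodule.Quotient.mk_smul, map_smul]
    obtain ⟨z, hz⟩ := Ideal.Quotient.mk_surjective (f (Submodule.Quotient.mk ⟨x, hx⟩))
    rw [← hz, Algebra.smul_def]
    change Ideal.Quotient.mk _ t * Ideal.Quotient.mk _ z = 0
    rw [Ideal.Quotient.eq_zero_iff_mem.2 ht, zero_mul]
  rw [LinearEquiv.map_eq_zero_iff, Submodule.Quotient.mk_eq_zero] at h1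
  exact h1

end

/-! ### Signs of units -/

section Signs

open NumberField NumberField.InfinitePlace

variable {K : Type*} [Field K] [NumberField.IsTotallyReal K]

/-- The real embedding attached to an infinite place of a totally real field. -/
def realEmb (v : InfinitePlace K) : K →+* ℝ := v.embedding_of_isReal (IsTotallyReal.isReal v)

theorem abs_realEmb (v : InfinitePlace K) (x : K) : |realEmb v x| = v x :=
  norm_embedding_of_isReal _ _

theorem exists_realEmb_eq (σ : K →+* ℝ) : ∃ v, realEmb v = σ := by
  have hreal : ComplexEmbedding.IsReal (Complex.ofRealHom.comp σ) := by
    ext x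
    simp
  refine ⟨InfinitePlace.mk (Complex.ofRealHom.comp σ), RingHom.ext fun x => ?_⟩
  have h1 := embedding_of_isReal_apply
    (IsTotallyReal.isReal (InfinitePlace.mk (Complex.ofRealHom.comp σ))) x
  rw [embedding_mk_eq_of_isReal hreal] at h1
  exact Complex.ofReal_injective h1

/-- The vector of signs of an element at the real places. -/
def signs (x : K) (v : InfinitePlace K) : Prop := 0 < realEmb v x

theorem isTotallyPositive_iff_signs {x : K} : IsTotallyPositive x ↔ signs x = signs 1 := by
  constructor
  · intro h
    funext v
    have h1 : signs (1 : K) v := by simp [signs]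
    exact propext ⟨fun _ => h1, fun _ => h _⟩
  · intro h σ
    obtain ⟨v, rfl⟩ := exists_realEmb_eq σ
    change signs x v
    rw [h]
    simp [signs]

theorem signs_mul {x : K} (hx : IsTotallyPositive x) (y : K) : signs (x * y) = signs y := by
  funext v
  refine propext ?_
  simp only [signs, map_mul]
  exact mul_pos_iff_of_pos_left (hx _)

omit [NumberField.IsTotallyReal K] in
theorem isTotallyPositive_sq {x : K} (hx : x ≠ 0) : IsTotallyPositive (x ^ 2) := fun σ => by
  rw [map_pow]
  exact sq_pos_of_ne_zero (by simpa using hx)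

variable [NumberField K]

/-- Algebraic integers of any prescribed signs exist, by weak approximation. -/
theorem exists_signs_eq (ε : InfinitePlace K → Prop) : ∃ x : 𝓞 K, x ≠ 0 ∧ signs (x : K) = ε := by
  classical
  let t : InfinitePlace K → K := fun v => if ε v then 1 else -1
  obtain ⟨x, hx⟩ := (denseRange_algebraMap_pi K).exists_mem_open
    (s := Set.univ.pi fun v => Metric.ball (WithAbs.toAbs v.1 (t v)) 1)
    (isOpen_set_pi Set.finite_univ fun v _ => Metric.isOpen_ball)
    ⟨fun v => WithAbs.toAbs v.1 (t v), fun v _ => Metric.mem_ball_self one_pos⟩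
  have hx' : ∀ v, |realEmb v x - realEmb v (t v)| < 1 := fun v => by
    have h1 := hx v trivial
    rw [Metric.mem_ball, dist_eq_norm] at h1
    rw [← map_sub, abs_realEmb]
    exact h1
  have hs : signs x = ε := by
    funext v
    have h1 := abs_lt.1 (hx' v)
    refine propext ?_
    by_cases h : ε v
    · simp only [t, h, if_true, map_one] at h1
      exact ⟨fun _ => h, fun _ => by simp only [signs]; linarith⟩
    · simp only [t, h, if_false, map_neg, map_one] at h1
      exact ⟨fun h2 => by simp only [signs] at h2; linarith, fun h2 => absurd h2 h⟩
  have hx0 : x ≠ 0 := by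
    rintro rfl
    obtain ⟨v⟩ := (inferInstance : Nonempty (InfinitePlace K))
    have h1 := hx' v
    rw [map_zero, zero_sub, abs_neg] at h1
    by_cases h : ε v <;> simp [t, h] at h1
  obtain ⟨n, d, hd, rfl⟩ := IsFractionRing.div_surjective (A := 𝓞 K) x
  have hd0 : (d : K) ≠ 0 := by simpa using nonZeroDivisors.ne_zero hd
  refine ⟨n * d, mul_ne_zero (fun h => hx0 (by simp [h])) (nonZeroDivisors.ne_zero hd), ?_⟩
  rw [← hs, ← signs_mul (isTotallyPositive_sq hd0) (algebraMap (𝓞 K) K n / _)]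
  congr 1
  change (n : K) * d = d ^ 2 * (n / d)
  field_simp

theorem torsion_eq (ζ : (𝓞 K)ˣ) (hζ : ζ ∈ Units.torsion K) : ζ = 1 ∨ ζ = -1 := by
  obtain ⟨v⟩ := (inferInstance : Nonempty (InfinitePlace K))
  have h1 := (Units.mem_torsion K).1 hζ v
  rw [← abs_realEmb] at h1
  rcases eq_or_eq_neg_of_abs_eq h1 with h | h
  · left
    refine Units.ext (RingOfIntegers.ext ((realEmb v).injective ?_))
    simpa using h
  · right
    refine Units.ext (RingOfIntegers.ext ((realEmb v).injective ?_))
    simpa using h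

/-- If every nonzero integer is a unit times a totally positive integer, then totally positive units
are squares. Indeed the units then realize all sign vectors, while by Dirichlet's unit theorem
they have at most as many classes modulo squares as there are sign vectors. -/
theorem exists_sq_eq_of_isTotallyPositive
    (h : ∀ x : 𝓞 K, x ≠ 0 → ∃ (ε : (𝓞 K)ˣ) (y : 𝓞 K), IsTotallyPositive (y : K) ∧ x = ε * y)
    {η : (𝓞 K)ˣ} (hη : IsTotallyPositive ((η : 𝓞 K) : K)) : ∃ ε : (𝓞 K)ˣ, η = ε ^ 2 := by
  classical
  -- Representatives of the classes of units modulo squares.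
  let u : ℤˣ × (Fin (Units.rank K) → Fin 2) → (𝓞 K)ˣ := fun t =>
    Units.map (Int.castRingHom (𝓞 K)) t.1 * ∏ i, Units.fundSystem K i ^ (t.2 i : ℕ)
  have hu : ∀ x : (𝓞 K)ˣ, ∃ t ε, x = ε ^ 2 * u t := by
    intro x
    obtain ⟨⟨ζ, f⟩, hζ, -⟩ := Units.exist_unique_eq_mul_prod K x
    simp only at hζ
    have hf : ∀ i, ∃ (k : ℤ) (r : Fin 2), f i = 2 * k + (r : ℕ) := fun i => by
      rcases Int.even_or_odd' (f i) with ⟨k, hk | hk⟩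
      · exact ⟨k, 0, by simpa using hk⟩
      · exact ⟨k, 1, by simpa using hk⟩
    choose k r hkr using hf
    obtain ⟨s, hs⟩ : ∃ s : ℤˣ, (ζ : (𝓞 K)ˣ) = Units.map (Int.castRingHom (𝓞 K)) s := by
      rcases torsion_eq _ ζ.2 with h | h
      · exact ⟨1, by rw [h, map_one]⟩
      · exact ⟨-1, by rw [h]; ext; simp⟩
    refine ⟨(s, r), ∏ i, Units.fundSystem K i ^ k i, ?_⟩
    rw [hζ, hs]
    simp only [u]
    rw [← Finset.prod_pow, mul_left_comm, ← Finset.prod_mul_distrib]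
    congr 1
    refine Finset.prod_congr rfl fun i _ => ?_
    rw [hkr, zpow_add, mul_comm 2, zpow_mul, zpow_natCast]
    rfl
  have hsq : ∀ (ε : (𝓞 K)ˣ) (x : 𝓞 K), signs ((((ε ^ 2 : (𝓞 K)ˣ) : 𝓞 K) * x : 𝓞 K) : K) =
      signs (x : K) := fun ε x => by
    rw [Units.val_pow_eq_pow_val]
    exact signs_mul (isTotallyPositive_sq (Units.coe_ne_zero ε)) _
  have hsurj : Function.Surjective fun t => signs ((u t : 𝓞 K) : K) := by
    intro ε
    obtain ⟨x, hx, rfl⟩ := exists_signs_eq ε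
    obtain ⟨e, y, hy, rfl⟩ := h x hx
    obtain ⟨t, e', rfl⟩ := hu e
    refine ⟨t, ?_⟩
    change signs ((u t : 𝓞 K) : K) = _
    rw [mul_comm, ← hsq e', ← Units.val_mul]
    exact (signs_mul hy _).symm
  -- There are `2 ^ (rank + 1)` representatives and as many sign vectors.
  have hbij := (Fintype.bijective_iff_surjective_and_card _).2 ⟨hsurj, by
    have h1 : Units.rank K + 1 = Fintype.card (InfinitePlace K) :=
      Nat.sub_add_cancel Fintype.card_pos
    simp [← h1, pow_succ, mul_comm]⟩
  obtain ⟨t, ε, rfl⟩ := hu η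
  refine ⟨ε, ?_⟩
  have h1 : u (1, 0) = 1 := by simp [u]
  have h2 : t = (1, 0) := hbij.1 (by
    change signs ((u t : 𝓞 K) : K) = signs ((u (1, 0) : 𝓞 K) : K)
    rw [Units.val_mul, isTotallyPositive_iff_signs, hsq] at hη
    rw [hη, h1]
    rfl)
  rw [h2, h1, mul_one]

end Signs

/-! ### Elements of given norm in the maximal order -/

section PrimesAreGood

variable {K : Type*} [Field K] [NumberField K] [NumberField.IsTotallyReal K] {a b : K}
variable {H : Subalgebra (𝓞 K) (Quat K a b)}

omit [NumberField K] [NumberField.IsTotallyReal K] in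
theorem IsTotallyPositive.mul {x y : K} (hx : IsTotallyPositive x) (hy : IsTotallyPositive y) :
    IsTotallyPositive (x * y) := fun σ => by
  rw [map_mul]
  exact mul_pos (hx σ) (hy σ)

omit [NumberField K] [NumberField.IsTotallyReal K] in
theorem IsTotallyPositive.of_mul {x y : K} (hx : IsTotallyPositive x)
    (hxy : IsTotallyPositive (x * y)) : IsTotallyPositive y := fun σ => by
  have h1 := hxy σ
  rw [map_mul] at h1
  exact (mul_pos_iff_of_pos_left (hx σ)).1 h1

omit [NumberField K] [NumberField.IsTotallyReal K] in
theorem IsTotallyPositive.pow {x : K} (hx : IsTotallyPositive x) (e : ℕ) :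
    IsTotallyPositive (x ^ e) := fun σ => by
  rw [map_pow]
  exact pow_pos (hx σ) e

/-- The left ideals of the order that are generated by a prime `𝔭` of the base field and a zero
divisor modulo `𝔭` are principal, with a generator whose norm generates `𝔭`. -/
def IsOrder.PrincipalAtPrimes (hH : IsOrder H) (hdef : IsDefinite K a b) : Prop :=
  ∀ 𝔭 : Ideal (𝓞 K), 𝔭.IsMaximal → 𝔭 ≠ ⊥ → ∀ x, (hH.std hdef).n x ∈ 𝔭 → x ∉ scalarIdeal H 𝔭 →
    ∃ y, Ideal.span {x} ⊔ scalarIdeal H 𝔭 = Ideal.span {y} ∧ Ideal.span {(hH.std hdef).n y} = 𝔭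

variable {hH : IsOrder H} {hdef : IsDefinite K a b}

namespace IsOrder.PrincipalAtPrimes

variable (hP : hH.PrincipalAtPrimes hdef)
include hP

/-- Every prime ideal is generated by a reduced norm. -/
theorem exists_isTotallyPositive_span_eq {𝔭 : Ideal (𝓞 K)} (hp : 𝔭.IsMaximal) (hp0 : 𝔭 ≠ ⊥) :
    ∃ π : 𝓞 K, IsTotallyPositive (π : K) ∧ Ideal.span {π} = 𝔭 := by
  obtain ⟨x, hx, hx'⟩ := hH.exists_not_mem_scalarIdeal hdef hp hp0
  obtain ⟨y, -, hy⟩ := hP 𝔭 hp hp0 x hx hx'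
  refine ⟨_, hH.isTotallyPositive_n hdef (y := y) fun h => hp0 ?_, hy⟩
  rw [← hy, h, Ideal.span_singleton_eq_bot.2 rfl]

theorem exists_prime_dvd {x : 𝓞 K} (hx0 : x ≠ 0) (hx : ¬ IsUnit x) :
    ∃ π : 𝓞 K, IsTotallyPositive (π : K) ∧ Prime π ∧ π ∣ x := by
  obtain ⟨𝔭, hp, hxp⟩ := Ideal.exists_le_maximal _ (mt Ideal.span_singleton_eq_top.1 hx)
  have hp0 : 𝔭 ≠ ⊥ := by
    rintro rfl
    exact hx0 (by simpa using hxp)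
  obtain ⟨π, hπ, rfl⟩ := hP.exists_isTotallyPositive_span_eq hp hp0
  exact ⟨π, hπ, (Ideal.span_singleton_prime (by simpa using hp0)).1 hp.isPrime,
    Ideal.mem_span_singleton.1 (hxp (Ideal.mem_span_singleton_self x))⟩

theorem exists_unit_mul {x : 𝓞 K} (hx : x ≠ 0) :
    ∃ (ε : (𝓞 K)ˣ) (y : 𝓞 K), IsTotallyPositive (y : K) ∧ x = ε * y := by
  induction x using (wellFounded_dvdNotUnit (α := 𝓞 K)).induction with
  | _ x ih =>
  by_cases hu : IsUnit x
  · exact ⟨hu.unit, 1, fun σ => by simp, by simp⟩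
  · obtain ⟨π, hπ, hp, z, rfl⟩ := hP.exists_prime_dvd hx hu
    have hz := right_ne_zero_of_mul hx
    obtain ⟨ε, y, hy, rfl⟩ := ih z ⟨hz, π, hp.not_isUnit, mul_comm _ _⟩ hz
    exact ⟨ε, π * y, hπ.mul hy, by ring⟩

theorem exists_sq_eq {η : (𝓞 K)ˣ} (hη : IsTotallyPositive ((η : 𝓞 K) : K)) :
    ∃ ε : (𝓞 K)ˣ, η = ε ^ 2 :=
  exists_sq_eq_of_isTotallyPositive (fun _ hx => hP.exists_unit_mul hx) hη

/-- A totally positive prime element is the norm of the generators of the left ideals above it,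
because totally positive units are squares. -/
theorem isGoodPrime {π : 𝓞 K} (hπ : IsTotallyPositive (π : K)) (hp : Prime π) :
    (hH.std hdef).IsGoodPrime π (Ideal.absNorm (Ideal.span {π})) := by
  have hp0 : Ideal.span {π} ≠ ⊥ := by simpa using hp.ne_zero
  have hmax : (Ideal.span {π}).IsMaximal :=
    ((Ideal.span_singleton_prime hp.ne_zero).2 hp).isMaximal hp0
  refine ⟨hp, hmax, rfl, ?_, fun y hy => ?_, ?_, fun x hx hx' => ?_, ?_⟩
  · have h5 : Ideal.absNorm (Ideal.span {π}) ≠ 1 := by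
      rw [Ne, Ideal.absNorm_eq_one_iff]; exact hmax.ne_top
    have h6 : Ideal.absNorm (Ideal.span {π}) ≠ 0 := by rwa [Ne, Ideal.absNorm_eq_zero_iff]
    omega
  · rw [hH.index_span hdef (by rw [hy]; exact hp.ne_zero), hy]
  · rw [← span_algebraMap_eq, hH.index_span_algebraMap hp.ne_zero]
  · obtain ⟨y, hy, hny⟩ := hP _ hmax hp0 x (Ideal.mem_span_singleton.2 hx) hx'
    obtain ⟨η, hη⟩ := Ideal.span_singleton_eq_span_singleton.1 hny
    have hy0 : (hH.std hdef).n y ≠ 0 := by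
      rintro h
      rw [h, zero_mul] at hη
      exact hp.ne_zero hη.symm
    have hηpos : IsTotallyPositive ((η : 𝓞 K) : K) := by
      rw [← hη] at hπ
      exact (hH.isTotallyPositive_n hdef hy0).of_mul hπ
    obtain ⟨ε, rfl⟩ := hP.exists_sq_eq hηpos
    refine ⟨algebraMap (𝓞 K) H ε * y, ?_, hy.trans ?_⟩
    · rw [n_mul, n_algebraMap, ← hη, mul_comm, Units.val_pow_eq_pow_val]
    · exact (Ideal.span_singleton_mul_left_unit (ε.isUnit.map (algebraMap (𝓞 K) H)) y).symm
  · obtain ⟨x, hx, hx'⟩ := hH.exists_not_mem_scalarIdeal hdef hmax hp0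
    exact ⟨x, Ideal.mem_span_singleton.1 hx, hx'⟩

end IsOrder.PrincipalAtPrimes

theorem IsOrder.finite_n_eq (hH : IsOrder H) (hdef : IsDefinite K a b) (c : 𝓞 K) :
    {x | (hH.std hdef).n x = c}.Finite :=
  Set.Finite.of_finite_image (f := Subtype.val) ((finite_nrd_eq hH hdef (c : K)).subset (by
    rintro _ ⟨x, hx, rfl⟩
    exact ⟨x.2, (hH.n_eq_iff hdef x c).1 hx⟩)) Subtype.val_injective.injOn

theorem IsOrder.dvdDisc_iff (hH : IsOrder H) (hdef : IsDefinite K a b) (π : 𝓞 K) :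
    (hH.std hdef).DvdDisc π ↔ Ideal.span {π} ∣ discrd H := by
  have hcoe := fun x y z : H => hH.coe_tr hdef ((x * y - y * x) * (hH.std hdef).conj z)
  rw [Ideal.dvd_iff_le, discrd, Ideal.span_le]
  constructor
  · rintro h d ⟨x, hx, y, hy, z, hz, hd⟩
    have h1 := hcoe ⟨x, hx⟩ ⟨y, hy⟩ ⟨z, hz⟩
    rw [NumberField.RingOfIntegers.ext (hd.trans h1.symm)]
    exact Ideal.mem_span_singleton.2 (h _ _ _)
  · intro h x y z
    exact Ideal.mem_span_singleton.1 (h ⟨x.1, x.2, y.1, y.2, z.1, z.2, hcoe x y z⟩)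

/-- Both sides satisfy the same recursion at each prime, and agree at units since totally positive
units are squares. -/
theorem IsOrder.PrincipalAtPrimes.repNum_eq (hP : hH.PrincipalAtPrimes hdef) {α : 𝓞 K}
    (hα : IsTotallyPositive (α : K)) :
    (hH.std hdef).repNum α = (hH.std hdef).repNum 1 * sigma (discrd H) α := by
  classical
  have hfin := hH.finite_n_eq hdef
  induction α using (wellFounded_dvdNotUnit (α := 𝓞 K)).induction with
  | _ α ih =>
  have hα0 : α ≠ 0 := fun h => hα.ne_zero (by rw [h]; rfl)
  by_cases hu : IsUnit α
  · obtain ⟨ε, hε⟩ := hP.exists_sq_eq (η := hu.unit) hα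
    have hε' : α = ε ^ 2 := by
      rw [← Units.val_pow_eq_pow_val, ← hε, IsUnit.unit_spec]
    rw [sigma_unit _ hu, mul_one, repNum, repNum]
    have hset : {x | (hH.std hdef).n x = α} =
        (algebraMap (𝓞 K) H ε * ·) '' {x | (hH.std hdef).n x = 1} := by
      ext x
      constructor
      · intro hx
        refine ⟨algebraMap (𝓞 K) H (ε⁻¹ : (𝓞 K)ˣ) * x, ?_, ?_⟩
        · change (hH.std hdef).n _ = 1
          rw [n_mul, n_algebraMap, hx, hε', ← mul_pow, Units.inv_mul, one_pow]
        · change _ * (_ * x) = x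
          rw [← mul_assoc, ← map_mul, Units.mul_inv, map_one, one_mul]
      · rintro ⟨y, hy, rfl⟩
        change (hH.std hdef).n _ = α
        rw [n_mul, n_algebraMap, hy, mul_one, hε']
    rw [hset, Set.ncard_image_of_injective]
    exact fun x y h => (hH.std hdef).algebraMap_mul_cancel ε.ne_zero h
  · obtain ⟨π, hπ, hp, hdvd⟩ := hP.exists_prime_dvd hα0 hu
    obtain ⟨γ, hγ, hπγ⟩ :=
      (FiniteMultiplicity.of_prime_left hp hα0).exists_eq_pow_mul_and_not_dvd
    generalize multiplicity π α = e at hγ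
    subst hγ
    have hγ0 := right_ne_zero_of_mul hα0
    have he : e ≠ 0 := by
      rintro rfl
      rw [pow_zero, one_mul] at hdvd
      exact hπγ hdvd
    have hγpos : IsTotallyPositive (γ : K) := (hπ.pow e).of_mul hα
    rw [(hP.isGoodPrime hπ hp).repNum_pow_mul hfin hπγ,
      ih γ ⟨hγ0, π ^ e, fun h => hp.not_isUnit ((isUnit_pow_iff he).1 h), mul_comm _ _⟩ hγpos,
      sigma_pow_mul _ hp hγ0 hπγ, excess]
    simp only [hH.dvdDisc_iff hdef]
    ring

end PrimesAreGood

end QuatOrder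

end

/-! ### Elements of given norm in the suborder -/

theorem mainTheorem6 {K : Type*} [Field K] [NumberField K] [NumberField.IsTotallyReal K]
    (a b : K) (hdef : QuatOrder.IsDefinite K a b)
    (G H : Subalgebra (𝓞 K) (QuatOrder.Quat K a b))
    (hH : QuatOrder.IsMaximalOrder H) (hG : QuatOrder.IsOrder G)
    (hperc : QuatOrder.IsPerceptive G H) (hcls : QuatOrder.classNumber G = 1)
    (𝔮 : Ideal (𝓞 K)) (h𝔮 : Prime 𝔮)
    (hquot : Nonempty
      ((↥(Subalgebra.toSubmodule H) ⧸
          (Subalgebra.toSubmodule G).submoduleOf (Subalgebra.toSubmodule H)) ≃ₗ[𝓞 K]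
        (𝓞 K ⧸ 𝔮 ^ 2)))
    (hdisc : ¬ 𝔮 ∣ QuatOrder.discrd H)
    (α : 𝓞 K) (hα : QuatOrder.IsTotallyPositive (α : K))
    (e : ℕ) (he : α ∈ 𝔮 ^ e) (he' : α ∉ 𝔮 ^ (e + 1)) :
    (QuatOrder.normOne G).Finite ∧ (QuatOrder.normFiber G α).Finite ∧
      (QuatOrder.rep G α : ℤ) =
        (QuatOrder.normOne G).ncard * QuatOrder.sigma (𝔮 * QuatOrder.discrd H) α *
          QuatOrder.localFactor (Ideal.absNorm 𝔮) e := by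
  refine ⟨QuatOrder.finite_nrd_eq hG hdef 1, QuatOrder.finite_nrd_eq hG hdef α, ?_⟩
  have hmax : 𝔮.IsMaximal := (Ideal.isPrime_of_prime h𝔮).isMaximal h𝔮.ne_zero
  have hP : hH.1.PrincipalAtPrimes hdef := fun 𝔭 hp hp0 x hx hx' =>
    hH.exists_sup_eq_span hdef hG hperc hcls hmax (QuatOrder.smul_mem_of_quot_equiv hquot) hdisc
      hp hp0 hx hx'
  obtain ⟨β, hβpos, rfl⟩ := hP.exists_isTotallyPositive_span_eq hmax h𝔮.ne_zero
  have hβ : Prime β := (Ideal.prime_span_singleton_iff).1 h𝔮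
  rw [Ideal.span_singleton_pow, Ideal.mem_span_singleton] at he he'
  obtain ⟨γ, rfl⟩ := he
  have hβγ : ¬ β ∣ γ := fun ⟨c, hc⟩ => he' ⟨c, by rw [hc]; ring⟩
  have hγ0 : γ ≠ 0 := fun h => hβγ (h ▸ dvd_zero β)
  have hγpos : QuatOrder.IsTotallyPositive (γ : K) := (hβpos.pow e).of_mul hα
  -- The isomorphism `ℋ / 𝒢 ≃ 𝓞 K / 𝔮²` turned into a functional on `ℋ` with kernel `𝒢`.
  obtain ⟨f⟩ := hquot
  let f' := f.trans (Submodule.quotEquivOfEq _ _ (Ideal.span_singleton_pow β 2))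
  let φ : H →ₗ[𝓞 K] 𝓞 K ⧸ Ideal.span {β ^ 2} := f'.toLinearMap ∘ₗ Submodule.mkQ _
  have hsub : QuatOrder.StdInvolution.IsPerceptiveSub (hH.1.std hdef) β
      (Ideal.absNorm (Ideal.span {β})) (G.comap H.val) φ :=
    { good := hP.isGoodPrime hβpos hβ
      cramer := hH.1.hasCramer hdef
      not_dvdDisc := by rwa [hH.1.dvdDisc_iff hdef]
      card_quot_sq := by
        change Ideal.absNorm (Ideal.span {β ^ 2}) = _
        rw [← Ideal.span_singleton_pow, map_pow]
      surj := f'.surjective.comp (Submodule.mkQ_surjective _)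
      ker := fun x => by
        change f' (Submodule.Quotient.mk x) = 0 ↔ _
        rw [LinearEquiv.map_eq_zero_iff, Submodule.Quotient.mk_eq_zero]
        rfl
      perc := fun x => by
        obtain ⟨u, ⟨huH, hu⟩, hux⟩ := hperc.2 x.1 x.2
        exact ⟨⟨u, huH⟩, (hH.1.n_eq_iff hdef _ _).2 hu, hux⟩ }
  have hcount : ∀ c : 𝓞 K, {q | q ∈ G ∧ QuatOrder.nrd q = (c : K)}.ncard =
      {x | (hH.1.std hdef).n x = c ∧ x ∈ G.comap H.val}.ncard := fun c => by
    rw [← Set.ncard_image_of_injective _ Subtype.val_injective]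
    congr 1
    ext q
    constructor
    · rintro ⟨hq, hqc⟩
      exact ⟨⟨q, hperc.1 hq⟩, ⟨(hH.1.n_eq_iff hdef _ _).2 hqc, hq⟩, rfl⟩
    · rintro ⟨x, ⟨hxc, hx⟩, rfl⟩
      exact ⟨hx, (hH.1.n_eq_iff hdef _ _).1 hxc⟩
  have hone : (QuatOrder.normOne G).ncard =
      QuatOrder.StdInvolution.IsPerceptiveSub.unitCount (hH.1.std hdef) (G.comap H.val) 1 := by
    have h1 := hcount 1
    simp only [QuatOrder.StdInvolution.IsPerceptiveSub.unitCount, mul_one]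
    exact h1
  have hsigma : QuatOrder.sigma (Ideal.span {β} * QuatOrder.discrd H) (β ^ e * γ) =
      QuatOrder.sigma (QuatOrder.discrd H) γ := by
    rw [QuatOrder.sigma_pow_mul _ hβ hγ0 hβγ, if_pos (dvd_mul_right _ _),
      QuatOrder.sigma_mul_prime _ hβ hβγ, Finset.sum_range_succ',
      Finset.sum_eq_zero fun i _ => zero_pow i.succ_ne_zero, zero_add, pow_zero, one_mul]
  rw [hsigma, hone, ← hsub.repSub_eq (hH.1.finite_n_eq hdef) hβγ (hP.repNum_eq hγpos) e]
  exact congrArg Nat.cast (hcount _)
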